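/- Let $(\mathcal K,[\cdot,\cdot])$ be a complex Krein space, let $C^+$ denote the Krein space adjoint of $C\in B(\mathcal K)$, and let $N\in B(\mathcal K)$ be normal, i.e. $NN^+=N^+N$. Put $A=\frac{N+N^+}{2}$ and $B=\frac{N-N^+}{2i}$. A polynomial $p\in\mathbb C[x,y]\setminus\{0\}$ is called definitizing for $N$ if $[p(A,B)v,v]\ge 0$ for all $v\in\mathcal K$. Let $I\subseteq\mathbb C[x,y]$ be the ideal generated by all definitizing polynomials with real coefficients, and assume that $I$ is zero-dimensional, i.e. $\dim\mathbb C[x,y]/I<\infty$. Let $p_1,\dots,p_m$ be real definitizing polynomials which generate $I$. For a polynomial $q$ and $z\in\mathbb C$ write $q(z):=q(\operatorname{Re}z,\operatorname{Im}z)$. **Hilbert spaces.** For $C\in B(\mathcal K)$ with $[Cv,v]\ge0$ for all $v$, the Hilbert space completion of $\mathcal K/\ker C$ with respect to $[C\cdot,\cdot]$, together with the adjoint of the factor mapping from $\mathcal K$ into it, is a Hilbert space with a bounded injective operator into $\mathcal K$ whose product with its adjoint is $C$. Let $T_k:\mathcal H_k\to\mathcal K$ be the operator obtained in this way from $C=p_k(A,B)$,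 and $T:\mathcal H\to\mathcal K$ the one obtained from $C=\sum_{k=1}^m p_k(A,B)$, so that $T_kT_k^+=p_k(A,B)$ and $TT^+=\sum_k p_k(A,B)$. Put $\Theta(N)=T^{-1}NT\in B(\mathcal H)$ and $\Theta_k(N)=T_k^{-1}NT_k\in B(\mathcal H_k)$. These are normal operators; let $E_k$ be the spectral measure of $\Theta_k(N)$, and let $S:=\sigma(\Theta(N))\subseteq\mathbb C$ (with $\sigma=\emptyset$ on the zero space). **Local algebras.** Let $V(I)\subseteq\mathbb C^2$ be the (finite) set of common zeros of $I$, and $V_{\mathbb R}(I)=V(I)\cap\mathbb R^2$, regarded as a subset of $\mathbb C$ via $(x,y)\mapsto x+iy$. For $a=(a_1,a_2)\in V(I)$ let $P(a)=\langle x-a_1,y-a_2\rangle$, and let $Q(a)$ be the component with radical $P(a)$ in the unique minimal primary decomposition of $I$. Put $\mathcal A(a)=\mathbb C[x,y]/(P(a)\cdot Q(a))$ and $\mathcal B(a)=\mathbb C[x,y]/Q(a)$. The map $f\mapsto f^\#$, $f^\#(x,y)=\overline{f(\bar x,\bar y)}$, induces conjugate linear bijections $\mathcal A(a)\to\mathcal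 A(\bar a)$ and $\mathcal B(a)\to\mathcal B(\bar a)$, also denoted by $^\#$, where $\bar a=(\bar a_1,\bar a_2)$. **Functions.** Let $\mathcal M_N$ be the algebra, with pointwise operations, of all functions $\phi$ on $(S\cup V_{\mathbb R}(I))\,\dot\cup\,(V(I)\setminus\mathbb R^2)$ with $\phi(z)\in\mathbb C$ for $z\in S\setminus V_{\mathbb R}(I)$, $\phi(z)\in\mathcal A(z)$ for $z\in V_{\mathbb R}(I)$, and $\phi(a)\in\mathcal B(a)$ for $a\in V(I)\setminus\mathbb R^2$. It carries the involution given by $\phi^\#(z)=\overline{\phi(z)}$, $\phi^\#(z)=\phi(z)^\#$ and $\phi^\#(a)=\phi(\bar a)^\#$ on these three sets, respectively. For $q\in\mathbb C[x,y]$ let $q_N\in\mathcal M_N$ be the function with $q_N(z)=q(z)$, $q_N(z)=q+P(z)\cdot Q(z)$ and $q_N(a)=q+Q(a)$ on these three sets. Let $\mathcal F_N$ be the set of all $\phi\in\mathcal M_N$ which are bounded and Borel measurable on $S\setminus V_{\mathbb R}(I)$ and such that, for every $w\in S\cap V_{\mathbb R}(I)$ which is not isolated in $S$, $$\phi(z)-q(z)=O\Big(\max_{j}|h_j(z)|\Big)\quad\text{as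 } S\setminus V_{\mathbb R}(I)\ni z\to w ,$$ where $h_1,\dots,h_n$ generate the ideal $Q(w)$ and $q\in\mathbb C[x,y]$ is a representative of $\phi(w)$ (this does not depend on the choices). **Theorem.** The set $\mathcal F_N$ is a unital subalgebra of $\mathcal M_N$ invariant under $^\#$. For every $\phi\in\mathcal F_N$ there are $r\in\mathbb C[x,y]$ and bounded Borel measurable functions $f_1,\dots,f_m:S\cup V_{\mathbb R}(I)\to\mathbb C$ vanishing on $V_{\mathbb R}(I)$ such that $$\phi=r_N+\sum_{j=1}^m f_j\,(p_j)_N\ \text{ on } S\cup V_{\mathbb R}(I),\qquad \phi=r_N\ \text{ on } V(I)\setminus\mathbb R^2 ,$$ and the operator $$\phi(N):=r(A,B)+\sum_{k=1}^m T_k\Big(\int_{\sigma(\Theta_k(N))} f_k\,dE_k\Big)T_k^+\in B(\mathcal K)$$ does not depend on the choice of such $r,f_1,\dots,f_m$. The map $\phi\mapsto\phi(N)$ is a unital $*$-homomorphism from $\mathcal F_N$ into the bicommutant $\{N,N^+\}''\subseteq B(\mathcal K)$, i.e. it is linear and multiplicative and satisfies $\phi^\#(N)=\phi(N)^+$. Moreover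 $q_N\in\mathcal F_N$ and $q_N(N)=q(A,B)$ for every $q\in\mathbb C[x,y]$. -/

import Mathlib

open scoped ComplexConjugate InnerProductSpace ComplexOrder Topology

noncomputable section

namespace KreinNormal

/-! ### Krein spaces -/

/-- A Krein space, presented through a fundamental symmetry: `K` carries a Hilbert space structure
`⟪·, ·⟫` inducing its topology, and the indefinite inner product is `[x, y] = ⟪x, J y⟫`, where
`J` is selfadjoint with `J² = 1`.  (The positive and negative parts of the fundamental
decomposition are the kernels of `J - 1` and `J + 1`.)  Every notion below depends only on
`[·, ·]` and on the topology of `K`. -/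
class KreinSpace (K : Type*) [NormedAddCommGroup K] [InnerProductSpace ℂ K]
    [CompleteSpace K] where
  /-- the fundamental symmetry -/
  J : K →L[ℂ] K
  isSelfAdjoint_J : IsSelfAdjoint J
  J_mul_J : J * J = 1

section Krein

variable {K : Type*} [NormedAddCommGroup K] [InnerProductSpace ℂ K] [CompleteSpace K]
  [KreinSpace K]

/-- The indefinite inner product `[x, y]`; as for Mathlib's inner products it is conjugate linear
in the first and linear in the second argument. -/
def form (x y : K) : ℂ := ⟪x, KreinSpace.J y⟫_ℂ

/-- The Krein space adjoint `C⁺` of `C ∈ B(K)`: `[C x, y] = [x, C⁺ y]`. -/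
def kreinAdjoint (C : K →L[ℂ] K) : K →L[ℂ] K :=
  KreinSpace.J * C.adjoint * KreinSpace.J

/-- The adjoint `T⁺ : K → H` of an operator `T : H → K` from a Hilbert space into the Krein space:
`[T h, x] = ⟪h, T⁺ x⟫`. -/
def adjointFrom {H : Type*} [NormedAddCommGroup H] [InnerProductSpace ℂ H] [CompleteSpace H]
    (T : H →L[ℂ] K) : K →L[ℂ] H :=
  T.adjoint ∘L KreinSpace.J

theorem J_J (x : K) : KreinSpace.J (KreinSpace.J x) = x := by
  have h := congrArg (fun C : K →L[ℂ] K => C x) (KreinSpace.J_mul_J (K := K))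
  simpa using h

theorem inner_J_left (x y : K) : ⟪KreinSpace.J x, y⟫_ℂ = ⟪x, KreinSpace.J y⟫_ℂ := by
  have h : (KreinSpace.J : K →L[ℂ] K).adjoint = KreinSpace.J := KreinSpace.isSelfAdjoint_J
  rw [← ContinuousLinearMap.adjoint_inner_left, h]

theorem form_kreinAdjoint (C : K →L[ℂ] K) (x y : K) :
    form (C x) y = form x (kreinAdjoint C y) := by
  simp [form, kreinAdjoint, J_J, ContinuousLinearMap.adjoint_inner_right]

theorem form_adjointFrom {H : Type*} [NormedAddCommGroup H] [InnerProductSpace ℂ H]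
    [CompleteSpace H] (T : H →L[ℂ] K) (h : H) (x : K) :
    form (T h) x = ⟪h, adjointFrom T x⟫_ℂ := by
  simp [form, adjointFrom, ContinuousLinearMap.adjoint_inner_right]

/-- `N` is normal: it commutes with its Krein space adjoint. -/
def IsKreinNormal (N : K →L[ℂ] K) : Prop := N * kreinAdjoint N = kreinAdjoint N * N

/-- The real part `A = (N + N⁺) / 2`. -/
def rePart (N : K →L[ℂ] K) : K →L[ℂ] K := (2 : ℂ)⁻¹ • (N + kreinAdjoint N)

/-- The imaginary part `B = (N - N⁺) / (2 i)`. -/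
def imPart (N : K →L[ℂ] K) : K →L[ℂ] K := (2 * Complex.I)⁻¹ • (N - kreinAdjoint N)

/-- The bicommutant `{N, N⁺}''` in `B(K)`. -/
def bicommutant (N : K →L[ℂ] K) : Set (K →L[ℂ] K) :=
  Set.centralizer (Set.centralizer {N, kreinAdjoint N})

end Krein

/-! ### Polynomials in two variables and definitizability -/

/-- The ring `ℂ[x, y]`; `x` is `X 0` and `y` is `X 1`. -/
abbrev Poly : Type := MvPolynomial (Fin 2) ℂ

/-- `q(A, B)` for elements `A`, `B` of an algebra (used for commuting `A`, `B`). -/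
def polyOp {R : Type*} [Ring R] [Algebra ℂ R] (q : Poly) (A B : R) : R :=
  ∑ s ∈ q.support, q.coeff s • (A ^ s 0 * B ^ s 1)

/-- The embedding `x + i y ↦ (x, y)` of `ℂ` into `ℂ²`. -/
def tau (z : ℂ) : Fin 2 → ℂ := ![(z.re : ℂ), (z.im : ℂ)]

/-- `q(z) = q(Re z, Im z)`. -/
def evalC (q : Poly) (z : ℂ) : ℂ := MvPolynomial.eval (tau z) q

/-- `q` has real coefficients. -/
def IsRealPoly (q : Poly) : Prop := ∀ s, (q.coeff s).im = 0

section Definitizing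

variable {K : Type*} [NormedAddCommGroup K] [InnerProductSpace ℂ K] [CompleteSpace K]
  [KreinSpace K]

/-- `[P v, v] ≥ 0` for all `v` (in particular these numbers are real). -/
def FormNonneg (P : K →L[ℂ] K) : Prop := ∀ v : K, 0 ≤ form v (P v)

/-- `q(A, B)`, where `A` and `B` are the real and imaginary parts of `N`. -/
def polyAt (N : K →L[ℂ] K) (q : Poly) : K →L[ℂ] K := polyOp q (rePart N) (imPart N)

/-- `q` is a definitizing polynomial for `N`. -/
def IsDefinitizing (N : K →L[ℂ] K) (q : Poly) : Prop := q ≠ 0 ∧ FormNonneg (polyAt N q)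

/-- The ideal `I` of `ℂ[x, y]` generated by all real definitizing polynomials of `N`. -/
def definitizingIdeal (N : K →L[ℂ] K) : Ideal Poly :=
  Ideal.span {q | IsRealPoly q ∧ IsDefinitizing N q}

theorem FormNonneg.sum {m : ℕ} {P : Fin m → K →L[ℂ] K} (h : ∀ k, FormNonneg (P k)) :
    FormNonneg (∑ k, P k) := by
  intro v
  have : form v ((∑ k, P k) v) = ∑ k, form v (P k v) := by
    simp [form, map_sum]
  rw [this]
  exact Finset.sum_nonneg fun k _ => h k v

end Definitizing

/-! ### The Hilbert space and the embedding attached to a nonnegative operator -/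

section Factor

variable {K : Type*} [NormedAddCommGroup K] [InnerProductSpace ℂ K] [CompleteSpace K]
  [KreinSpace K]

/-- `K` with the positive semidefinite inner product `[P ·, ·]`. -/
def PreFactor (P : K →L[ℂ] K) (_ : FormNonneg P) : Type _ := K

variable (P : K →L[ℂ] K) (hP : FormNonneg P)

instance : AddCommGroup (PreFactor P hP) := inferInstanceAs (AddCommGroup K)

instance : Module ℂ (PreFactor P hP) := inferInstanceAs (Module ℂ K)

variable {P} in
theorem FormNonneg.conj_form (hP : FormNonneg P) (x y : K) :
    conj (form y (P x)) = form x (P y) := by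
  have hpos : (KreinSpace.J ∘L P).IsPositive := by
    rw [ContinuousLinearMap.isPositive_iff_complex]
    intro v
    have h := hP v
    rw [Complex.nonneg_iff] at h
    have hs : ⟪(KreinSpace.J ∘L P) v, v⟫_ℂ = conj (form v (P v)) := by
      simp [form, inner_conj_symm]
    rw [hs]
    refine ⟨?_, by simpa using h.1⟩
    apply Complex.ext
    · simp
    · simp [← h.2]
  have := hpos.isSymmetric x y
  simp only [form, inner_conj_symm]
  simpa using this

/-- The inner product `[x, P y]` on `K`. -/
instance preFactorCore : PreInnerProductSpace.Core ℂ (PreFactor P hP) where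
  inner x y := form (K := K) x (P y)
  conj_inner_symm x y := hP.conj_form (K := K) x y
  re_inner_nonneg x := (Complex.nonneg_iff.1 (hP x)).1
  add_left x y _ := inner_add_left (𝕜 := ℂ) (E := K) x y _
  smul_left x _ r := inner_smul_left (𝕜 := ℂ) (E := K) x _ r

instance : SeminormedAddCommGroup (PreFactor P hP) :=
  InnerProductSpace.Core.toSeminormedAddCommGroup (𝕜 := ℂ)

instance : InnerProductSpace ℂ (PreFactor P hP) := .ofCore _

/-- The Hilbert space completion of `K / ker P` with respect to `[P ·, ·]`.  (The completion of a
seminormed space is Hausdorff, so it identifies vectors at distance zero.) -/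
abbrev FactorSpace : Type _ := UniformSpace.Completion (PreFactor P hP)

/-- The factor mapping `K → FactorSpace P hP`. -/
def factorQuot : K →L[ℂ] FactorSpace P hP :=
  LinearMap.mkContinuous
    { toFun := fun x => ((show PreFactor P hP from x : PreFactor P hP) : FactorSpace P hP)
      map_add' := fun x y => UniformSpace.Completion.coe_add (α := PreFactor P hP) x y
      map_smul' := fun c x => UniformSpace.Completion.coe_smul (X := PreFactor P hP) c x }
    (Real.sqrt ‖(KreinSpace.J : K →L[ℂ] K) ∘L P‖) (by
      intro x
      change ‖((show PreFactor P hP from x : PreFactor P hP) : FactorSpace P hP)‖ ≤ _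
      rw [UniformSpace.Completion.norm_coe]
      refine le_of_sq_le_sq ?_ (by positivity)
      rw [mul_pow, Real.sq_sqrt (norm_nonneg _),
        @norm_sq_eq_re_inner ℂ (PreFactor P hP) _ _ _ x]
      calc RCLike.re (form (K := K) x (P x)) ≤ ‖form (K := K) x (P x)‖ := RCLike.re_le_norm _
        _ ≤ ‖x‖ * ‖((KreinSpace.J : K →L[ℂ] K) ∘L P) x‖ := norm_inner_le_norm (𝕜 := ℂ) (E := K) _ _
        _ ≤ ‖x‖ * (‖(KreinSpace.J : K →L[ℂ] K) ∘L P‖ * ‖x‖) := by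
            gcongr; exact ContinuousLinearMap.le_opNorm _ _
        _ = _ := by ring)

/-- The operator `T : FactorSpace P hP → K`, the adjoint of the factor mapping. -/
def factorMap : FactorSpace P hP →L[ℂ] K :=
  KreinSpace.J ∘L (factorQuot P hP).adjoint

theorem inner_factorQuot (x y : K) :
    ⟪factorQuot P hP x, factorQuot P hP y⟫_ℂ = form x (P y) :=
  UniformSpace.Completion.inner_coe (𝕜 := ℂ) (E := PreFactor P hP) x y

theorem adjointFrom_factorMap : adjointFrom (factorMap P hP) = factorQuot P hP := by
  ext x
  refine ext_inner_left ℂ fun h => ?_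
  rw [← form_adjointFrom]
  simp [form, factorMap, inner_J_left, J_J, ContinuousLinearMap.adjoint_inner_left]

/-- `T T⁺ = P`. -/
theorem factorMap_comp_adjointFrom : factorMap P hP ∘L adjointFrom (factorMap P hP) = P := by
  ext x
  have h : KreinSpace.J (factorMap P hP (factorQuot P hP x)) = KreinSpace.J (P x) := by
    refine ext_inner_left ℂ fun y => ?_
    have := inner_factorQuot P hP y x
    simpa [factorMap, J_J, form, ContinuousLinearMap.adjoint_inner_right] using this
  have h2 := congrArg KreinSpace.J h
  rw [J_J, J_J] at h2
  rw [adjointFrom_factorMap]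
  exact h2

theorem factorMap_injective : Function.Injective (factorMap P hP) := by
  rw [injective_iff_map_eq_zero]
  intro h hh
  have h0 : ∀ x, ⟪h, factorQuot P hP x⟫_ℂ = 0 := by
    intro x
    rw [← adjointFrom_factorMap, ← form_adjointFrom, hh]
    simp [form]
  have hd : DenseRange (factorQuot P hP) :=
    UniformSpace.Completion.denseRange_coe (α := PreFactor P hP)
  have h1 : ∀ k : FactorSpace P hP, ⟪h, k⟫_ℂ = 0 := by
    intro k
    refine hd.induction_on (p := fun k => ⟪h, k⟫_ℂ = 0) k ?_ h0
    exact isClosed_eq (by fun_prop) continuous_const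
  exact inner_self_eq_zero.1 (h1 h)

end Factor

/-- `Θ(C) = T⁻¹ C T`, i.e. the bounded operator `D` with `T D = C T`.  For injective `T` there is at
most one such `D`; one exists whenever `C` commutes with `T T⁺`. -/
def Theta {K H : Type*} [NormedAddCommGroup K] [InnerProductSpace ℂ K]
    [NormedAddCommGroup H] [InnerProductSpace ℂ H]
    (T : H →L[ℂ] K) (C : K →L[ℂ] K) : H →L[ℂ] H :=
  open Classical in
  if h : ∃ D : H →L[ℂ] H, T ∘L D = C ∘L T then h.choose else 0

/-! ### Spectral measures -/

section Spectral

open MeasureTheory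

variable {H : Type*} [NormedAddCommGroup H] [InnerProductSpace ℂ H] [CompleteSpace H]

variable (H) in
/-- A projection valued measure on the Borel sets of `ℂ`. -/
structure ProjMeasure where
  /-- the projection attached to a set (only relevant for Borel sets) -/
  proj : Set ℂ → H →L[ℂ] H
  isStarProjection : ∀ s, MeasurableSet s → IsStarProjection (proj s)
  proj_univ : proj Set.univ = 1
  proj_inter : ∀ s t, MeasurableSet s → MeasurableSet t → proj (s ∩ t) = proj s * proj t
  hasSum : ∀ s : ℕ → Set ℂ, (∀ i, MeasurableSet (s i)) → Pairwise (Function.onFun Disjoint s) →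
    ∀ x, HasSum (fun i => proj (s i) x) (proj (⋃ i, s i) x)

namespace ProjMeasure

variable (E : ProjMeasure H)

theorem proj_empty (x : H) : E.proj ∅ x = 0 := by
  have h := E.hasSum (fun _ => ∅) (fun _ => MeasurableSet.empty)
    (fun _ _ _ => by simp [Function.onFun]) x
  exact (summable_const_iff _).1 h.summable

theorem re_inner_nonneg {s : Set ℂ} (hs : MeasurableSet s) (x : H) :
    0 ≤ (⟪x, E.proj s x⟫_ℂ).re := by
  have h := E.isStarProjection s hs
  have h1 : (E.proj s).adjoint = E.proj s := h.isSelfAdjoint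
  have h2 : E.proj s (E.proj s x) = E.proj s x :=
    congrArg (fun C : H →L[ℂ] H => C x) h.isIdempotentElem
  rw [← h2, ← ContinuousLinearMap.adjoint_inner_left, h1]
  exact inner_self_nonneg (𝕜 := ℂ)

/-- The scalar measure `s ↦ ⟪E(s) x, x⟫`. -/
def scalar (x : H) : Measure ℂ :=
  Measure.ofMeasurable (fun s _ => ENNReal.ofReal (⟪x, E.proj s x⟫_ℂ).re)
    (by simp [proj_empty])
    (by
      intro f hf hd
      have h : HasSum (fun i => (⟪x, E.proj (f i) x⟫_ℂ).re) (⟪x, E.proj (⋃ i, f i) x⟫_ℂ).re :=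
        Complex.hasSum_re ((E.hasSum f hf hd x).mapL (innerSL ℂ x))
      rw [← h.tsum_eq, ENNReal.ofReal_tsum_of_nonneg (fun i => E.re_inner_nonneg (hf i) x)
        h.summable])

/-- `E` is the spectral measure of `M`: it is supported on `σ(M)` and `M = ∫ z dE(z)`, weakly. -/
def IsSpectralMeasureOf (M : H →L[ℂ] H) : Prop :=
  E.proj (spectrum ℂ M)ᶜ = 0 ∧ ∀ x, ⟪x, M x⟫_ℂ = ∫ z, z ∂(E.scalar x)

/-- `∫ f dE` for a bounded Borel function `f`: the operator `D` with
`⟪D x, x⟫ = ∫ f d⟪E x, x⟫` for all `x` (there is at most one). -/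
def integral (f : ℂ → ℂ) : H →L[ℂ] H :=
  open Classical in
  if h : ∃ D : H →L[ℂ] H, ∀ x, ⟪x, D x⟫_ℂ = ∫ z, f z ∂(E.scalar x) then h.choose else 0

/-- The unit mass at `0`. -/
instance : Nonempty (ProjMeasure H) := by
  classical
  refine ⟨⟨fun s => if (0 : ℂ) ∈ s then 1 else 0, ?_, by simp, ?_, ?_⟩⟩
  · intro s _
    split_ifs
    · exact ⟨one_mul 1, IsSelfAdjoint.one _⟩
    · exact ⟨zero_mul 0, IsSelfAdjoint.zero _⟩
  · intro s t _ _
    by_cases h1 : (0 : ℂ) ∈ s <;> by_cases h2 : (0 : ℂ) ∈ t <;> simp [h1, h2]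
  · intro s _ hd x
    by_cases h : (0 : ℂ) ∈ ⋃ i, s i
    · obtain ⟨i, hi⟩ := Set.mem_iUnion.1 h
      have key := hasSum_single (f := fun j => (if (0 : ℂ) ∈ s j then (1 : H →L[ℂ] H) else 0) x) i
        (by
          intro j hj
          have : (0 : ℂ) ∉ s j := fun h0 => Set.disjoint_left.1 (hd hj) h0 hi
          simp [this])
      simpa only [h, hi, if_true] using key
    · have h' : ∀ i, (0 : ℂ) ∉ s i := fun i hi => h (Set.mem_iUnion.2 ⟨i, hi⟩)
      simp [h, h', hasSum_zero]

end ProjMeasure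

/-- The spectral measure of a normal operator `M` on a Hilbert space. -/
def spectralMeasure (M : H →L[ℂ] H) : ProjMeasure H :=
  Classical.epsilon fun E => E.IsSpectralMeasureOf M

end Spectral

/-! ### The variety, its primary components and the local algebras -/

section Ideals

variable (I : Ideal Poly)

/-- The variety `V(I) ⊆ ℂ²`. -/
def variety : Set (Fin 2 → ℂ) := MvPolynomial.zeroLocus ℂ I

/-- The real points `V(I) ∩ ℝ²`, regarded as a subset of `ℂ` through `(x, y) ↦ x + i y`. -/
def realVariety : Set ℂ := {z | tau z ∈ variety I}

/-- The non-real points `V(I) \ ℝ²`. -/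
def nonrealVariety : Set (Fin 2 → ℂ) := {a ∈ variety I | ∃ i, (a i).im ≠ 0}

/-- The maximal ideal `P(a) = ⟨x - a₁, y - a₂⟩`. -/
def pointIdeal (a : Fin 2 → ℂ) : Ideal Poly :=
  Ideal.span {MvPolynomial.X 0 - MvPolynomial.C (a 0), MvPolynomial.X 1 - MvPolynomial.C (a 1)}

/-- The primary component `Q(a)` of a zero-dimensional ideal `I` at `a`, i.e. the member with
radical `P(a)` of the minimal primary decomposition of `I`
(see `primaryComponent_eq_of_isMinimalPrimaryDecomposition`). -/
def primaryComponent (a : Fin 2 → ℂ) : Ideal Poly where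
  carrier := {f | ∃ g : Poly, MvPolynomial.eval a g ≠ 0 ∧ g * f ∈ I}
  zero_mem' := ⟨1, by simp, by simp⟩
  add_mem' := by
    rintro f f' ⟨g, hg, h⟩ ⟨g', hg', h'⟩
    refine ⟨g * g', by simp [hg, hg'], ?_⟩
    have : g * g' * (f + f') = g' * (g * f) + g * (g' * f') := by ring
    rw [this]
    exact I.add_mem (I.mul_mem_left _ h) (I.mul_mem_left _ h')
  smul_mem' := by
    rintro c f ⟨g, hg, h⟩
    refine ⟨g, hg, ?_⟩
    have : g * (c • f) = c * (g * f) := by simp only [smul_eq_mul]; ring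
    rw [this]
    exact I.mul_mem_left _ h

/-- `𝒜(a) = ℂ[x, y] / (P(a) · Q(a))`. -/
abbrev AlgA (a : Fin 2 → ℂ) : Type := Poly ⧸ (pointIdeal a * primaryComponent I a)

/-- `ℬ(a) = ℂ[x, y] / Q(a)`. -/
abbrev AlgB (a : Fin 2 → ℂ) : Type := Poly ⧸ primaryComponent I a

variable {I}

theorem mem_pointIdeal_iff {a : Fin 2 → ℂ} {f : Poly} :
    f ∈ pointIdeal a ↔ MvPolynomial.eval a f = 0 := by
  have hX : ∀ i, (MvPolynomial.X i - MvPolynomial.C (a i) : Poly) ∈ pointIdeal a := by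
    intro i
    fin_cases i <;> exact Ideal.subset_span (by simp)
  have key : ∀ f : Poly, f - MvPolynomial.C (MvPolynomial.eval a f) ∈ pointIdeal a := by
    intro f
    induction f using MvPolynomial.induction_on with
    | C c => simp
    | add p q hp hq =>
      have := (pointIdeal a).add_mem hp hq
      convert this using 1
      simp only [map_add]; ring
    | mul_X p i hp =>
      have := (pointIdeal a).add_mem ((pointIdeal a).mul_mem_left p (hX i))
        ((pointIdeal a).mul_mem_left (MvPolynomial.C (a i)) hp)
      convert this using 1
      simp only [map_mul, MvPolynomial.eval_X]; ring
  constructor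
  · intro h
    have hle : pointIdeal a ≤ RingHom.ker (MvPolynomial.eval a) := by
      refine Ideal.span_le.2 ?_
      rintro _ (rfl | rfl) <;> simp [RingHom.mem_ker]
    exact hle h
  · intro h
    simpa [h] using key f

theorem eq_of_pointIdeal_le {a b : Fin 2 → ℂ} (h : pointIdeal a ≤ pointIdeal b) : a = b := by
  funext i
  have hX : (MvPolynomial.X i - MvPolynomial.C (a i) : Poly) ∈ pointIdeal b :=
    h (mem_pointIdeal_iff.2 (by simp))
  have := mem_pointIdeal_iff.1 hX
  simp only [map_sub, MvPolynomial.eval_X, MvPolynomial.eval_C] at this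
  exact (sub_eq_zero.1 this).symm

theorem exists_eq_pointIdeal_of_isPrime [FiniteDimensional ℂ (Poly ⧸ I)] {r : Ideal Poly}
    (hr : r.IsPrime) (h : I ≤ r) : ∃ b, r = pointIdeal b := by
  have : FiniteDimensional ℂ (Poly ⧸ r) :=
    Module.Finite.of_surjective (Ideal.Quotient.factorₐ ℂ h).toLinearMap
      (Ideal.Quotient.factor_surjective h)
  have : IsArtinianRing (Poly ⧸ r) := IsArtinianRing.of_finite ℂ (Poly ⧸ r)
  have hf : IsField (Poly ⧸ r) := IsArtinianRing.isField_of_isDomain _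
  have hm : r.IsMaximal := Ideal.Quotient.maximal_of_isField _ hf
  obtain ⟨b, hb⟩ := MvPolynomial.isMaximal_iff_eq_vanishingIdeal_singleton.1 hm
  refine ⟨b, ?_⟩
  rw [hb]
  ext f
  rw [mem_pointIdeal_iff, MvPolynomial.mem_vanishingIdeal_singleton_iff,
    MvPolynomial.aeval_eq_eval]

theorem exists_radical_eq_pointIdeal [FiniteDimensional ℂ (Poly ⧸ I)] {t : Finset (Ideal Poly)}
    (ht : Submodule.IsMinimalPrimaryDecomposition I t) {a : Fin 2 → ℂ} (ha : a ∈ variety I) :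
    ∃ q ∈ t, q.radical = pointIdeal a := by
  have hpr : (pointIdeal a).IsPrime := by
    have : pointIdeal a = RingHom.ker (MvPolynomial.eval a) := by
      ext f; rw [mem_pointIdeal_iff, RingHom.mem_ker]
    rw [this]; exact RingHom.ker_isPrime _
  have hle : I ≤ pointIdeal a := fun f hf => mem_pointIdeal_iff.2 (by
    have := ha f hf
    rwa [MvPolynomial.aeval_eq_eval] at this)
  have h1 : t.inf id ≤ pointIdeal a := ht.inf_eq.trans_le hle
  obtain ⟨q, hq, hqa⟩ := (Ideal.IsPrime.inf_le' hpr).1 h1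
  refine ⟨q, hq, ?_⟩
  have hqp : q.radical.IsPrime := Ideal.isPrime_radical (ht.primary hq)
  obtain ⟨b, hb⟩ := exists_eq_pointIdeal_of_isPrime (I := I) hqp
    ((ht.inf_eq.symm.trans_le (Finset.inf_le hq)).trans Ideal.le_radical)
  have h2 : q.radical ≤ pointIdeal a := hpr.radical_le_iff.2 hqa
  rw [hb] at h2 ⊢
  rw [eq_of_pointIdeal_le h2]

theorem primaryComponent_eq_of_isMinimalPrimaryDecomposition [FiniteDimensional ℂ (Poly ⧸ I)]
    {t : Finset (Ideal Poly)} (ht : Submodule.IsMinimalPrimaryDecomposition I t) {q : Ideal Poly}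
    (hq : q ∈ t) {a : Fin 2 → ℂ} (ha : q.radical = pointIdeal a) :
    primaryComponent I a = q := by
  have hle : ∀ q' ∈ t, I ≤ q' := fun q' h => ht.inf_eq.symm.trans_le (Finset.inf_le h)
  apply le_antisymm
  · rintro f ⟨g, hg, hgf⟩
    rw [mul_comm] at hgf
    refine ((Ideal.isPrimary_iff.1 (ht.primary hq)).2 (hle q hq hgf)).resolve_right ?_
    rw [ha, mem_pointIdeal_iff]
    exact hg
  · have hsep : ∀ q' ∈ t.erase q, ∃ g ∈ q', MvPolynomial.eval a g ≠ 0 := by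
      intro q' hq'
      have hq't := Finset.mem_of_mem_erase hq'
      by_contra! hcon
      have h1 : q' ≤ pointIdeal a := fun g hg => mem_pointIdeal_iff.2 (hcon g hg)
      have hpr : (pointIdeal a).IsPrime := ha ▸ Ideal.isPrime_radical (ht.primary hq)
      have h2 : q'.radical ≤ pointIdeal a := hpr.radical_le_iff.2 h1
      obtain ⟨b, hb⟩ := exists_eq_pointIdeal_of_isPrime (I := I)
        (Ideal.isPrime_radical (ht.primary hq't)) ((hle q' hq't).trans Ideal.le_radical)
      rw [hb] at h2
      refine ht.distinct hq't hq (Finset.ne_of_mem_erase hq') ?_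
      simp only [Submodule.colon_univ]
      rw [hb, ha, eq_of_pointIdeal_le h2]
    choose! g hgq hga using hsep
    intro f hf
    refine ⟨∏ q' ∈ t.erase q, g q', ?_, ?_⟩
    · rw [map_prod]
      exact Finset.prod_ne_zero_iff.2 hga
    · rw [← ht.inf_eq, Submodule.mem_finsetInf]
      intro q' hq'
      by_cases h : q' = q
      · subst h; exact Ideal.mul_mem_left _ _ hf
      · have h' := Finset.mem_erase.2 ⟨h, hq'⟩
        refine Ideal.mul_mem_right _ _ ?_
        exact Ideal.mem_of_dvd q' (Finset.dvd_prod_of_mem g h') (hgq q' h')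

/-- The ring homomorphism `f ↦ f^#`, where `f^#(x, y)` is the conjugate of `f(x̄, ȳ)`, i.e. the
coefficients are conjugated. -/
def sharpHom : Poly →+* Poly := MvPolynomial.map (starRingEnd ℂ)

/-- `(ξ, η)^# = (ξ̄, η̄)`. -/
def conjPt (a : Fin 2 → ℂ) : Fin 2 → ℂ := fun i => conj (a i)

theorem conjPt_tau (z : ℂ) : conjPt (tau z) = tau z := by
  funext i; fin_cases i <;> simp [conjPt, tau]

theorem conjPt_conjPt (a : Fin 2 → ℂ) : conjPt (conjPt a) = a := by
  funext i; simp [conjPt]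

theorem eval_sharpHom (a : Fin 2 → ℂ) (f : Poly) :
    MvPolynomial.eval a (sharpHom f) = conj (MvPolynomial.eval (conjPt a) f) := by
  induction f using MvPolynomial.induction_on with
  | C c => simp [sharpHom]
  | add p q hp hq => simp [hp, hq]
  | mul_X p i hp => simp [hp]; simp [sharpHom, conjPt]

theorem pointIdeal_sharp (a : Fin 2 → ℂ) :
    pointIdeal (conjPt a) ≤ (pointIdeal a).comap sharpHom := by
  intro f hf
  rw [Ideal.mem_comap, mem_pointIdeal_iff, eval_sharpHom, mem_pointIdeal_iff.1 hf, map_zero]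

theorem primaryComponent_sharp (hI : I ≤ I.comap sharpHom) (a : Fin 2 → ℂ) :
    primaryComponent I (conjPt a) ≤ (primaryComponent I a).comap sharpHom := by
  rintro f ⟨g, hg, h⟩
  refine ⟨sharpHom g, ?_, ?_⟩
  · rw [eval_sharpHom]; simpa using hg
  · rw [← map_mul]; exact hI h

theorem mul_sharp (hI : I ≤ I.comap sharpHom) (z : ℂ) :
    pointIdeal (tau z) * primaryComponent I (tau z) ≤
      (pointIdeal (tau z) * primaryComponent I (tau z)).comap sharpHom := by
  have h1 := pointIdeal_sharp (tau z)
  have h2 := primaryComponent_sharp hI (tau z)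
  rw [conjPt_tau] at h1 h2
  rw [Ideal.mul_le]
  intro f hf g hg
  rw [Ideal.mem_comap, map_mul]
  exact Ideal.mul_mem_mul (h1 hf) (h2 hg)

theorem conjPt_mem (hI : I ≤ I.comap sharpHom) {a : Fin 2 → ℂ} (ha : a ∈ nonrealVariety I) :
    conjPt a ∈ nonrealVariety I := by
  obtain ⟨h, i, hi⟩ := ha
  refine ⟨fun f hf => ?_, i, by simpa [conjPt] using hi⟩
  have h1 := h _ (hI hf)
  rw [MvPolynomial.aeval_eq_eval] at h1 ⊢
  simpa [eval_sharpHom] using h1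

end Ideals

section

variable {K : Type*} [NormedAddCommGroup K] [InnerProductSpace ℂ K] [CompleteSpace K]
  [KreinSpace K]

theorem definitizingIdeal_sharp (N : K →L[ℂ] K) :
    definitizingIdeal N ≤ (definitizingIdeal N).comap sharpHom := by
  refine Ideal.span_le.2 fun q hq => ?_
  have : sharpHom q = q := by
    ext s
    rw [sharpHom, MvPolynomial.coeff_map]
    exact Complex.conj_eq_iff_im.2 (hq.1 s)
  change sharpHom q ∈ definitizingIdeal N
  rw [this]
  exact Ideal.subset_span hq

end

/-! ### The function classes -/

section Functions

variable (I : Ideal Poly) (S : Set ℂ)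

/-- The algebra `ℳ_N` of functions on `(S ∪ V_ℝ(I)) ⊔ (V(I) \ ℝ²)`, where `S = σ(Θ(N))`, with values
in `ℂ` on `S \ V_ℝ(I)`, in `𝒜(z)` at `z ∈ V_ℝ(I)` and in `ℬ(a)` at `a ∈ V(I) \ ℝ²`.  The three
components of an element are its restrictions to these sets; all operations are pointwise. -/
abbrev FunM : Type :=
  (↥(S \ realVariety I) → ℂ) ×
    ((z : ↥(realVariety I)) → AlgA I (tau z)) × ((a : ↥(nonrealVariety I)) → AlgB I a)

variable {I S}

/-- The involution `φ ↦ φ^#` of `ℳ_N` (for an ideal invariant under `f ↦ f^#`). -/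
def FunM.sharp (hI : I ≤ I.comap sharpHom) (φ : FunM I S) : FunM I S :=
  (fun z => conj (φ.1 z),
    fun z => Ideal.quotientMap _ sharpHom (mul_sharp hI z) (φ.2.1 z),
    fun a => Ideal.quotientMap _ sharpHom (primaryComponent_sharp hI a)
      (φ.2.2 ⟨conjPt a, conjPt_mem hI a.2⟩))

variable (I S) in
/-- The element `q_N` of `ℳ_N` attached to a polynomial `q`. -/
def polyN (q : Poly) : FunM I S :=
  (fun z => evalC q z, fun _ => Ideal.Quotient.mk _ q, fun _ => Ideal.Quotient.mk _ q)

variable (I S) in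
/-- The function class `ℱ_N`: the `φ ∈ ℳ_N` which are Borel measurable and bounded on `S \ V_ℝ(I)`
and satisfy, at every `w ∈ S ∩ V_ℝ(I)` that is not isolated in `S`,
`φ(z) - q(Re z, Im z) = O(max_j |h_j(Re z, Im z)|)` as `z → w` in `S \ V_ℝ(I)`, where
`h_1, …, h_n` generate `Q(w)` and the polynomial `q` represents `φ(w)`.  (The norm of a finite tuple
is the maximum norm.) -/
def classF : Set (FunM I S) :=
  {φ | Measurable φ.1 ∧ (∃ c : ℝ, ∀ z, ‖φ.1 z‖ ≤ c) ∧
    ∀ w : ↥(realVariety I), (w : ℂ) ∈ S → AccPt (w : ℂ) (Filter.principal S) →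
      ∃ (n : ℕ) (h : Fin n → Poly) (q : Poly),
        Ideal.span (Set.range h) = primaryComponent I (tau w) ∧
        Ideal.Quotient.mk _ q = φ.2.1 w ∧
        (fun z : ↥(S \ realVariety I) => φ.1 z - evalC q z)
          =O[Filter.comap Subtype.val (𝓝 (w : ℂ))]
            fun z => ‖fun j => evalC (h j) z‖}

/-- The decomposition `φ = r_N + ∑ f_j (p_j)_N` on `S ∪ V_ℝ(I)` and `φ = r_N` on `V(I) \ ℝ²`, with
bounded Borel functions `f_j` vanishing on `V_ℝ(I)`.  Only the values of the `f_j` on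
`S ∪ V_ℝ(I)` matter, and functions on this Borel set are given here through extensions to `ℂ`. -/
structure IsDecomposition {m : ℕ} (p : Fin m → Poly) (φ : FunM I S) (r : Poly)
    (f : Fin m → ℂ → ℂ) : Prop where
  measurable : ∀ j, Measurable (f j)
  bounded : ∀ j, ∃ c : ℝ, ∀ z, ‖f j z‖ ≤ c
  vanish : ∀ j, ∀ z ∈ realVariety I, f j z = 0
  on_spectrum : ∀ z, φ.1 z = (polyN I S r).1 z + ∑ j, f j z • (polyN I S (p j)).1 z
  on_real : ∀ z, φ.2.1 z = (polyN I S r).2.1 z + ∑ j, f j z • (polyN I S (p j)).2.1 z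
  on_nonreal : ∀ a, φ.2.2 a = (polyN I S r).2.2 a

end Functions

/-! ### The functional calculus -/

section Calculus

variable {K : Type*} [NormedAddCommGroup K] [InnerProductSpace ℂ K] [CompleteSpace K]
  [KreinSpace K]

/-- The spectrum `σ(Θ(N))` of the operator `Θ(N)` on the Hilbert space `H` attached to
`T T⁺ = ∑ p_k(A, B)`. -/
def hilbertSpectrum (N : K →L[ℂ] K) {m : ℕ} (p : Fin m → Poly)
    (hp : ∀ k, FormNonneg (polyAt N (p k))) : Set ℂ :=
  spectrum ℂ (Theta (factorMap (∑ k, polyAt N (p k)) (FormNonneg.sum hp)) N)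

/-- The operator `r(A, B) + ∑ T_k (∫ f_k dE_k) T_k⁺`, where `T_k T_k⁺ = p_k(A, B)` and `E_k` is the
spectral measure of `Θ_k(N)`. -/
def Psi (N : K →L[ℂ] K) {m : ℕ} (p : Fin m → Poly)
    (hp : ∀ k, FormNonneg (polyAt N (p k))) (r : Poly) (f : Fin m → ℂ → ℂ) : K →L[ℂ] K :=
  polyAt N r + ∑ k,
    factorMap (polyAt N (p k)) (hp k) ∘L
      (spectralMeasure (Theta (factorMap (polyAt N (p k)) (hp k)) N)).integral (f k) ∘L
        adjointFrom (factorMap (polyAt N (p k)) (hp k))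

end Calculus

end KreinNormal

end

open KreinNormal

noncomputable section

namespace KreinNormal

open MeasureTheory Filter

/-! ### Bounded Borel functions on `ℂ` -/

/-! Everything is transported to the single Hilbert space `ℋ` belonging to `P = ∑ p_k(A, B) = T T⁺`.
An operator commuting with `P` lifts along `T` to a bounded operator on `ℋ`, compatibly with
products, with `T⁺` and with adjoints (`exists_lifts`, resting on Lax's inequality). Hence `Θ(N)` is
normal, it has a spectral measure `E`, and `T⁺ T = ∫ ∑ p_k dE`.

Since `[p_k(A, B) v, v] ≤ [P v, v]`, there is a contraction `W : ℋ → ℋ_k` with `T_k⁺ = W T⁺`, and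
`W* W ∫ ∑ p_j dE = ∫ p_k dE`. This has two consequences. First, `|p_k| ≤ |∑ p_j|` on `S`
(`norm_evalC_le_norm_evalC_sum`), so the zeros of `∑ p_j` in `S` are exactly the points of `S ∩
V_ℝ(I)`. Second, `T_k (∫ f dE_k) T_k⁺ = T (∫ f p_k / ∑ p_j dE) T⁺` whenever `f` vanishes at those
zeros (`factorMap_comp_integral`). So each candidate for `φ(N)` has the form `r(A, B) + T (∫ g dE)
T⁺`, called `totalPsi`.

On the function side this corresponds to `φ = r_N + g (∑ p_k)_N` with a bounded `g` vanishing on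
`V_ℝ(I)` (`IsReduced`), and `ℱ_N` consists of precisely these `φ` (`mem_classF_iff`). The polynomial
`r` comes from the Chinese remainder theorem and `g` is the quotient `(φ - r) / ∑ p_k`. It is
bounded because near a real zero `w` the generators of `Q(w)` are `O(∑ p_k)` on `S`, and `S` is
compact.

For independence of the choices (`totalPsi_eq_of_isReduced`), the difference of two admissible
polynomials lies in `P(z) · Q(z)` at the real points and in `Q(a)` at the others. It is therefore `∑
s_j p_j` with every `s_j` vanishing on `V_ℝ(I)`; this is what the factor `P(z)` in `𝒜(z)` is for.
Such a polynomial acts as a spectral integral, which cancels the change of `g`. Multiplicativity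
then follows from `T⁺ T = ∫ ∑ p_k dE`, compatibility with `#` from the realness of the `p_k`, and
membership in the bicommutant from lifting the commuting operators to `ℋ`.

The spectral theorem for bounded Borel functions is derived from the continuous functional calculus
by the Riesz–Markov theorem and closure under bounded pointwise limits
(`exists_isSpectralMeasureOf`). -/

/-- `f` is a bounded Borel function on `ℂ`. -/
structure BddBorel (f : ℂ → ℂ) : Prop where
  measurable : Measurable f
  bounded : ∃ c : ℝ, ∀ z, ‖f z‖ ≤ c

namespace BddBorel

variable {f g : ℂ → ℂ}

theorem add (hf : BddBorel f) (hg : BddBorel g) : BddBorel (f + g) := by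
  obtain ⟨c, hc⟩ := hf.bounded
  obtain ⟨d, hd⟩ := hg.bounded
  exact ⟨hf.measurable.add hg.measurable, c + d, fun z =>
    (norm_add_le _ _).trans (add_le_add (hc z) (hd z))⟩

theorem mul (hf : BddBorel f) (hg : BddBorel g) : BddBorel (f * g) := by
  obtain ⟨c, hc⟩ := hf.bounded
  obtain ⟨d, hd⟩ := hg.bounded
  refine ⟨hf.measurable.mul hg.measurable, c * d, fun z => ?_⟩
  rw [Pi.mul_apply, norm_mul]
  exact mul_le_mul (hc z) (hd z) (norm_nonneg _) ((norm_nonneg _).trans (hc z))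

theorem const (c : ℂ) : BddBorel fun _ => c := ⟨measurable_const, ‖c‖, fun _ => le_rfl⟩

theorem zero : BddBorel 0 := const 0

theorem smul (c : ℂ) (hf : BddBorel f) : BddBorel (c • f) := (const c).mul hf

theorem star (hf : BddBorel f) : BddBorel fun z => conj (f z) := by
  obtain ⟨c, hc⟩ := hf.bounded
  exact ⟨Complex.continuous_conj.measurable.comp hf.measurable, c, fun z => by simpa using hc z⟩

theorem indicator (hf : BddBorel f) {s : Set ℂ} (hs : MeasurableSet s) :
    BddBorel (s.indicator f) := by
  obtain ⟨c, hc⟩ := hf.bounded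
  exact ⟨hf.measurable.indicator hs, c, fun z => (norm_indicator_le_norm_self f z).trans (hc z)⟩

theorem indicator_one {s : Set ℂ} (hs : MeasurableSet s) :
    BddBorel (s.indicator fun _ => (1 : ℂ)) := (const 1).indicator hs

theorem indicator_of_isCompact (hf : Continuous f) {s : Set ℂ} (hs : IsCompact s) :
    BddBorel (s.indicator f) := by
  obtain ⟨c, hc⟩ := hs.exists_bound_of_continuousOn hf.continuousOn
  refine ⟨hf.measurable.indicator hs.measurableSet, max c 0, fun z => ?_⟩
  by_cases hz : z ∈ s
  · simpa [hz] using Or.inl (hc z hz)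
  · simp [hz]

theorem sum {ι : Type*} (s : Finset ι) {F : ι → ℂ → ℂ} (h : ∀ i ∈ s, BddBorel (F i)) :
    BddBorel (∑ i ∈ s, F i) := by
  classical
  induction s using Finset.induction_on with
  | empty => simpa using zero
  | insert i s hi ih =>
    rw [Finset.sum_insert hi]
    exact (h i (by simp)).add (ih fun j hj => h j (by simp [hj]))

theorem integrable (hf : BddBorel f) (μ : Measure ℂ) [IsFiniteMeasure μ] : Integrable f μ := by
  obtain ⟨c, hc⟩ := hf.bounded
  exact Integrable.of_bound hf.measurable.aestronglyMeasurable c (ae_of_all _ hc)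

theorem simpleFunc (F : SimpleFunc ℂ ℂ) : BddBorel F := by
  refine ⟨F.measurable, ?_⟩
  obtain ⟨c, hc⟩ := F.exists_forall_norm_le
  exact ⟨c, hc⟩

end BddBorel

/-- A class of functions is stable if it is closed under linear combinations of bounded Borel
functions and under pointwise limits of uniformly bounded sequences of Borel functions. -/
structure StableClass (p : (ℂ → ℂ) → Prop) : Prop where
  add : ∀ f g, BddBorel f → BddBorel g → p f → p g → p (f + g)
  smul : ∀ (c : ℂ) (f), BddBorel f → p f → p (c • f)
  lim : ∀ (F : ℕ → ℂ → ℂ) (f : ℂ → ℂ) (c : ℝ), (∀ n, Measurable (F n)) → (∀ n z, ‖F n z‖ ≤ c) →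
    BddBorel f → (∀ z, Tendsto (fun n => F n z) atTop (𝓝 (f z))) → (∀ n, p (F n)) → p f

/-- Every stable class containing `𝒞` contains all bounded Borel functions. -/
def GeneratesBorel (𝒞 : Set (ℂ → ℂ)) : Prop :=
  ∀ p : (ℂ → ℂ) → Prop, StableClass p → (∀ f ∈ 𝒞, p f) → ∀ f, BddBorel f → p f

/-- Simple functions are finite combinations of indicators, and they converge pointwise to a bounded
Borel function while staying uniformly bounded. -/
theorem generatesBorel_indicator :
    GeneratesBorel {f | ∃ s, MeasurableSet s ∧ f = s.indicator fun _ => (1 : ℂ)} := by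
  intro p hp h f hf
  have hsimple : ∀ F : SimpleFunc ℂ ℂ, p F := by
    intro F
    induction F using SimpleFunc.induction with
    | @const c s hs =>
      have : ⇑((SimpleFunc.const ℂ c).piecewise s hs (SimpleFunc.const ℂ 0)) =
          c • s.indicator fun _ => (1 : ℂ) := by
        ext z
        by_cases hz : z ∈ s <;> simp [SimpleFunc.piecewise_apply, hz]
      rw [this]
      exact hp.smul _ _ (BddBorel.indicator_one hs) (h _ ⟨s, hs, rfl⟩)
    | add hd hF hG => exact hp.add _ _ (BddBorel.simpleFunc _) (BddBorel.simpleFunc _) hF hG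
  obtain ⟨c, hc⟩ := hf.bounded
  -- Approximants built around the base value `0` satisfy `‖F n z‖ ≤ ‖f z‖ + ‖f z‖`, whence the
  -- bound `c + c`.
  refine hp.lim (fun n => SimpleFunc.approxOn f hf.measurable Set.univ 0 trivial n) f (c + c)
    (fun n => SimpleFunc.measurable _) (fun n z => ?_) hf (fun z => ?_) fun n => hsimple _
  · exact (SimpleFunc.norm_approxOn_zero_le hf.measurable _ z n).trans (add_le_add (hc z) (hc z))
  · exact SimpleFunc.tendsto_approxOn hf.measurable _ (by simp)

/-- A π-λ argument over the closed sets. The indicator of a closed set is a bounded limit of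
continuous thickened indicators; complements and disjoint unions need only linear combinations and
one more limit. -/
theorem generatesBorel_continuous :
    GeneratesBorel {f | Continuous f ∧ ∃ c : ℝ, ∀ z, ‖f z‖ ≤ c} := by
  intro p hp h
  refine generatesBorel_indicator p hp ?_
  rintro _ ⟨s, hs, rfl⟩
  have hone : p fun _ => 1 := h _ ⟨continuous_const, 1, by simp⟩
  induction s, hs using MeasurableSpace.induction_on_inter
    (borel_eq_generateFrom_isClosed (α := ℂ) ▸ BorelSpace.measurable_eq) isPiSystem_isClosed with
  | empty =>
    have := hp.smul 0 _ (BddBorel.const 1) hone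
    convert this using 1
    ext z; simp
  | basic s hs =>
    have hpos : ∀ n : ℕ, (0 : ℝ) < 1 / ((n : ℝ) + 1) := fun n => Nat.one_div_pos_of_nat
    have hc : ∀ n : ℕ, Continuous fun z => (((thickenedIndicator (hpos n) s z : NNReal) : ℝ) : ℂ) :=
      fun n => Complex.continuous_ofReal.comp
        (NNReal.continuous_coe.comp (thickenedIndicator (hpos n) s).continuous)
    have hb : ∀ (n : ℕ) z, ‖(((thickenedIndicator (hpos n) s z : NNReal) : ℝ) : ℂ)‖ ≤ 1 := by
      intro n z
      rw [Complex.norm_real, NNReal.norm_eq]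
      exact_mod_cast thickenedIndicator_le_one (hpos n) s z
    refine hp.lim _ _ 1 (fun n => (hc n).measurable) hb
      (BddBorel.indicator_one (IsClosed.measurableSet hs)) (fun z => ?_) fun n => h _ ⟨hc n, 1, hb n⟩
    have h1 := tendsto_pi_nhds.1 (thickenedIndicator_tendsto_indicator_closure hpos
      tendsto_one_div_add_atTop_nhds_zero_nat s) z
    rw [IsClosed.closure_eq hs] at h1
    have h2 := (Complex.continuous_ofReal.comp NNReal.continuous_coe).continuousAt.tendsto.comp h1
    have h3 : s.indicator (fun _ => (1 : ℂ)) z =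
        (Complex.ofReal ∘ NNReal.toReal) (s.indicator (fun _ => 1) z) := by
      by_cases hz : z ∈ s <;> simp [hz]
    rw [h3]
    exact h2
  | compl s hs ih =>
    have := hp.add _ _ (BddBorel.const 1) ((BddBorel.indicator_one hs).smul (-1)) hone
      (hp.smul (-1) _ (BddBorel.indicator_one hs) ih)
    convert this using 1
    ext z
    by_cases hz : z ∈ s <;> simp [hz]
  | iUnion s hd hs ih =>
    have hfin : ∀ n : ℕ, p ((⋃ i ∈ Finset.range n, s i).indicator fun _ => (1 : ℂ)) := by
      intro n
      induction n with
      | zero =>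
        have := hp.smul 0 _ (BddBorel.const 1) hone
        convert this using 1
        ext z; simp
      | succ n ihn =>
        have hm : MeasurableSet (⋃ i ∈ Finset.range n, s i) :=
          Finset.measurableSet_biUnion _ fun i _ => hs i
        have := hp.add _ _ (BddBorel.indicator_one hm) (BddBorel.indicator_one (hs n)) ihn (ih n)
        convert this using 1
        have hdis : Disjoint (⋃ i ∈ Finset.range n, s i) (s n) := by
          rw [Set.disjoint_iUnion₂_left]
          intro i hi
          exact hd (Finset.mem_range.1 hi).ne
        rw [Finset.range_add_one, Finset.set_biUnion_insert, Set.union_comm,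
          Set.indicator_union_of_disjoint hdis]
        rfl
    refine hp.lim _ _ 1 (fun n => ((BddBorel.indicator_one
      (Finset.measurableSet_biUnion _ fun i _ => hs i))).measurable) (fun n z => ?_)
      (BddBorel.indicator_one (MeasurableSet.iUnion hs)) (fun z => ?_) hfin
    · exact (norm_indicator_le_norm_self _ z).trans (by simp)
    · by_cases hz : z ∈ ⋃ i, s i
      · obtain ⟨i, hi⟩ := Set.mem_iUnion.1 hz
        refine tendsto_const_nhds.congr' ?_
        filter_upwards [eventually_gt_atTop i] with n hn
        have : z ∈ ⋃ i ∈ Finset.range n, s i := Set.mem_biUnion (Finset.mem_range.2 hn) hi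
        simp only [Set.indicator_of_mem hz, Set.indicator_of_mem this]
      · refine tendsto_const_nhds.congr fun n => ?_
        have : z ∉ ⋃ i ∈ Finset.range n, s i := fun h' =>
          hz (Set.iUnion₂_subset_iUnion _ _ h')
        simp only [Set.indicator_of_notMem hz, Set.indicator_of_notMem this]

/-! ### Functional calculi for bounded Borel functions -/

section Calculus

variable {H : Type*} [NormedAddCommGroup H] [InnerProductSpace ℂ H]

theorem inner_clm_polarization (D : H →L[ℂ] H) (x y : H) :
    ⟪D y, x⟫_ℂ = (⟪D (x + y), x + y⟫_ℂ - ⟪D (x - y), x - y⟫_ℂ +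
      Complex.I * ⟪D (x + Complex.I • y), x + Complex.I • y⟫_ℂ -
      Complex.I * ⟪D (x - Complex.I • y), x - Complex.I • y⟫_ℂ) / 4 :=
  inner_map_polarization D.toLinearMap x y

theorem inner_right_polarization (D : H →L[ℂ] H) (x y : H) :
    ⟪x, D y⟫_ℂ = (⟪x + y, D (x + y)⟫_ℂ - ⟪x - y, D (x - y)⟫_ℂ -
      Complex.I * ⟪x + Complex.I • y, D (x + Complex.I • y)⟫_ℂ +
      Complex.I * ⟪x - Complex.I • y, D (x - Complex.I • y)⟫_ℂ) / 4 := by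
  rw [← inner_conj_symm, inner_clm_polarization]
  simp only [map_div₀, map_add, map_sub, map_mul, inner_conj_symm, Complex.conj_I, map_ofNat]
  ring

/-- Over `ℂ`, polarization recovers an operator from its quadratic form. This is why the integrals
only have to be specified on the diagonal. -/
theorem clm_eq_of_inner_self {D D' : H →L[ℂ] H} (h : ∀ x, ⟪x, D x⟫_ℂ = ⟪x, D' x⟫_ℂ) : D = D' := by
  ext y
  refine ext_inner_left ℂ fun x => ?_
  rw [inner_right_polarization, inner_right_polarization D']
  simp only [h]

/-- Polarization and the parallelogram law give `|⟪x, D y⟫| ≤ c (‖x‖² + ‖y‖²)`. Taking `x` to be the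
positive multiple of `D y` of norm `‖y‖` produces the factor `2`. -/
theorem norm_le_of_norm_inner_self_le {D : H →L[ℂ] H} {c : ℝ} (hc : 0 ≤ c)
    (h : ∀ x, ‖⟪x, D x⟫_ℂ‖ ≤ c * ‖x‖ ^ 2) : ‖D‖ ≤ 2 * c := by
  have key : ∀ x y, ‖⟪x, D y⟫_ℂ‖ ≤ c * (‖x‖ ^ 2 + ‖y‖ ^ 2) := by
    intro x y
    have h1 := parallelogram_law_with_norm ℂ x y
    have h2 := parallelogram_law_with_norm ℂ x (Complex.I • y)
    rw [norm_smul, Complex.norm_I, one_mul] at h2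
    rw [inner_right_polarization, norm_div]
    have h4 : ‖(4 : ℂ)‖ = 4 := by simp
    rw [h4, div_le_iff₀ (by norm_num)]
    refine (norm_add_le _ _).trans ?_
    refine (add_le_add_left (norm_sub_le _ _) _).trans ?_
    refine (add_le_add_left (add_le_add_left (norm_sub_le _ _) _) _).trans ?_
    rw [norm_mul, norm_mul, Complex.norm_I, one_mul, one_mul]
    have e1 := h (x + y)
    have e2 := h (x - y)
    have e3 := h (x + Complex.I • y)
    have e4 := h (x - Complex.I • y)
    have e5 : c * (‖x + y‖ ^ 2 + ‖x - y‖ ^ 2) = c * (2 * (‖x‖ ^ 2 + ‖y‖ ^ 2)) := by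
      congr 1
    have e6 : c * (‖x + Complex.I • y‖ ^ 2 + ‖x - Complex.I • y‖ ^ 2) =
      c * (2 * (‖x‖ ^ 2 + ‖y‖ ^ 2)) := by congr 1
    linarith
  refine D.opNorm_le_bound (by positivity) fun y => ?_
  by_cases hy : D y = 0
  · rw [hy, norm_zero]; positivity
  have hy' : 0 < ‖D y‖ := norm_pos_iff.2 hy
  have h1 := key (((‖y‖ / ‖D y‖ : ℝ) : ℂ) • D y) y
  rw [inner_smul_left, Complex.conj_ofReal, inner_self_eq_norm_sq_to_K, norm_mul, norm_smul,
    Complex.norm_real, Real.norm_of_nonneg (by positivity), norm_pow] at h1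
  simp only [Complex.coe_algebraMap, Complex.norm_real, norm_norm] at h1
  have e1 : ‖y‖ / ‖D y‖ * ‖D y‖ ^ 2 = ‖y‖ * ‖D y‖ := by field_simp
  have e2 : ‖y‖ / ‖D y‖ * ‖D y‖ = ‖y‖ := by field_simp
  rw [e1, e2] at h1
  by_cases hy0 : ‖y‖ = 0
  · rw [norm_eq_zero.1 hy0] at hy; simp at hy
  have hy0' : 0 < ‖y‖ := lt_of_le_of_ne (norm_nonneg _) (Ne.symm hy0)
  nlinarith

variable [CompleteSpace H]

/-- A uniformly bounded sequence of operators whose quadratic forms converge pointwise has a weak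
limit. -/
theorem exists_clm_of_tendsto_inner_self {D : ℕ → H →L[ℂ] H} {q : H → ℂ} {c : ℝ} (hc : 0 ≤ c)
    (hD : ∀ n x, ‖⟪x, D n x⟫_ℂ‖ ≤ c * ‖x‖ ^ 2)
    (h : ∀ x, Tendsto (fun n => ⟪x, D n x⟫_ℂ) atTop (𝓝 (q x))) :
    ∃ L : H →L[ℂ] H, ∀ x, ⟪x, L x⟫_ℂ = q x := by
  -- By polarization the full sesquilinear forms converge. The limit `B` is bounded by `2 c`, and
  -- the Riesz representation of bounded sesquilinear forms supplies the operator.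
  have hpol : ∀ x y, ∃ l, Tendsto (fun n => ⟪D n x, y⟫_ℂ) atTop (𝓝 l) := by
    intro x y
    have h' := fun v => (Complex.continuous_conj.tendsto _).comp (h v)
    simp only [Function.comp_def, inner_conj_symm] at h'
    simp only [inner_clm_polarization (D _) y x]
    exact ⟨_, ((((h' _).sub (h' _)).add ((h' _).const_mul _)).sub ((h' _).const_mul _)).div_const _⟩
  choose B hB using hpol
  have hnorm : ∀ x y, ‖B x y‖ ≤ 2 * c * ‖x‖ * ‖y‖ := by
    intro x y
    refine le_of_tendsto (hB x y).norm (Eventually.of_forall fun n => ?_)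
    refine (norm_inner_le_norm _ _).trans ?_
    gcongr
    refine ((D n).le_opNorm x).trans ?_
    gcongr
    exact norm_le_of_norm_inner_self_le hc (hD n)
  let B' : H →L⋆[ℂ] H →L[ℂ] ℂ := LinearMap.mkContinuous₂
    (LinearMap.mk₂'ₛₗ (starRingEnd ℂ) (RingHom.id ℂ) B
      (fun x x' y => tendsto_nhds_unique (hB _ _) (by
        simpa only [map_add, inner_add_left] using (hB x y).add (hB x' y)))
      (fun a x y => tendsto_nhds_unique (hB _ _) (by
        simpa only [map_smul, inner_smul_left, smul_eq_mul] using (hB x y).const_mul (conj a)))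
      (fun x y y' => tendsto_nhds_unique (hB _ _) (by
        simpa only [inner_add_right] using (hB x y).add (hB x y')))
      (fun a x y => tendsto_nhds_unique (hB _ _) (by
        simpa only [inner_smul_right, smul_eq_mul, RingHom.id_apply] using (hB x y).const_mul a)))
    (2 * c) hnorm
  refine ⟨InnerProductSpace.continuousLinearMapOfBilin B', fun x => ?_⟩
  have h1 : ⟪InnerProductSpace.continuousLinearMapOfBilin B' x, x⟫_ℂ = B x x := by
    rw [InnerProductSpace.continuousLinearMapOfBilin_apply]
    rfl
  rw [← inner_conj_symm, h1]
  have h2 := (Complex.continuous_conj.tendsto _).comp (hB x x)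
  simp only [Function.comp_def, inner_conj_symm] at h2
  exact tendsto_nhds_unique h2 (h x)

/-- `I f` is the operator `∫ f dE` for a family of scalar measures `μ x = ⟪E(·) x, x⟫`. -/
structure IsBorelCalculus (μ : H → Measure ℂ) (I : (ℂ → ℂ) → H →L[ℂ] H) : Prop where
  mass : ∀ x, μ x Set.univ ≤ ENNReal.ofReal (‖x‖ ^ 2)
  inner_self : ∀ f, BddBorel f → ∀ x, ⟪x, I f x⟫_ℂ = ∫ z, f z ∂μ x

theorem norm_integral_le_of_mass {μ : Measure ℂ} {a c : ℝ} (ha : 0 ≤ a)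
    (hμ : μ Set.univ ≤ ENNReal.ofReal a) (hc : 0 ≤ c) {f : ℂ → ℂ} (hf : ∀ z, ‖f z‖ ≤ c) :
    ‖∫ z, f z ∂μ‖ ≤ c * a := by
  have : IsFiniteMeasure μ := ⟨hμ.trans_lt ENNReal.ofReal_lt_top⟩
  refine (norm_integral_le_of_norm_le_const (ae_of_all _ hf)).trans ?_
  gcongr
  exact ENNReal.toReal_le_of_le_ofReal ha hμ

theorem isFiniteMeasure_of_mass {μ : Measure ℂ} {a : ℝ} (hμ : μ Set.univ ≤ ENNReal.ofReal a) :
    IsFiniteMeasure μ := ⟨hμ.trans_lt ENNReal.ofReal_lt_top⟩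

theorem tendsto_integral_of_bounded {μ : Measure ℂ} [IsFiniteMeasure μ] {F : ℕ → ℂ → ℂ}
    {f : ℂ → ℂ} {c : ℝ} (hF : ∀ n, Measurable (F n)) (hc : ∀ n z, ‖F n z‖ ≤ c)
    (h : ∀ z, Tendsto (fun n => F n z) atTop (𝓝 (f z))) :
    Tendsto (fun n => ∫ z, F n z ∂μ) atTop (𝓝 (∫ z, f z ∂μ)) :=
  tendsto_integral_of_dominated_convergence (fun _ => c)
    (fun n => (hF n).aestronglyMeasurable) (integrable_const c) (fun n => ae_of_all _ (hc n))
    (ae_of_all _ h)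

/-- If the operators representing the functions of a generating class exist, then those
representing all bounded Borel functions do. -/
theorem exists_isBorelCalculus {μ : H → Measure ℂ}
    (hμ : ∀ x, μ x Set.univ ≤ ENNReal.ofReal (‖x‖ ^ 2)) {𝒞 : Set (ℂ → ℂ)} (h𝒞 : GeneratesBorel 𝒞)
    (h : ∀ f ∈ 𝒞, ∃ D : H →L[ℂ] H, ∀ x, ⟪x, D x⟫_ℂ = ∫ z, f z ∂μ x) (f : ℂ → ℂ)
    (hf : BddBorel f) : ∃ D : H →L[ℂ] H, ∀ x, ⟪x, D x⟫_ℂ = ∫ z, f z ∂μ x := by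
  have hfin := fun x => isFiniteMeasure_of_mass (hμ x)
  refine h𝒞 _ ⟨?_, ?_, ?_⟩ h f hf
  · rintro f g hf hg ⟨D, hD⟩ ⟨D', hD'⟩
    refine ⟨D + D', fun x => ?_⟩
    simp only [add_apply, inner_add_right, hD, hD', Pi.add_apply]
    rw [integral_add (hf.integrable _) (hg.integrable _)]
  · rintro c f hf ⟨D, hD⟩
    refine ⟨c • D, fun x => ?_⟩
    simp only [smul_apply, inner_smul_right, hD, Pi.smul_apply, smul_eq_mul]
    rw [integral_const_mul]
  · intro F f c hF hc hf hlim hD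
    choose D hD using hD
    have hc0 : 0 ≤ c := (norm_nonneg _).trans (hc 0 0)
    refine exists_clm_of_tendsto_inner_self (D := D) hc0 (fun n x => ?_) (fun x => ?_)
    · rw [hD]
      exact norm_integral_le_of_mass (by positivity) (hμ x) hc0 (hc n)
    · simp only [hD]
      exact tendsto_integral_of_bounded hF hc hlim

namespace IsBorelCalculus

variable {μ : H → Measure ℂ} {I : (ℂ → ℂ) → H →L[ℂ] H}

omit [CompleteSpace H] in
theorem isFiniteMeasure (hI : IsBorelCalculus μ I) (x : H) : IsFiniteMeasure (μ x) := isFiniteMeasure_of_mass (hI.mass x)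

theorem eq_of (hI : IsBorelCalculus μ I) {f : ℂ → ℂ} (hf : BddBorel f) {D : H →L[ℂ] H}
    (h : ∀ x, ⟪x, D x⟫_ℂ = ∫ z, f z ∂μ x) : I f = D :=
  clm_eq_of_inner_self fun x => by rw [h, hI.inner_self f hf]

theorem add (hI : IsBorelCalculus μ I) {f g : ℂ → ℂ} (hf : BddBorel f) (hg : BddBorel g) : I (f + g) = I f + I g := by
  have hfin := hI.isFiniteMeasure
  refine hI.eq_of (hf.add hg) fun x => ?_
  simp only [add_apply, inner_add_right, hI.inner_self f hf,
    hI.inner_self g hg, Pi.add_apply]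
  rw [integral_add (hf.integrable _) (hg.integrable _)]

theorem smul (hI : IsBorelCalculus μ I) (c : ℂ) {f : ℂ → ℂ} (hf : BddBorel f) : I (c • f) = c • I f := by
  refine hI.eq_of (hf.smul c) fun x => ?_
  simp only [smul_apply, inner_smul_right, hI.inner_self f hf, Pi.smul_apply,
    smul_eq_mul]
  rw [integral_const_mul]

theorem zero (hI : IsBorelCalculus μ I) : I 0 = 0 := hI.eq_of BddBorel.zero fun x => by simp

theorem sum (hI : IsBorelCalculus μ I) {ι : Type*} (s : Finset ι) {F : ι → ℂ → ℂ} (h : ∀ i ∈ s, BddBorel (F i)) :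
    I (∑ i ∈ s, F i) = ∑ i ∈ s, I (F i) := by
  classical
  induction s using Finset.induction_on with
  | empty => simpa using hI.zero
  | insert i s hi ih =>
    have hs : ∀ j ∈ s, BddBorel (F j) := fun j hj => h j (by simp [hj])
    rw [Finset.sum_insert hi, Finset.sum_insert hi, hI.add (h i (by simp)) (BddBorel.sum s hs),
      ih hs]

theorem star (hI : IsBorelCalculus μ I) {f : ℂ → ℂ} (hf : BddBorel f) : I (fun z => conj (f z)) = (I f).adjoint := by
  refine hI.eq_of hf.star fun x => ?_
  rw [integral_conj, ← hI.inner_self f hf, ContinuousLinearMap.adjoint_inner_right, inner_conj_symm]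

/-- Dominated convergence settles the quadratic forms; polarization upgrades this to weak operator
convergence. -/
theorem tendsto (hI : IsBorelCalculus μ I) {F : ℕ → ℂ → ℂ} {f : ℂ → ℂ} {c : ℝ} (hF : ∀ n, Measurable (F n))
    (hc : ∀ n z, ‖F n z‖ ≤ c) (hf : BddBorel f)
    (h : ∀ z, Tendsto (fun n => F n z) atTop (𝓝 (f z))) (x y : H) :
    Tendsto (fun n => ⟪x, I (F n) y⟫_ℂ) atTop (𝓝 ⟪x, I f y⟫_ℂ) := by
  have hfin := hI.isFiniteMeasure
  have h1 : ∀ v, Tendsto (fun n => ⟪v, I (F n) v⟫_ℂ) atTop (𝓝 ⟪v, I f v⟫_ℂ) := by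
    intro v
    simp only [hI.inner_self f hf, fun n => hI.inner_self (F n) ⟨hF n, c, hc n⟩]
    exact tendsto_integral_of_bounded hF hc h
  simp only [inner_right_polarization _ x y]
  exact ((((h1 _).sub (h1 _)).sub ((h1 _).const_mul _)).add ((h1 _).const_mul _)).div_const _

/-- A calculus that is multiplicative on a generating class is multiplicative. -/
theorem mul_of_generates (hI : IsBorelCalculus μ I) {𝒞 : Set (ℂ → ℂ)} (h𝒞 : GeneratesBorel 𝒞) (hb : ∀ f ∈ 𝒞, BddBorel f)
    (h : ∀ f ∈ 𝒞, ∀ g ∈ 𝒞, I (f * g) = I f * I g) {f g : ℂ → ℂ} (hf : BddBorel f)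
    (hg : BddBorel g) : I (f * g) = I f * I g := by
  -- The two factors are extended one at a time: here `g` stays in the generating class while `f`
  -- becomes arbitrary.
  have h1 : ∀ g ∈ 𝒞, ∀ f, BddBorel f → I (f * g) = I f * I g := by
    intro g hgc
    have hg := hb g hgc
    refine h𝒞 _ ⟨?_, ?_, ?_⟩ (fun f hf => h f hf g hgc)
    · intro f f' hf hf' e e'
      rw [add_mul, hI.add (hf.mul hg) (hf'.mul hg), hI.add hf hf', e, e', add_mul]
    · intro c f hf e
      rw [smul_mul_assoc, hI.smul c (hf.mul hg), hI.smul c hf, e, smul_mul_assoc]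
    · intro F f c hF hc hf hlim e
      obtain ⟨d, hd⟩ := hg.bounded
      ext y
      refine ext_inner_left ℂ fun x => ?_
      refine tendsto_nhds_unique (hI.tendsto (F := fun n => F n * g) (c := c * d)
        (fun n => (hF n).mul hg.measurable) (fun n z => ?_) (hf.mul hg)
        (fun z => (hlim z).mul_const _) x y) ?_
      · rw [Pi.mul_apply, norm_mul]
        exact mul_le_mul (hc n z) (hd z) (norm_nonneg _) ((norm_nonneg _).trans (hc n z))
      · simp only [e, mul_apply_eq_comp]
        exact hI.tendsto hF hc hf hlim x (I g y)
  refine h𝒞 (fun g => I (f * g) = I f * I g) ⟨?_, ?_, ?_⟩ (fun g hgc => h1 g hgc f hf) g hg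
  · intro g g' hg hg' e e'
    rw [mul_add, hI.add (hf.mul hg) (hf.mul hg'), hI.add hg hg', e, e', mul_add]
  · intro c g hg e
    rw [mul_smul_comm, hI.smul c (hf.mul hg), hI.smul c hg, e, mul_smul_comm]
  · intro F g c hF hc hg hlim e
    obtain ⟨d, hd⟩ := hf.bounded
    ext y
    refine ext_inner_left ℂ fun x => ?_
    refine tendsto_nhds_unique (hI.tendsto (F := fun n => f * F n) (c := d * c)
      (fun n => hf.measurable.mul (hF n)) (fun n z => ?_) (hf.mul hg)
      (fun z => (hlim z).const_mul _) x y) ?_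
    · rw [Pi.mul_apply, norm_mul]
      exact mul_le_mul (hd z) (hc n z) (norm_nonneg _) ((norm_nonneg _).trans (hd z))
    · simp only [e, mul_apply_eq_comp]
      -- The limit now sits in the right factor. Moving `I f` to the other side of the inner product
      -- makes weak convergence sufficient.
      simp only [← ContinuousLinearMap.adjoint_inner_left (I f)]
      exact hI.tendsto hF hc hg hlim _ y

/-- The functions whose integrals are intertwined by a fixed operator form a stable class. -/
theorem stableClass_intertwine (hI : IsBorelCalculus μ I) {H' : Type*} [NormedAddCommGroup H']
    [InnerProductSpace ℂ H'] [CompleteSpace H'] {μ' : H' → Measure ℂ} {I' : (ℂ → ℂ) → H' →L[ℂ] H'}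
    (hI' : IsBorelCalculus μ' I') (R : H →L[ℂ] H') :
    StableClass fun f => R ∘L I f = I' f ∘L R := by
  refine ⟨?_, ?_, ?_⟩
  · intro f g hf hg e e'
    rw [hI.add hf hg, hI'.add hf hg, ContinuousLinearMap.comp_add, e, e',
      ContinuousLinearMap.add_comp]
  · intro c f hf e
    rw [hI.smul c hf, hI'.smul c hf, ContinuousLinearMap.comp_smul, e,
      ContinuousLinearMap.smul_comp]
  · intro F f c hF hc hf hlim e
    ext y
    refine ext_inner_left ℂ fun x => ?_
    have h1 := hI.tendsto hF hc hf hlim (R.adjoint x) y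
    have h2 := hI'.tendsto hF hc hf hlim x (R y)
    simp only [ContinuousLinearMap.adjoint_inner_left] at h1
    refine tendsto_nhds_unique h1 (h2.congr fun n => ?_)
    exact congrArg (fun D : H →L[ℂ] H' => ⟪x, D y⟫_ℂ) (e n).symm

end IsBorelCalculus

end Calculus

end KreinNormal

namespace KreinNormal

open MeasureTheory Filter

/-! ### Integration with respect to a projection valued measure -/

section ProjMeasure

variable {H : Type*} [NormedAddCommGroup H] [InnerProductSpace ℂ H] [CompleteSpace H]

theorem indicator_one_mul (s t : Set ℂ) :
    ((s.indicator fun _ => (1 : ℂ)) * t.indicator fun _ => 1) = (s ∩ t).indicator fun _ => 1 := by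
  ext z
  by_cases hs : z ∈ s <;> by_cases ht : z ∈ t <;> simp [hs, ht]

namespace ProjMeasure

variable (E : ProjMeasure H)

theorem scalar_apply {s : Set ℂ} (hs : MeasurableSet s) (x : H) :
    E.scalar x s = ENNReal.ofReal (⟪x, E.proj s x⟫_ℂ).re :=
  Measure.ofMeasurable_apply s hs

theorem scalar_univ (x : H) : E.scalar x Set.univ = ENNReal.ofReal (‖x‖ ^ 2) := by
  rw [scalar_apply E MeasurableSet.univ, E.proj_univ, one_apply_eq_self,
    inner_self_eq_norm_sq_to_K]
  norm_cast

theorem inner_proj {s : Set ℂ} (hs : MeasurableSet s) (x : H) :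
    ⟪x, E.proj s x⟫_ℂ = ∫ z, s.indicator (fun _ => (1 : ℂ)) z ∂(E.scalar x) := by
  rw [integral_indicator_const _ hs, measureReal_def, scalar_apply E hs,
    ENNReal.toReal_ofReal (E.re_inner_nonneg hs x)]
  have h1 : (E.proj s).adjoint = E.proj s := (E.isStarProjection s hs).isSelfAdjoint
  have h2 : conj ⟪x, E.proj s x⟫_ℂ = ⟪x, E.proj s x⟫_ℂ := by
    rw [inner_conj_symm, ← ContinuousLinearMap.adjoint_inner_right, h1]
  simpa using (Complex.conj_eq_iff_re.1 h2).symm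

/-- The representing operators exist for indicators, being the projections themselves, hence for all
bounded Borel functions. For these the definition of `integral` never falls back to its default
value `0`. -/
theorem isBorelCalculus : IsBorelCalculus E.scalar E.integral := by
  refine ⟨fun x => (E.scalar_univ x).le, fun f hf x => ?_⟩
  have h : ∃ D : H →L[ℂ] H, ∀ x, ⟪x, D x⟫_ℂ = ∫ z, f z ∂(E.scalar x) := by
    refine exists_isBorelCalculus (fun x => (E.scalar_univ x).le) generatesBorel_indicator ?_ f hf
    rintro _ ⟨s, hs, rfl⟩
    exact ⟨E.proj s, E.inner_proj hs⟩
  rw [integral, dif_pos h]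
  exact h.choose_spec x

theorem integral_indicator_one {s : Set ℂ} (hs : MeasurableSet s) :
    E.integral (s.indicator fun _ => (1 : ℂ)) = E.proj s :=
  E.isBorelCalculus.eq_of (BddBorel.indicator_one hs) (E.inner_proj hs)

theorem integral_mul {f g : ℂ → ℂ} (hf : BddBorel f) (hg : BddBorel g) :
    E.integral (f * g) = E.integral f * E.integral g := by
  refine E.isBorelCalculus.mul_of_generates generatesBorel_indicator ?_ ?_ hf hg
  · rintro _ ⟨s, hs, rfl⟩
    exact BddBorel.indicator_one hs
  · rintro _ ⟨s, hs, rfl⟩ _ ⟨t, ht, rfl⟩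
    rw [integral_indicator_one E hs, integral_indicator_one E ht, ← E.proj_inter s t hs ht,
      ← integral_indicator_one E (hs.inter ht)]
    rw [indicator_one_mul]

theorem integral_one : E.integral (fun _ => 1) = 1 := by
  have := E.integral_indicator_one MeasurableSet.univ
  rwa [Set.indicator_univ, E.proj_univ] at this

end ProjMeasure

end ProjMeasure

/-! ### Existence of spectral measures -/

section Existence

variable {H : Type*} [NormedAddCommGroup H] [InnerProductSpace ℂ H] [CompleteSpace H]

/-- A nonnegative `g` is `h̄ h` with `h = √g`, so `g(M) = h(M)* h(M)`. -/
theorem inner_cfcHom_nonneg (M : H →L[ℂ] H) (hM : IsStarNormal M) (x : H)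
    (g : C(spectrum ℂ M, ℝ)) (hg : ∀ z, 0 ≤ g z) :
    0 ≤ (⟪x, cfcHom (R := ℂ) hM ((⟨Complex.ofReal, Complex.continuous_ofReal⟩ : C(ℝ, ℂ)).comp g)
      x⟫_ℂ).re := by
  set h : C(spectrum ℂ M, ℂ) :=
    ⟨fun z => ((Real.sqrt (g z) : ℝ) : ℂ), by fun_prop⟩
  have hgh : (⟨Complex.ofReal, Complex.continuous_ofReal⟩ : C(ℝ, ℂ)).comp g = star h * h := by
    ext z
    simp only [ContinuousMap.comp_apply, ContinuousMap.coe_mk, ContinuousMap.mul_apply,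
      ContinuousMap.star_apply, h, RCLike.star_def, Complex.conj_ofReal]
    rw [← Complex.ofReal_mul, Real.mul_self_sqrt (hg z)]
  rw [hgh, map_mul, map_star, mul_apply_eq_comp, ContinuousLinearMap.star_eq_adjoint,
    ContinuousLinearMap.adjoint_inner_right]
  exact inner_self_nonneg (𝕜 := ℂ)

/-- The Riesz–Markov–Kakutani theorem for the positive functional `g ↦ Re ⟪x, g(M) x⟫` on the
compact spectrum, pushed forward to `ℂ`. -/
theorem exists_scalarMeasure (M : H →L[ℂ] H) (hM : IsStarNormal M) (x : H) :
    ∃ μ : Measure ℂ, μ (spectrum ℂ M)ᶜ = 0 ∧ IsFiniteMeasure μ ∧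
      ∀ f : ℂ → ℂ, Continuous f → ⟪x, cfc f M x⟫_ℂ = ∫ z, f z ∂μ := by
  have hcomp : CompactSpace (spectrum ℂ M) := isCompact_iff_compactSpace.1 (spectrum.isCompact M)
  have hX : MeasurableSet (spectrum ℂ M) := (spectrum.isCompact M).measurableSet
  let Λ : CompactlySupportedContinuousMap (spectrum ℂ M) ℝ →ₚ[ℝ] ℝ := PositiveLinearMap.mk₀
    { toFun := fun g => (⟪x, cfcHom (R := ℂ) hM
        ((⟨Complex.ofReal, Complex.continuous_ofReal⟩ : C(ℝ, ℂ)).comp g.toContinuousMap) x⟫_ℂ).re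
      map_add' := fun g g' => by
        have : (⟨Complex.ofReal, Complex.continuous_ofReal⟩ : C(ℝ, ℂ)).comp
            (g + g').toContinuousMap =
            (⟨Complex.ofReal, Complex.continuous_ofReal⟩ : C(ℝ, ℂ)).comp g.toContinuousMap +
            (⟨Complex.ofReal, Complex.continuous_ofReal⟩ : C(ℝ, ℂ)).comp g'.toContinuousMap := by
          ext z; simp
        rw [this, map_add, add_apply, inner_add_right, Complex.add_re]
      map_smul' := fun c g => by
        have : (⟨Complex.ofReal, Complex.continuous_ofReal⟩ : C(ℝ, ℂ)).comp
            (c • g).toContinuousMap = (c : ℂ) •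
            (⟨Complex.ofReal, Complex.continuous_ofReal⟩ : C(ℝ, ℂ)).comp g.toContinuousMap := by
          ext z; simp
        rw [this, map_smul, smul_apply, inner_smul_right, Complex.re_ofReal_mul]
        rfl }
    (fun g hg => inner_cfcHom_nonneg M hM x g.toContinuousMap fun z => hg z)
  have hΛ : ∀ g : C(spectrum ℂ M, ℝ), (⟪x, cfcHom (R := ℂ) hM
      ((⟨Complex.ofReal, Complex.continuous_ofReal⟩ : C(ℝ, ℂ)).comp g) x⟫_ℂ).re =
      ∫ z, g z ∂(RealRMK.rieszMeasure Λ) := fun g =>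
    (RealRMK.integral_rieszMeasure Λ ⟨g, HasCompactSupport.of_compactSpace g⟩).symm
  have hreal : ∀ g : C(spectrum ℂ M, ℝ), ⟪x, cfcHom (R := ℂ) hM
      ((⟨Complex.ofReal, Complex.continuous_ofReal⟩ : C(ℝ, ℂ)).comp g) x⟫_ℂ =
      ∫ z, (g z : ℂ) ∂(RealRMK.rieszMeasure Λ) := by
    intro g
    rw [integral_complex_ofReal, ← hΛ]
    -- Keeping only real parts loses nothing: for real `g` the operator `g(M)` is selfadjoint and
    -- its quadratic form is real.
    have hsa : star (cfcHom (R := ℂ) hM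
        ((⟨Complex.ofReal, Complex.continuous_ofReal⟩ : C(ℝ, ℂ)).comp g)) = cfcHom (R := ℂ) hM
        ((⟨Complex.ofReal, Complex.continuous_ofReal⟩ : C(ℝ, ℂ)).comp g) := by
      rw [← map_star]
      congr 1
      ext z; simp
    have h2 := inner_conj_symm (𝕜 := ℂ) x (cfcHom (R := ℂ) hM
        ((⟨Complex.ofReal, Complex.continuous_ofReal⟩ : C(ℝ, ℂ)).comp g) x)
    rw [← ContinuousLinearMap.adjoint_inner_right, ← ContinuousLinearMap.star_eq_adjoint, hsa] at h2
    exact (Complex.conj_eq_iff_re.1 h2).symm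
  have hfin : IsFiniteMeasure (RealRMK.rieszMeasure Λ) := inferInstance
  refine ⟨(RealRMK.rieszMeasure Λ).map Subtype.val, ?_, inferInstance, fun f hf => ?_⟩
  · rw [Measure.map_apply measurable_subtype_coe hX.compl]
    convert measure_empty (μ := RealRMK.rieszMeasure Λ)
    ext z; simp
  · rw [(MeasurableEmbedding.subtype_coe hX).integral_map]
    have hc : Continuous fun z : spectrum ℂ M => f z := by fun_prop
    rw [cfc_apply f M hM hf.continuousOn]
    have hdec : (⟨(spectrum ℂ M).domRestrict f, hc⟩ : C(spectrum ℂ M, ℂ)) =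
        (⟨Complex.ofReal, Complex.continuous_ofReal⟩ : C(ℝ, ℂ)).comp
          ⟨fun z : spectrum ℂ M => (f z).re, by fun_prop⟩ + Complex.I •
        (⟨Complex.ofReal, Complex.continuous_ofReal⟩ : C(ℝ, ℂ)).comp
          ⟨fun z : spectrum ℂ M => (f z).im, by fun_prop⟩ := by
      ext z
      simp only [ContinuousMap.add_apply, ContinuousMap.comp_apply, ContinuousMap.coe_mk,
        ContinuousMap.smul_apply, smul_eq_mul, mul_comm Complex.I, Complex.re_add_im]
      rfl
    rw [hdec, map_add, map_smul, add_apply, smul_apply, inner_add_right, inner_smul_right, hreal,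
      hreal, ← integral_const_mul, ← integral_add]
    · refine integral_congr_ae (ae_of_all _ fun z => ?_)
      simp [mul_comm Complex.I, Complex.re_add_im]
    · exact Continuous.integrable_of_hasCompactSupport (by fun_prop)
        (HasCompactSupport.of_compactSpace _)
    · exact Continuous.integrable_of_hasCompactSupport (by fun_prop)
        (HasCompactSupport.of_compactSpace _)

/-- Here `q - p` is itself an orthogonal projection. The identity converts countable additivity of
the scalar measures into strong convergence of sums of projections. -/
theorem norm_sub_sq_of_isStarProjection {p q : H →L[ℂ] H} (hp : IsStarProjection p)
    (hq : IsStarProjection q) (hpq : q * p = p) (x : H) :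
    ‖q x - p x‖ ^ 2 = (⟪x, q x⟫_ℂ).re - (⟪x, p x⟫_ℂ).re := by
  have hpq' : p * q = p := by
    have := congrArg star hpq
    rwa [star_mul, hp.isSelfAdjoint.star_eq, hq.isSelfAdjoint.star_eq] at this
  have hsq : star (q - p) * (q - p) = q - p := by
    rw [star_sub, hp.isSelfAdjoint.star_eq, hq.isSelfAdjoint.star_eq, sub_mul, mul_sub, mul_sub,
      hpq, hpq', hp.isIdempotentElem.eq, hq.isIdempotentElem.eq]
    simp
  have h := @inner_self_eq_norm_sq ℂ H _ _ _ ((q - p) x)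
  rw [← ContinuousLinearMap.adjoint_inner_right, ← ContinuousLinearMap.star_eq_adjoint,
    ← mul_apply_eq_comp, hsq, sub_apply, inner_sub_right] at h
  rw [← h]
  simp

/-- The scalar measures of all vectors extend the continuous functional calculus to bounded Borel
functions, with multiplicativity inherited from continuous ones. The images of the indicators are
the spectral projections. -/
theorem exists_isSpectralMeasureOf (M : H →L[ℂ] H) (hM : IsStarNormal M) :
    ∃ E : ProjMeasure H, E.IsSpectralMeasureOf M := by
  choose μ hμ0 hfin hμ using exists_scalarMeasure M hM
  have hmass : ∀ x, μ x Set.univ = ENNReal.ofReal (‖x‖ ^ 2) := by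
    intro x
    have h := hμ x (fun _ => 1) continuous_const
    rw [cfc_const_one ℂ M, one_apply_eq_self, inner_self_eq_norm_sq_to_K,
      integral_const] at h
    have h' : ‖x‖ ^ 2 = (μ x).real Set.univ := by
      have := congrArg Complex.re h
      simpa [← Complex.ofReal_pow] using this
    rw [h', measureReal_def, ENNReal.ofReal_toReal (measure_ne_top _ _)]
  have hex := exists_isBorelCalculus (fun x => (hmass x).le) generatesBorel_continuous
    fun f hf => ⟨cfc f M, fun x => hμ x f hf.1⟩
  choose! I hI' using hex
  have hI : IsBorelCalculus μ I := ⟨fun x => (hmass x).le, hI'⟩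
  have hbc : ∀ f : ℂ → ℂ, (Continuous f ∧ ∃ c : ℝ, ∀ z, ‖f z‖ ≤ c) → BddBorel f :=
    fun f hf => ⟨hf.1.measurable, hf.2⟩
  have hcfc : ∀ f : ℂ → ℂ, (Continuous f ∧ ∃ c : ℝ, ∀ z, ‖f z‖ ≤ c) → I f = cfc f M :=
    fun f hf => hI.eq_of (hbc f hf) fun x => hμ x f hf.1
  have hmul : ∀ f g, BddBorel f → BddBorel g → I (f * g) = I f * I g := by
    intro f g hf hg
    refine hI.mul_of_generates generatesBorel_continuous hbc (fun f hf g hg => ?_) hf hg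
    have hfg : Continuous (f * g) ∧ ∃ c : ℝ, ∀ z, ‖(f * g) z‖ ≤ c :=
      ⟨hf.1.mul hg.1, ((hbc f hf).mul (hbc g hg)).bounded⟩
    rw [hcfc f hf, hcfc g hg, hcfc _ hfg, ← cfc_mul f g M hf.1.continuousOn hg.1.continuousOn]
    rfl
  have hinter : ∀ s t, MeasurableSet s → MeasurableSet t →
      I ((s ∩ t).indicator fun _ => (1 : ℂ)) =
        I (s.indicator fun _ => 1) * I (t.indicator fun _ => 1) := by
    intro s t hs ht
    rw [← hmul _ _ (BddBorel.indicator_one hs) (BddBorel.indicator_one ht),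
      indicator_one_mul]
  have hproj : ∀ s, MeasurableSet s → IsStarProjection (I (s.indicator fun _ => (1 : ℂ))) := by
    intro s hs
    refine ⟨?_, ?_⟩
    · rw [IsIdempotentElem, ← hinter s s hs hs, Set.inter_self]
    · rw [IsSelfAdjoint, ContinuousLinearMap.star_eq_adjoint, ← hI.star (BddBorel.indicator_one hs)]
      congr 1
      ext z
      by_cases hz : z ∈ s <;> simp [hz]
  have hre : ∀ s, MeasurableSet s → ∀ x,
      (⟪x, I (s.indicator fun _ => (1 : ℂ)) x⟫_ℂ).re = (μ x).real s := by
    intro s hs x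
    rw [hI.inner_self _ (BddBorel.indicator_one hs), integral_indicator_const _ hs]
    simp
  have hX : MeasurableSet (spectrum ℂ M) := (spectrum.isCompact M).measurableSet
  let E : ProjMeasure H :=
    { proj := fun s => I (s.indicator fun _ => 1)
      isStarProjection := hproj
      proj_univ := by
        rw [Set.indicator_univ, hcfc _ ⟨continuous_const, 1, by simp⟩, cfc_const_one ℂ M]
      proj_inter := hinter
      hasSum := by
        intro s hs hd x
        rw [HasSum, tendsto_iff_norm_sub_tendsto_zero]
        have hfs : ∀ t : Finset ℕ, ∑ i ∈ t, I ((s i).indicator fun _ => (1 : ℂ)) x =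
            I ((⋃ i ∈ t, s i).indicator fun _ => (1 : ℂ)) x := by
          intro t
          rw [← sum_apply, ← hI.sum t fun i _ => BddBorel.indicator_one (hs i)]
          congr 2
          rw [Finset.indicator_biUnion _ _ fun i _ j _ hij => hd hij]
          ext z
          simp
        have hsq : ∀ t : Finset ℕ, ‖∑ i ∈ t, I ((s i).indicator fun _ => (1 : ℂ)) x -
            I ((⋃ i, s i).indicator fun _ => (1 : ℂ)) x‖ ^ 2 =
            (μ x).real (⋃ i, s i) - ∑ i ∈ t, (μ x).real (s i) := by
          intro t
          have hmt : MeasurableSet (⋃ i ∈ t, s i) := Finset.measurableSet_biUnion _ fun i _ => hs i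
          have hm := MeasurableSet.iUnion hs
          rw [hfs, norm_sub_rev, norm_sub_sq_of_isStarProjection (hproj _ hmt) (hproj _ hm) ?_ x,
            hre _ hmt, hre _ hm, measureReal_biUnion_finset (fun i _ j _ hij => hd hij)
            fun i _ => hs i]
          rw [← hinter _ _ hm hmt, Set.inter_eq_self_of_subset_right]
          exact Set.iUnion₂_subset_iUnion _ _
        have hsum : HasSum (fun i => (μ x).real (s i)) ((μ x).real (⋃ i, s i)) := by
          have h1 := measure_iUnion (μ := μ x) hd hs
          have h2 : Summable fun i => (μ x).real (s i) := by
            refine ENNReal.summable_toReal ?_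
            rw [← h1]
            exact measure_ne_top _ _
          convert h2.hasSum using 1
          rw [measureReal_def, h1, ENNReal.tsum_toReal_eq fun i => measure_ne_top _ _]
          rfl
        have h0 : Tendsto (fun t : Finset ℕ => (μ x).real (⋃ i, s i) - ∑ i ∈ t, (μ x).real (s i))
            atTop (𝓝 0) := by
          have := hsum.const_sub ((μ x).real (⋃ i, s i))
          simpa using this
        have h3 := (Real.continuous_sqrt.tendsto 0).comp h0
        rw [Real.sqrt_zero] at h3
        refine h3.congr fun t => ?_
        rw [Function.comp_apply, ← hsq, Real.sqrt_sq (norm_nonneg _)] }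
  have hE : ∀ x, E.scalar x = μ x := by
    intro x
    ext s hs
    rw [E.scalar_apply hs]
    change ENNReal.ofReal (⟪x, I (s.indicator fun _ => (1 : ℂ)) x⟫_ℂ).re = _
    rw [hre s hs, measureReal_def, ENNReal.ofReal_toReal (measure_ne_top _ _)]
  refine ⟨E, ?_, fun x => ?_⟩
  · refine clm_eq_of_inner_self fun x => ?_
    change ⟪x, I ((spectrum ℂ M)ᶜ.indicator fun _ => (1 : ℂ)) x⟫_ℂ = _
    rw [hI.inner_self _ (BddBorel.indicator_one hX.compl), integral_indicator_const _ hX.compl]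
    simp [measureReal_def, hμ0]
  · rw [hE, ← hμ x (fun z => z) continuous_id, cfc_id' ℂ M]

theorem spectralMeasure_spec (M : H →L[ℂ] H) (hM : IsStarNormal M) :
    (spectralMeasure M).IsSpectralMeasureOf M :=
  Classical.epsilon_spec (exists_isSpectralMeasureOf M hM)

end Existence

end KreinNormal

namespace KreinNormal

open MeasureTheory Filter

/-! ### Polynomials of commuting elements -/

section PolyOp

variable {R : Type*} [Ring R] [Algebra ℂ R]

open scoped IsMulCommutative in
/-- Evaluation of polynomials at a commuting pair, as an algebra homomorphism. -/
def polyHom {A B : R} (h : Commute A B) : Poly →ₐ[ℂ] R :=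
  have hcomm : ∀ a ∈ ({A, B} : Set R), ∀ b ∈ ({A, B} : Set R), a * b = b * a := by
    rintro _ (rfl | rfl) _ (rfl | rfl)
    exacts [rfl, h, h.symm, rfl]
  haveI := Algebra.isMulCommutative_adjoin ℂ hcomm
  (Algebra.adjoin ℂ {A, B}).val.comp (MvPolynomial.aeval
    ![(⟨A, Algebra.subset_adjoin (by simp)⟩ : Algebra.adjoin ℂ {A, B}),
      ⟨B, Algebra.subset_adjoin (by simp)⟩])

/-- `polyOp` is only a sum over monomials; this identification makes it an algebra homomorphism for
commuting pairs. -/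
theorem polyHom_apply {A B : R} (h : Commute A B) (q : Poly) : polyHom h q = polyOp q A B := by
  rw [polyHom, polyOp]
  simp only [AlgHom.comp_apply, MvPolynomial.aeval_def, MvPolynomial.eval₂_eq', Fin.prod_univ_two,
    ← Algebra.smul_def]
  simp

theorem polyHom_X_zero {A B : R} (h : Commute A B) : polyHom h (MvPolynomial.X 0) = A := by
  simp [polyHom]

theorem polyHom_X_one {A B : R} (h : Commute A B) : polyHom h (MvPolynomial.X 1) = B := by
  simp [polyHom]

end PolyOp

/-! ### Polynomials as functions on `ℂ`, and their density -/

section EvalC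

@[simp] theorem evalC_add (p q : Poly) (z : ℂ) : evalC (p + q) z = evalC p z + evalC q z :=
  map_add _ _ _

@[simp] theorem evalC_sub (p q : Poly) (z : ℂ) : evalC (p - q) z = evalC p z - evalC q z :=
  map_sub _ _ _

@[simp] theorem evalC_mul (p q : Poly) (z : ℂ) : evalC (p * q) z = evalC p z * evalC q z :=
  map_mul _ _ _

@[simp] theorem evalC_sum {ι : Type*} (s : Finset ι) (p : ι → Poly) (z : ℂ) :
    evalC (∑ i ∈ s, p i) z = ∑ i ∈ s, evalC (p i) z :=
  map_sum _ _ _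

@[simp] theorem evalC_C (c : ℂ) (z : ℂ) : evalC (MvPolynomial.C c) z = c := by
  simp [evalC]

@[simp] theorem evalC_X_zero (z : ℂ) : evalC (MvPolynomial.X 0) z = (z.re : ℂ) := by
  simp [evalC, tau]

@[simp] theorem evalC_X_one (z : ℂ) : evalC (MvPolynomial.X 1) z = (z.im : ℂ) := by
  simp [evalC, tau]

theorem evalC_sharpHom (q : Poly) (z : ℂ) : evalC (sharpHom q) z = conj (evalC q z) := by
  rw [evalC, eval_sharpHom, conjPt_tau, evalC]

theorem continuous_evalC (q : Poly) : Continuous (evalC q) := by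
  induction q using MvPolynomial.induction_on with
  | C c => simpa [funext fun z => evalC_C c z] using continuous_const
  | add p q hp hq => exact (hp.add hq).congr fun z => (evalC_add p q z).symm
  | mul_X p i hp =>
    have : Continuous (evalC (MvPolynomial.X i)) := by
      fin_cases i
      · exact (Complex.continuous_ofReal.comp Complex.continuous_re).congr
          fun z => (evalC_X_zero z).symm
      · exact (Complex.continuous_ofReal.comp Complex.continuous_im).congr
          fun z => (evalC_X_one z).symm
    exact (hp.mul this).congr fun z => (evalC_mul p _ z).symm

/-- Stone–Weierstrass: polynomials in `Re z` and `Im z` are stable under conjugation through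
`sharpHom`, and the two coordinates separate points. -/
theorem exists_poly_approx {C : Set ℂ} (hC : IsCompact C) {f : ℂ → ℂ} (hf : Continuous f) {ε : ℝ}
    (hε : 0 < ε) : ∃ q : Poly, ∀ z ∈ C, ‖evalC q z - f z‖ < ε := by
  have : CompactSpace C := isCompact_iff_compactSpace.1 hC
  let A : StarSubalgebra ℂ C(C, ℂ) :=
    { carrier := {g | ∃ q : Poly, ∀ z, g z = evalC q z}
      mul_mem' := by
        rintro g g' ⟨q, hq⟩ ⟨q', hq'⟩
        exact ⟨q * q', fun z => by simp [hq, hq']⟩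
      add_mem' := by
        rintro g g' ⟨q, hq⟩ ⟨q', hq'⟩
        exact ⟨q + q', fun z => by simp [hq, hq']⟩
      algebraMap_mem' := fun c => ⟨MvPolynomial.C c, fun z => by
        rw [evalC_C]; rfl⟩
      star_mem' := by
        rintro g ⟨q, hq⟩
        exact ⟨sharpHom q, fun z => by simp [evalC_sharpHom, hq]⟩ }
  have hA : A.SeparatesPoints := by
    intro z w hzw
    by_contra! hcon
    have h0 := hcon (fun z => (((z : ℂ).re : ℝ) : ℂ))
      ⟨⟨fun z => (((z : ℂ).re : ℝ) : ℂ), by fun_prop⟩, ⟨MvPolynomial.X 0, fun z => by simp⟩, rfl⟩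
    have h1 := hcon (fun z => (((z : ℂ).im : ℝ) : ℂ))
      ⟨⟨fun z => (((z : ℂ).im : ℝ) : ℂ), by fun_prop⟩, ⟨MvPolynomial.X 1, fun z => by simp⟩, rfl⟩
    exact hzw (Subtype.ext (Complex.ext (by simpa using h0) (by simpa using h1)))
  have htop := ContinuousMap.starSubalgebra_topologicalClosure_eq_top_of_separatesPoints A hA
  have hmem : (⟨fun z : C => f z, by fun_prop⟩ : C(C, ℂ)) ∈ A.topologicalClosure := by
    rw [htop]; trivial
  obtain ⟨g, ⟨q, hq⟩, hg⟩ := Metric.mem_closure_iff.1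
    (show (⟨fun z : C => f z, by fun_prop⟩ : C(C, ℂ)) ∈ closure (A : Set C(C, ℂ)) from hmem) ε hε
  refine ⟨q, fun z hz => ?_⟩
  rw [← hq ⟨z, hz⟩, ← dist_eq_norm, dist_comm]
  exact (ContinuousMap.dist_apply_le_dist (f := (⟨fun z : C => f z, by fun_prop⟩ : C(C, ℂ)))
    (g := g) ⟨z, hz⟩).trans_lt hg

/-- When `C` contains the spectra involved, a property of spectral integrals needs to be checked
only for polynomials on `C`; functions living off `C` integrate to zero. -/
theorem generatesBorel_evalC {C : Set ℂ} (hC : IsCompact C) :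
    GeneratesBorel ({f | ∃ q : Poly, f = C.indicator (evalC q)} ∪
      {f | ∃ g, BddBorel g ∧ f = Cᶜ.indicator g}) := by
  intro p hp h
  refine generatesBorel_continuous p hp ?_
  rintro f ⟨hf, hfb⟩
  have hfB : BddBorel f := ⟨hf.measurable, hfb⟩
  have hadd := hp.add _ _ (hfB.indicator hC.measurableSet) (hfB.indicator hC.measurableSet.compl)
  rw [Set.indicator_self_add_compl] at hadd
  refine hadd ?_ (h _ (Or.inr ⟨f, hfB, rfl⟩))
  choose q hq using fun n : ℕ => exists_poly_approx hC hf (Nat.one_div_pos_of_nat (n := n) (α := ℝ))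
  obtain ⟨c, hc⟩ := hfb
  have hc0 : 0 ≤ c := (norm_nonneg _).trans (hc 0)
  -- The bound `1 + c` combines `‖f‖ ≤ c` with the approximation error `1 / (n + 1) ≤ 1`.
  refine hp.lim (fun n => C.indicator (evalC (q n))) _ (1 + c)
    (fun n => (BddBorel.indicator_of_isCompact (continuous_evalC _) hC).measurable)
    (fun n z => ?_) (hfB.indicator hC.measurableSet) (fun z => ?_) fun n => h _ (Or.inl ⟨q n, rfl⟩)
  · by_cases hz : z ∈ C
    · rw [Set.indicator_of_mem hz]
      have h1 : (1 : ℝ) / (n + 1) ≤ 1 := by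
        rw [div_le_one (by positivity)]
        linarith [n.cast_nonneg (α := ℝ)]
      calc ‖evalC (q n) z‖ = ‖evalC (q n) z - f z + f z‖ := by rw [sub_add_cancel]
        _ ≤ ‖evalC (q n) z - f z‖ + ‖f z‖ := norm_add_le _ _
        _ ≤ 1 + c := add_le_add ((hq n z hz).le.trans h1) (hc z)
    · rw [Set.indicator_of_notMem hz, norm_zero]; positivity
  · by_cases hz : z ∈ C
    · simp only [Set.indicator_of_mem hz]
      rw [tendsto_iff_norm_sub_tendsto_zero]
      exact squeeze_zero (fun _ => norm_nonneg _) (fun n => (hq n z hz).le)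
        tendsto_one_div_add_atTop_nhds_zero_nat
    · simp only [Set.indicator_of_notMem hz]
      exact tendsto_const_nhds

end EvalC

/-! ### Spectral measures and polynomials -/

section Spectral

variable {H : Type*} [NormedAddCommGroup H] [InnerProductSpace ℂ H] [CompleteSpace H]

/-- The real part of an operator on a Hilbert space. -/
def hilbertRe (M : H →L[ℂ] H) : H →L[ℂ] H := (2 : ℂ)⁻¹ • (M + M.adjoint)

/-- The imaginary part of an operator on a Hilbert space. -/
def hilbertIm (M : H →L[ℂ] H) : H →L[ℂ] H := (2 * Complex.I)⁻¹ • (M - M.adjoint)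

theorem commute_hilbertRe_hilbertIm {M : H →L[ℂ] H} (hM : IsStarNormal M) :
    Commute (hilbertRe M) (hilbertIm M) := by
  have h : Commute M.adjoint M := hM.star_comm_self
  have h1 : Commute (M + M.adjoint) (M - M.adjoint) :=
    ((Commute.refl M).add_left h).sub_right (h.symm.add_left (Commute.refl _))
  exact (h1.smul_left _).smul_right _

theorem re_eq_and_im_eq (z : ℂ) : ((z.re : ℝ) : ℂ) = (2 : ℂ)⁻¹ * (z + conj z) ∧
    ((z.im : ℝ) : ℂ) = (2 * Complex.I)⁻¹ * (z - conj z) := by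
  constructor
  · rw [Complex.re_eq_add_conj]; ring
  · rw [Complex.im_eq_sub_conj]; ring

/-- `Re z` and `Im z` are combinations of `z` and `z̄`, so the two homomorphisms agree on the
generators. The order properties of the continuous functional calculus thereby become available for
polynomials. -/
theorem polyHom_eq_cfc {M : H →L[ℂ] H} (hM : IsStarNormal M) (q : Poly) :
    polyHom (commute_hilbertRe_hilbertIm hM) q = cfc (evalC q) M := by
  have hc := fun q : Poly => (continuous_evalC q).continuousOn (s := spectrum ℂ M)
  have hstar : cfc (fun z : ℂ => conj z) M = M.adjoint := cfc_star_id (R := ℂ) M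
  have hX : ∀ i, polyHom (commute_hilbertRe_hilbertIm hM) (MvPolynomial.X i) =
      cfc (evalC (MvPolynomial.X i)) M := by
    intro i
    fin_cases i
    · rw [show (⟨0, by decide⟩ : Fin 2) = 0 from rfl, polyHom_X_zero,
        funext evalC_X_zero, funext fun z => (re_eq_and_im_eq z).1,
        cfc_const_mul _ _ M (by fun_prop), cfc_add M _ _ (by fun_prop) (by fun_prop), cfc_id' ℂ M,
        hstar]
      rfl
    · rw [show (⟨1, by decide⟩ : Fin 2) = 1 from rfl, polyHom_X_one,
        funext evalC_X_one, funext fun z => (re_eq_and_im_eq z).2,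
        cfc_const_mul _ _ M (by fun_prop), cfc_sub _ _ M (by fun_prop) (by fun_prop), cfc_id' ℂ M,
        hstar]
      rfl
  induction q using MvPolynomial.induction_on with
  | C c =>
    rw [funext fun z => evalC_C c z, cfc_const c M, ← MvPolynomial.algebraMap_eq, AlgHom.commutes]
  | add p q hp hq =>
    rw [map_add, hp, hq, funext fun z => evalC_add p q z, cfc_add M _ _ (hc p) (hc q)]
  | mul_X p i hp =>
    rw [map_mul, hp, hX i, funext fun z => evalC_mul p (MvPolynomial.X i) z, cfc_mul _ _ M (hc p) (hc _)]

namespace ProjMeasure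

variable {E : ProjMeasure H} {M : H →L[ℂ] H}

theorem measurableSet_spectrum (M : H →L[ℂ] H) : MeasurableSet (spectrum ℂ M) :=
  (spectrum.isCompact M).measurableSet

/-- By multiplicativity, the part of `f` off the spectrum contributes `E(σ(M)ᶜ) ∫ f dE = 0`. -/
theorem IsSpectralMeasureOf.integral_congr (hE : E.IsSpectralMeasureOf M) {f g : ℂ → ℂ}
    (hf : BddBorel f) (hg : BddBorel g) (h : ∀ z ∈ spectrum ℂ M, f z = g z) :
    E.integral f = E.integral g := by
  have hs := measurableSet_spectrum M
  have key : ∀ f, BddBorel f → E.integral f = E.integral ((spectrum ℂ M).indicator f) := by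
    intro f hf
    have h1 := E.isBorelCalculus.add (hf.indicator hs) (hf.indicator hs.compl)
    have h2 : E.integral ((spectrum ℂ M)ᶜ.indicator f) = 0 := by
      have h3 := E.integral_mul (BddBorel.indicator_one hs.compl) hf
      rw [E.integral_indicator_one hs.compl, hE.1, zero_mul] at h3
      rw [← h3]
      congr 1
      ext z
      by_cases hz : z ∈ (spectrum ℂ M)ᶜ
      · simp only [Pi.mul_apply, Set.indicator_of_mem hz, one_mul]
      · simp only [Pi.mul_apply, Set.indicator_of_notMem hz, zero_mul]
    rwa [Set.indicator_self_add_compl, h2, add_zero] at h1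
  rw [key f hf, key g hg, Set.indicator_congr h]

theorem bddBorel_evalC (M : H →L[ℂ] H) (q : Poly) :
    BddBorel ((spectrum ℂ M).indicator (evalC q)) :=
  BddBorel.indicator_of_isCompact (continuous_evalC q) (spectrum.isCompact M)

theorem IsSpectralMeasureOf.integral_id (hE : E.IsSpectralMeasureOf M) :
    E.integral ((spectrum ℂ M).indicator fun z => z) = M := by
  refine E.isBorelCalculus.eq_of
    (BddBorel.indicator_of_isCompact continuous_id (spectrum.isCompact M)) fun x => ?_
  rw [hE.2]
  refine integral_congr_ae ?_
  have h0 : E.scalar x (spectrum ℂ M)ᶜ = 0 := by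
    rw [E.scalar_apply (measurableSet_spectrum M).compl, hE.1]
    simp
  filter_upwards [show spectrum ℂ M ∈ ae (E.scalar x) from h0] with z hz
  simp [hz]

/-- Polynomials are cut off to the compact spectrum because nonconstant ones are unbounded on `ℂ`.
By multiplicativity only the coordinates matter, and these come from `∫ z dE = M` and its adjoint.
-/
theorem IsSpectralMeasureOf.integral_evalC (hE : E.IsSpectralMeasureOf M) (hM : IsStarNormal M)
    (q : Poly) : E.integral ((spectrum ℂ M).indicator (evalC q)) =
      polyHom (commute_hilbertRe_hilbertIm hM) q := by
  have hid : BddBorel ((spectrum ℂ M).indicator fun z => z) :=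
    BddBorel.indicator_of_isCompact continuous_id (spectrum.isCompact M)
  have hX : ∀ i, E.integral ((spectrum ℂ M).indicator (evalC (MvPolynomial.X i))) =
      polyHom (commute_hilbertRe_hilbertIm hM) (MvPolynomial.X i) := by
    intro i
    fin_cases i
    · rw [show (⟨0, by decide⟩ : Fin 2) = 0 from rfl, polyHom_X_zero, hilbertRe]
      conv_rhs => rw [← hE.integral_id]
      rw [← E.isBorelCalculus.star hid, ← E.isBorelCalculus.add hid hid.star,
        ← E.isBorelCalculus.smul _ (hid.add hid.star)]
      congr 1
      ext z
      by_cases hz : z ∈ spectrum ℂ M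
      · simp only [Set.indicator_of_mem hz, Pi.smul_apply, Pi.add_apply, evalC_X_zero, smul_eq_mul]
        exact (re_eq_and_im_eq z).1
      · simp [hz]
    · rw [show (⟨1, by decide⟩ : Fin 2) = 1 from rfl, polyHom_X_one, hilbertIm, sub_eq_add_neg,
        ← neg_one_smul ℂ M.adjoint]
      conv_rhs => rw [← hE.integral_id]
      rw [← E.isBorelCalculus.star hid, ← E.isBorelCalculus.smul _ hid.star,
        ← E.isBorelCalculus.add hid (hid.star.smul _),
        ← E.isBorelCalculus.smul _ (hid.add (hid.star.smul _))]
      congr 1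
      ext z
      by_cases hz : z ∈ spectrum ℂ M
      · simp only [Set.indicator_of_mem hz, Pi.smul_apply, Pi.add_apply, evalC_X_one, smul_eq_mul]
        rw [(re_eq_and_im_eq z).2, neg_one_mul, sub_eq_add_neg]
      · simp [hz]
  induction q using MvPolynomial.induction_on with
  | C c =>
    rw [← MvPolynomial.algebraMap_eq, AlgHom.commutes,
      Algebra.algebraMap_eq_smul_one (A := H →L[ℂ] H), ← E.integral_one, ← E.isBorelCalculus.smul c (BddBorel.const 1)]
    refine hE.integral_congr (bddBorel_evalC M _) ((BddBorel.const 1).smul c) fun z hz => ?_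
    simp [hz, MvPolynomial.algebraMap_eq]
  | add p q hp hq =>
    rw [map_add, ← hp, ← hq, ← E.isBorelCalculus.add (bddBorel_evalC M p) (bddBorel_evalC M q),
      ← Set.indicator_add']
    congr 2
    ext z; simp
  | mul_X p i hp =>
    rw [map_mul, ← hp, ← hX i, ← E.integral_mul (bddBorel_evalC M p) (bddBorel_evalC M _),
      ← hE.integral_congr (bddBorel_evalC M _) ((bddBorel_evalC M p).mul (bddBorel_evalC M _))]
    intro z hz
    simp [hz]

/-- An operator intertwining two normal operators and their adjoints intertwines the integrals with
respect to their spectral measures. -/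
theorem IsSpectralMeasureOf.intertwine {H' : Type*} [NormedAddCommGroup H']
    [InnerProductSpace ℂ H'] [CompleteSpace H'] {E' : ProjMeasure H'} {M' : H' →L[ℂ] H'}
    (hE : E.IsSpectralMeasureOf M) (hE' : E'.IsSpectralMeasureOf M') (hM : IsStarNormal M)
    (hM' : IsStarNormal M') {R : H →L[ℂ] H'} (h : R ∘L M = M' ∘L R)
    (h' : R ∘L M.adjoint = M'.adjoint ∘L R) {f : ℂ → ℂ} (hf : BddBorel f) :
    R ∘L E.integral f = E'.integral f ∘L R := by
  -- Both spectra are included, so that one generating class serves the two measures.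
  have hC : IsCompact (spectrum ℂ M ∪ spectrum ℂ M') :=
    (spectrum.isCompact M).union (spectrum.isCompact M')
  refine generatesBorel_evalC hC _
    (E.isBorelCalculus.stableClass_intertwine E'.isBorelCalculus R) ?_ f hf
  rintro _ (⟨q, rfl⟩ | ⟨g, hg, rfl⟩)
  · have hq := BddBorel.indicator_of_isCompact (continuous_evalC q) hC
    rw [hE.integral_congr hq (bddBorel_evalC M q) fun z hz => by
        simp [hz],
      hE'.integral_congr hq (bddBorel_evalC M' q) fun z hz => by
        simp [hz],
      hE.integral_evalC hM, hE'.integral_evalC hM']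
    clear hq
    have hX : ∀ i, R ∘L polyHom (commute_hilbertRe_hilbertIm hM) (MvPolynomial.X i) =
        polyHom (commute_hilbertRe_hilbertIm hM') (MvPolynomial.X i) ∘L R := by
      intro i
      fin_cases i
      · rw [show (⟨0, by decide⟩ : Fin 2) = 0 from rfl, polyHom_X_zero, polyHom_X_zero]
        simp only [hilbertRe, ContinuousLinearMap.comp_smul, ContinuousLinearMap.smul_comp,
          ContinuousLinearMap.comp_add, ContinuousLinearMap.add_comp, h, h']
      · rw [show (⟨1, by decide⟩ : Fin 2) = 1 from rfl, polyHom_X_one, polyHom_X_one]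
        simp only [hilbertIm, ContinuousLinearMap.comp_smul, ContinuousLinearMap.smul_comp,
          ContinuousLinearMap.comp_sub, ContinuousLinearMap.sub_comp, h, h']
    induction q using MvPolynomial.induction_on with
    | C c =>
      rw [← MvPolynomial.algebraMap_eq, AlgHom.commutes, AlgHom.commutes,
        Algebra.algebraMap_eq_smul_one, Algebra.algebraMap_eq_smul_one]
      ext x; simp
    | add p q hp hq =>
      rw [map_add, map_add, ContinuousLinearMap.comp_add, ContinuousLinearMap.add_comp,
        hp, hq]
    | mul_X p i hp =>
      rw [map_mul, map_mul, ContinuousLinearMap.mul_def, ContinuousLinearMap.mul_def,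
        ← ContinuousLinearMap.comp_assoc, hp, ContinuousLinearMap.comp_assoc, hX i,
        ContinuousLinearMap.comp_assoc]
  · have hg' := hg.indicator hC.measurableSet.compl
    rw [hE.integral_congr hg' BddBorel.zero fun z hz => by
        simp [hz],
      hE'.integral_congr hg' BddBorel.zero fun z hz => by
        simp [hz],
      E.isBorelCalculus.zero, E'.isBorelCalculus.zero]
    simp

end ProjMeasure

end Spectral

end KreinNormal

namespace KreinNormal

/-! ### Zero-dimensional ideals -/

section Ideals

variable {I : Ideal Poly}

theorem le_primaryComponent (I : Ideal Poly) (a : Fin 2 → ℂ) : I ≤ primaryComponent I a :=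
  fun f hf => ⟨1, by simp, by simpa using hf⟩

theorem mem_variety_iff {a : Fin 2 → ℂ} :
    a ∈ variety I ↔ ∀ f ∈ I, MvPolynomial.eval a f = 0 := by
  simp only [variety, MvPolynomial.mem_zeroLocus_iff, MvPolynomial.aeval_eq_eval]

/-- Nullstellensatz: an ideal which is contained in no `P(a)` is the unit ideal. -/
theorem eq_top_of_forall_not_le (h : ∀ a, ¬ I ≤ pointIdeal a) : I = ⊤ := by
  by_contra hI
  obtain ⟨m, hm, hle⟩ := I.exists_le_maximal hI
  obtain ⟨b, hb⟩ := MvPolynomial.isMaximal_iff_eq_vanishingIdeal_singleton.1 hm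
  refine h b fun f hf => ?_
  have := hle hf
  rw [hb, MvPolynomial.mem_vanishingIdeal_singleton_iff, MvPolynomial.aeval_eq_eval] at this
  exact mem_pointIdeal_iff.2 this

theorem pointIdeal_isPrime (a : Fin 2 → ℂ) : (pointIdeal a).IsPrime := by
  have : pointIdeal a = RingHom.ker (MvPolynomial.eval a) := by
    ext f; rw [mem_pointIdeal_iff, RingHom.mem_ker]
  rw [this]
  exact RingHom.ker_isPrime _

/-- Every element of `ℂ[x, y]` satisfies a univariate polynomial equation modulo `I`. -/
theorem exists_aeval_mem [FiniteDimensional ℂ (Poly ⧸ I)] (l : Poly) :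
    ∃ χ : Polynomial ℂ, χ ≠ 0 ∧ Polynomial.aeval l χ ∈ I := by
  obtain ⟨χ, hχ, h⟩ := (Algebra.IsAlgebraic.isAlgebraic (R := ℂ) (Ideal.Quotient.mkₐ ℂ I l))
  refine ⟨χ, hχ, ?_⟩
  rw [Polynomial.aeval_algHom_apply] at h
  exact Ideal.Quotient.eq_zero_iff_mem.1 h

theorem eval_aeval (a : Fin 2 → ℂ) (l : Poly) (χ : Polynomial ℂ) :
    MvPolynomial.eval a (Polynomial.aeval l χ) = χ.eval (MvPolynomial.eval a l) := by
  rw [← MvPolynomial.coe_aeval_eq_eval, RingHom.coe_coe, ← Polynomial.aeval_algHom_apply,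
    Polynomial.coe_aeval_eq_eval]

/-- Each coordinate of a common zero is a root of a fixed nonzero univariate polynomial. -/
theorem finite_variety [FiniteDimensional ℂ (Poly ⧸ I)] : (variety I).Finite := by
  choose χ hχ h using fun i : Fin 2 => exists_aeval_mem (I := I) (MvPolynomial.X i)
  refine (Set.Finite.pi' fun i => (χ i).rootSet_finite ℂ).subset fun a ha i => ?_
  have h1 := mem_variety_iff.1 ha _ (h i)
  rw [eval_aeval, MvPolynomial.eval_X] at h1
  rw [Polynomial.mem_rootSet]
  exact ⟨hχ i, by simpa using h1⟩

/-- A polynomial in `Q(a)` which does not vanish at a given point `c ≠ a`. -/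
theorem exists_mem_primaryComponent_eval_ne_zero [FiniteDimensional ℂ (Poly ⧸ I)]
    {a c : Fin 2 → ℂ} (h : c ≠ a) : ∃ f ∈ primaryComponent I a, MvPolynomial.eval c f ≠ 0 := by
  obtain ⟨i, hi⟩ := Function.ne_iff.1 h
  set l : Poly := MvPolynomial.X i - MvPolynomial.C (a i)
  obtain ⟨χ, hχ, hmem⟩ := exists_aeval_mem (I := I) l
  -- Write `χ = X ^ k * u` with `u(0) ≠ 0`. As `l` vanishes at `a`, the polynomial `u(l)` does not;
  -- it multiplies `l ^ k` into `I`, so `l ^ k` belongs to `Q(a)`.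
  obtain ⟨u, hu, hu0⟩ := Polynomial.exists_eq_pow_rootMultiplicity_mul_and_not_dvd χ hχ 0
  rw [map_zero, sub_zero] at hu hu0
  refine ⟨l ^ χ.rootMultiplicity 0, ⟨Polynomial.aeval l u, ?_, ?_⟩, ?_⟩
  · rw [eval_aeval]
    have : MvPolynomial.eval a l = 0 := by simp [l]
    rw [this]
    rwa [Polynomial.X_dvd_iff, Polynomial.coeff_zero_eq_eval_zero] at hu0
  · rw [hu, map_mul, map_pow, Polynomial.aeval_X] at hmem
    rwa [mul_comm]
  · rw [map_pow]
    refine pow_ne_zero _ ?_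
    simpa [l, sub_eq_zero] using hi

theorem eq_of_primaryComponent_le [FiniteDimensional ℂ (Poly ⧸ I)] {a c : Fin 2 → ℂ}
    (h : primaryComponent I a ≤ pointIdeal c) : c = a := by
  by_contra hne
  obtain ⟨f, hf, hfc⟩ := exists_mem_primaryComponent_eval_ne_zero (I := I) hne
  exact hfc (mem_pointIdeal_iff.1 (h hf))

theorem eq_of_mul_primaryComponent_le [FiniteDimensional ℂ (Poly ⧸ I)] {a c : Fin 2 → ℂ}
    (h : pointIdeal a * primaryComponent I a ≤ pointIdeal c) : c = a := by
  rcases (pointIdeal_isPrime c).mul_le.1 h with h | h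
  · exact (eq_of_pointIdeal_le h).symm
  · exact eq_of_primaryComponent_le h

/-- Chinese remainder theorem: values in the local algebras `𝒜(z)` at all real points and `ℬ(a)` at
all nonreal points of `V(I)` can be prescribed simultaneously. -/
theorem exists_poly_interpolate [FiniteDimensional ℂ (Poly ⧸ I)]
    (α : (z : realVariety I) → AlgA I (tau z)) (β : (a : nonrealVariety I) → AlgB I a) :
    ∃ r : Poly, (∀ z, Ideal.Quotient.mk _ r = α z) ∧ ∀ a, Ideal.Quotient.mk _ r = β a := by
  classical
  have hfin := (finite_variety (I := I)).to_subtype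
  -- The ideals `P(a) · Q(a)` are used at nonreal points too. There the congruence is stronger than
  -- required and is weakened to one modulo `Q(a)` at the end.
  let J : variety I → Ideal Poly := fun a => pointIdeal a * primaryComponent I a
  have hJ : Pairwise (Function.onFun IsCoprime J) := by
    intro a b hab
    rw [Function.onFun, Ideal.isCoprime_iff_sup_eq]
    refine eq_top_of_forall_not_le fun c hc => hab ?_
    have h1 := eq_of_mul_primaryComponent_le (le_sup_left.trans hc)
    have h2 := eq_of_mul_primaryComponent_le (le_sup_right.trans hc)
    exact Subtype.ext (h1.symm.trans h2)
  choose α' hα' using fun z => Ideal.Quotient.mk_surjective (α z)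
  choose β' hβ' using fun a => Ideal.Quotient.mk_surjective (β a)
  let g : variety I → Poly := fun a =>
    if h : ∃ i, (a.1 i).im ≠ 0 then β' ⟨a.1, a.2, h⟩
    else if h' : ∃ z : realVariety I, tau z = a then α' h'.choose else 0
  obtain ⟨r, hr⟩ := Ideal.exists_forall_sub_mem_ideal hJ g
  have htau : ∀ z, ¬ ∃ i, (tau z i).im ≠ 0 := by
    rintro z ⟨i, hi⟩
    fin_cases i <;> simp [tau] at hi
  have hinj : ∀ z w, tau z = tau w → z = w := by
    intro z w h
    have h0 := congrFun h 0
    have h1 := congrFun h 1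
    simp only [tau, Matrix.cons_val_zero, Matrix.cons_val_one, Complex.ofReal_inj] at h0 h1
    exact Complex.ext h0 h1
  refine ⟨r, fun z => ?_, fun a => ?_⟩
  · rw [← hα' z]
    have h := hr ⟨tau z, z.2⟩
    have hex : ∃ z' : realVariety I, tau z' = tau z := ⟨z, rfl⟩
    have hch : hex.choose = z := Subtype.ext (hinj _ _ hex.choose_spec)
    simp only [g, dif_neg (htau z), dif_pos hex, hch] at h
    exact Ideal.Quotient.eq.2 h
  · rw [← hβ' a]
    have h := hr ⟨a, a.2.1⟩
    simp only [g, dif_pos a.2.2] at h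
    have hle : J ⟨a, a.2.1⟩ ≤ primaryComponent I a := Ideal.mul_le_right
    exact Ideal.Quotient.eq.2 (hle h)

/-- The ideal of the polynomials vanishing at all real points of `V(I)`. -/
def realVanishing (I : Ideal Poly) : Ideal Poly := ⨅ z : realVariety I, pointIdeal (tau z)

theorem mem_realVanishing_iff {f : Poly} :
    f ∈ realVanishing I ↔ ∀ z ∈ realVariety I, evalC f z = 0 := by
  simp only [realVanishing, Ideal.mem_iInf, mem_pointIdeal_iff, Subtype.forall, evalC]

theorem finite_realVariety [FiniteDimensional ℂ (Poly ⧸ I)] : (realVariety I).Finite := by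
  refine finite_variety.preimage fun z _ w _ h => ?_
  have h0 := congrFun h 0
  have h1 := congrFun h 1
  simp only [tau, Matrix.cons_val_zero, Matrix.cons_val_one, Complex.ofReal_inj] at h0 h1
  exact Complex.ext h0 h1

theorem exists_poly_vanishing_off {s : Set (Fin 2 → ℂ)} (hs : s.Finite) (c : Fin 2 → ℂ) :
    ∃ e : Poly, MvPolynomial.eval c e ≠ 0 ∧ ∀ a ∈ s, a ≠ c → MvPolynomial.eval a e = 0 := by
  classical
  have h1 : ∀ a : Fin 2 → ℂ, a ≠ c → ∃ e : Poly, MvPolynomial.eval c e ≠ 0 ∧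
      MvPolynomial.eval a e = 0 := by
    intro a ha
    obtain ⟨i, hi⟩ := Function.ne_iff.1 ha
    refine ⟨MvPolynomial.X i - MvPolynomial.C (a i), ?_, by simp⟩
    simpa [sub_eq_zero] using Ne.symm hi
  choose! e he he' using h1
  refine ⟨∏ a ∈ hs.toFinset.erase c, e a, ?_, fun a ha hac => ?_⟩
  · rw [map_prod]
    exact Finset.prod_ne_zero_iff.2 fun a ha => he a (Finset.ne_of_mem_erase ha)
  · rw [map_prod]
    exact Finset.prod_eq_zero (Finset.mem_erase.2 ⟨hac, hs.mem_toFinset.2 ha⟩) (he' a hac)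

/-- The question is local. At a real zero `z`, a generator `u v` of `P(z) · Q(z)` is multiplied by
an `e` vanishing at all other zeros, so that `e u` vanishes at every real zero. At any other `c`
such an `e` already vanishes on `V_ℝ(I)`, and membership in `Q(c)` suffices; off `V(I)` it is
automatic. -/
theorem mem_realVanishing_mul [FiniteDimensional ℂ (Poly ⧸ I)] {r : Poly}
    (hreal : ∀ z ∈ realVariety I, r ∈ pointIdeal (tau z) * primaryComponent I (tau z))
    (hnon : ∀ a ∈ nonrealVariety I, r ∈ primaryComponent I a) : r ∈ realVanishing I * I := by
  suffices h : ∀ c, r ∈ primaryComponent (realVanishing I * I) c by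
    -- The ideal of denominators of `r`. Local membership at `c` gives it an element not vanishing
    -- at `c`, so by the Nullstellensatz it contains `1`.
    let A : Ideal Poly := (realVanishing I * I).colon {r}
    have hA : A = ⊤ := by
      refine eq_top_of_forall_not_le fun c hc => ?_
      obtain ⟨g, hg, hgr⟩ := h c
      have : g ∈ A := Submodule.mem_colon_singleton.2 hgr
      exact hg (mem_pointIdeal_iff.1 (hc this))
    have h1 : (1 : Poly) ∈ A := by rw [hA]; trivial
    simpa using Submodule.mem_colon_singleton.1 h1
  intro c
  by_cases hc : ∃ z ∈ realVariety I, tau z = c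
  · obtain ⟨z, hz, rfl⟩ := hc
    obtain ⟨e, he, he'⟩ := exists_poly_vanishing_off (finite_variety (I := I)) (tau z)
    refine Ideal.mul_le.2 ?_ (hreal z hz)
    rintro u hu v ⟨g, hg, hgv⟩
    refine ⟨e * g, by simp [he, hg], ?_⟩
    have : e * g * (u * v) = (e * u) * (g * v) := by ring
    rw [this]
    refine Ideal.mul_mem_mul (mem_realVanishing_iff.2 fun w hw => ?_) hgv
    rw [evalC_mul]
    by_cases hwz : tau w = tau z
    · rw [evalC, evalC, hwz, mem_pointIdeal_iff.1 hu, mul_zero]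
    · rw [evalC, he' _ hw hwz, zero_mul]
  · have hr : r ∈ primaryComponent I c := by
      by_cases hcV : c ∈ variety I
      · refine hnon c ⟨hcV, ?_⟩
        by_contra! hcon
        refine hc ⟨⟨(c 0).re, (c 1).re⟩, ?_, ?_⟩
        all_goals
          have htau : tau ⟨(c 0).re, (c 1).re⟩ = c := by
            funext i
            fin_cases i
            · exact Complex.ext rfl (hcon 0).symm
            · exact Complex.ext rfl (hcon 1).symm
        · change tau _ ∈ variety I
          rwa [htau]
        · exact htau
      · rw [mem_variety_iff] at hcV
        push Not at hcV
        obtain ⟨g, hg, hgc⟩ := hcV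
        exact ⟨g, hgc, Ideal.mul_mem_right _ _ hg⟩
    obtain ⟨g, hg, hgr⟩ := hr
    obtain ⟨e, he, he'⟩ := exists_poly_vanishing_off (finite_variety (I := I)) c
    refine ⟨e * g, by simp [he, hg], ?_⟩
    rw [mul_assoc]
    refine Ideal.mul_mem_mul (mem_realVanishing_iff.2 fun w hw => he' _ hw fun h => ?_) hgr
    exact hc ⟨w, hw, h⟩

/-- A polynomial representing `0` in all local algebras is a combination of the generators of `I`
with coefficients vanishing at the real points of `V(I)`. -/
theorem exists_eq_sum_of_mem [FiniteDimensional ℂ (Poly ⧸ I)] {m : ℕ} {p : Fin m → Poly}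
    (hgen : Ideal.span (Set.range p) = I) {r : Poly}
    (hreal : ∀ z ∈ realVariety I, r ∈ pointIdeal (tau z) * primaryComponent I (tau z))
    (hnon : ∀ a ∈ nonrealVariety I, r ∈ primaryComponent I a) :
    ∃ s : Fin m → Poly, (∀ j, ∀ z ∈ realVariety I, evalC (s j) z = 0) ∧ r = ∑ j, s j * p j := by
  have h := mem_realVanishing_mul hreal hnon
  have h' : r ∈ realVanishing I • Ideal.span (Set.range p) := by rw [hgen]; exact h
  obtain ⟨a, ha, hsum⟩ := (Submodule.mem_ideal_smul_span_iff_exists_sum _ _ _).1 h'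
  refine ⟨a, fun j => mem_realVanishing_iff.1 (ha j), ?_⟩
  rw [← hsum, Finsupp.sum_fintype _ _ (by simp)]
  rfl

end Ideals

end KreinNormal

namespace KreinNormal

open Filter

section Krein

variable {K : Type*} [NormedAddCommGroup K] [InnerProductSpace ℂ K] [CompleteSpace K]
  [KreinSpace K]

/-! ### The Krein space adjoint -/

theorem form_ext {y y' : K} (h : ∀ x, form x y = form x y') : y = y' := by
  have h1 : KreinSpace.J y = KreinSpace.J y' := ext_inner_left ℂ h
  rw [← J_J y, h1, J_J]

theorem conj_form_symm (x y : K) : conj (form y x) = form x y := by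
  rw [form, form, inner_conj_symm, inner_J_left]

theorem eq_kreinAdjoint_of_form {C D : K →L[ℂ] K} (h : ∀ x y, form (C x) y = form x (D y)) :
    D = kreinAdjoint C := by
  ext y
  exact form_ext fun x => by rw [← h, form_kreinAdjoint]

theorem kreinAdjoint_kreinAdjoint (C : K →L[ℂ] K) : kreinAdjoint (kreinAdjoint C) = C :=
  (eq_kreinAdjoint_of_form fun x y => by
    rw [← conj_form_symm, ← form_kreinAdjoint, conj_form_symm]).symm

theorem kreinAdjoint_mul (C D : K →L[ℂ] K) :
    kreinAdjoint (C * D) = kreinAdjoint D * kreinAdjoint C :=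
  (eq_kreinAdjoint_of_form fun x y => by
    rw [mul_apply_eq_comp, mul_apply_eq_comp, form_kreinAdjoint, form_kreinAdjoint]).symm

theorem kreinAdjoint_add (C D : K →L[ℂ] K) :
    kreinAdjoint (C + D) = kreinAdjoint C + kreinAdjoint D := by
  simp only [kreinAdjoint, map_add, mul_add, add_mul]

theorem kreinAdjoint_smul (c : ℂ) (C : K →L[ℂ] K) :
    kreinAdjoint (c • C) = conj c • kreinAdjoint C := by
  simp only [kreinAdjoint, map_smulₛₗ, mul_smul_comm, smul_mul_assoc]

theorem kreinAdjoint_one : kreinAdjoint (1 : K →L[ℂ] K) = 1 :=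
  (eq_kreinAdjoint_of_form fun _ _ => rfl).symm

theorem commute_kreinAdjoint {C D : K →L[ℂ] K} (h : Commute C D) :
    Commute (kreinAdjoint C) (kreinAdjoint D) := by
  rw [commute_iff_eq, ← kreinAdjoint_mul, ← kreinAdjoint_mul, h.eq]

theorem kreinAdjoint_comp_adjointFrom {H : Type*} [NormedAddCommGroup H] [InnerProductSpace ℂ H]
    [CompleteSpace H] (T : H →L[ℂ] K) (D : H →L[ℂ] H) :
    kreinAdjoint (T ∘L D ∘L adjointFrom T) = T ∘L D.adjoint ∘L adjointFrom T := by
  refine (eq_kreinAdjoint_of_form fun x y => ?_).symm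
  simp only [ContinuousLinearMap.comp_apply]
  rw [form_adjointFrom, ← conj_form_symm, form_adjointFrom, inner_conj_symm,
    ContinuousLinearMap.adjoint_inner_right]

/-! ### Polynomials of a normal operator -/

theorem commute_rePart_imPart {N : K →L[ℂ] K} (hN : IsKreinNormal N) :
    Commute (rePart N) (imPart N) := by
  have h : Commute N (kreinAdjoint N) := hN
  have h1 : Commute (N + kreinAdjoint N) (N - kreinAdjoint N) :=
    ((Commute.refl N).add_left h.symm).sub_right (h.add_left (Commute.refl _))
  exact (h1.smul_left _).smul_right _

theorem polyHom_eq_polyAt {N : K →L[ℂ] K} (hN : IsKreinNormal N) (q : Poly) :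
    polyHom (commute_rePart_imPart hN) q = polyAt N q := polyHom_apply _ q

theorem kreinAdjoint_rePart (N : K →L[ℂ] K) : kreinAdjoint (rePart N) = rePart N := by
  rw [rePart, kreinAdjoint_smul, kreinAdjoint_add, kreinAdjoint_kreinAdjoint, add_comm,
    map_inv₀, map_ofNat]

theorem kreinAdjoint_imPart (N : K →L[ℂ] K) : kreinAdjoint (imPart N) = imPart N := by
  rw [imPart, kreinAdjoint_smul, sub_eq_add_neg, ← neg_one_smul ℂ (kreinAdjoint N),
    kreinAdjoint_add, kreinAdjoint_smul, kreinAdjoint_kreinAdjoint]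
  simp only [map_inv₀, map_mul, map_ofNat, Complex.conj_I, map_neg, map_one, mul_neg, neg_smul,
    one_smul, inv_neg, smul_add, smul_neg, neg_neg]
  exact add_comm _ _

theorem kreinAdjoint_polyAt {N : K →L[ℂ] K} (hN : IsKreinNormal N) (q : Poly) :
    kreinAdjoint (polyAt N q) = polyAt N (sharpHom q) := by
  simp only [← polyHom_eq_polyAt hN]
  induction q using MvPolynomial.induction_on with
  | C c =>
    rw [sharpHom, MvPolynomial.map_C, ← MvPolynomial.algebraMap_eq, AlgHom.commutes,
      AlgHom.commutes, Algebra.algebraMap_eq_smul_one, Algebra.algebraMap_eq_smul_one,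
      kreinAdjoint_smul, kreinAdjoint_one]
  | add p q hp hq => rw [map_add, kreinAdjoint_add, hp, hq, map_add, map_add]
  | mul_X p i hp =>
    have hX : kreinAdjoint (polyHom (commute_rePart_imPart hN) (MvPolynomial.X i)) =
        polyHom (commute_rePart_imPart hN) (MvPolynomial.X i) := by
      fin_cases i
      · rw [show (⟨0, by decide⟩ : Fin 2) = 0 from rfl, polyHom_X_zero, kreinAdjoint_rePart]
      · rw [show (⟨1, by decide⟩ : Fin 2) = 1 from rfl, polyHom_X_one, kreinAdjoint_imPart]
    rw [map_mul, kreinAdjoint_mul, hp, hX, ← map_mul, map_mul sharpHom]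
    simp only [sharpHom, MvPolynomial.map_X]
    rw [mul_comm]

theorem commute_polyAt {N C : K →L[ℂ] K} (hN : IsKreinNormal N) (h : Commute C N)
    (h' : Commute C (kreinAdjoint N)) (q : Poly) : Commute C (polyAt N q) := by
  simp only [← polyHom_eq_polyAt hN]
  induction q using MvPolynomial.induction_on with
  | C c =>
    rw [← MvPolynomial.algebraMap_eq, AlgHom.commutes]
    exact (Algebra.commutes c C).symm
  | add p q hp hq => rw [map_add]; exact hp.add_right hq
  | mul_X p i hp =>
    rw [map_mul]
    refine hp.mul_right ?_
    fin_cases i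
    · rw [show (⟨0, by decide⟩ : Fin 2) = 0 from rfl, polyHom_X_zero]
      exact (h.add_right h').smul_right _
    · rw [show (⟨1, by decide⟩ : Fin 2) = 1 from rfl, polyHom_X_one]
      exact (h.sub_right h').smul_right _

/-! ### Nonnegative operators -/

variable {P : K →L[ℂ] K} (hP : FormNonneg P)

theorem FormNonneg.kreinAdjoint_eq (hP : FormNonneg P) : kreinAdjoint P = P :=
  (eq_kreinAdjoint_of_form fun x y => by rw [← conj_form_symm, hP.conj_form]).symm

theorem denseRange_factorQuot : DenseRange (factorQuot P hP) :=
  UniformSpace.Completion.denseRange_coe (α := PreFactor P hP)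

theorem clm_ext_factorQuot {X : Type*} [NormedAddCommGroup X] [InnerProductSpace ℂ X]
    {D D' : FactorSpace P hP →L[ℂ] X} (h : D ∘L factorQuot P hP = D' ∘L factorQuot P hP) :
    D = D' := by
  refine ContinuousLinearMap.coeFn_injective
    ((denseRange_factorQuot hP).equalizer D.continuous D'.continuous ?_)
  exact congrArg (fun L : K →L[ℂ] X => (L : K → X)) h

theorem exists_clm_comp_factorQuot {X : Type*} [NormedAddCommGroup X] [InnerProductSpace ℂ X]
    [CompleteSpace X] (L : K →L[ℂ] X) (c : ℝ) (h : ∀ x, ‖L x‖ ≤ c * ‖factorQuot P hP x‖) :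
    ∃ D : FactorSpace P hP →L[ℂ] X, D ∘L factorQuot P hP = L ∧ ∀ x, ‖D x‖ ≤ c * ‖x‖ := by
  refine ⟨L.toLinearMap.extendOfNorm (factorQuot P hP).toLinearMap, ?_, fun x => ?_⟩
  · ext x
    exact LinearMap.extendOfNorm_eq (denseRange_factorQuot hP) ⟨c, h⟩ x
  · exact LinearMap.norm_extendOfNorm_apply_le (denseRange_factorQuot hP) c h x

theorem norm_factorQuot_sq (x : K) : ‖factorQuot P hP x‖ ^ 2 = (form x (P x)).re := by
  rw [← inner_factorQuot P hP x x, inner_self_eq_norm_sq_to_K]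
  norm_cast

/-- The Cauchy–Schwarz inequality for `[P ·, ·]`, after one factor `C` is moved across as `C⁺` and
past `P`. -/
theorem norm_factorQuot_apply_sq_le {C : K →L[ℂ] K} (hC : Commute (kreinAdjoint C) P) (x : K) :
    ‖factorQuot P hP (C x)‖ ^ 2 ≤
      ‖factorQuot P hP x‖ * ‖factorQuot P hP ((kreinAdjoint C * C) x)‖ := by
  rw [norm_factorQuot_sq, form_kreinAdjoint, ← mul_apply_eq_comp (kreinAdjoint C), hC.eq,
    mul_apply_eq_comp, ← mul_apply_eq_comp (kreinAdjoint C), ← inner_factorQuot P hP]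
  exact (Complex.re_le_norm _).trans (norm_inner_le_norm _ _)

/-- Lax's inequality for an operator symmetric with respect to `[P ·, ·]`. -/
theorem norm_factorQuot_apply_le_of_symm {D : K →L[ℂ] K} (hD : Commute D P)
    (hsym : kreinAdjoint D = D) (x : K) :
    ‖factorQuot P hP (D x)‖ ≤ ‖D‖ * ‖factorQuot P hP x‖ := by
  set u := ‖factorQuot P hP x‖ with hu
  set v := ‖factorQuot P hP (D x)‖ with hv
  have hpow : ∀ n : ℕ, kreinAdjoint (D ^ n) = D ^ n := by
    intro n
    induction n with
    | zero => rw [pow_zero, kreinAdjoint_one]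
    | succ n ih => rw [pow_succ, kreinAdjoint_mul, ih, hsym, ← pow_succ', pow_succ]
  have hu0 : 0 ≤ u := norm_nonneg _
  have hv0 : 0 ≤ v := norm_nonneg _
  rcases hu0.eq_or_lt with h0 | hpos
  · have := norm_factorQuot_apply_sq_le hP (C := D) (by rwa [hsym]) x
    rw [← hu, ← hv, ← h0, zero_mul] at this
    have hv' : v = 0 := by nlinarith
    rw [hv', ← h0, mul_zero]
  -- Repeated use of Cauchy–Schwarz for `D ^ 2 ^ n`. With denominators restored this reads `(v / u)
  -- ^ 2 ^ n ≤ ‖D ^ 2 ^ n x‖_P / u`.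
  have key : ∀ n : ℕ, v ^ 2 ^ n * u ≤ u ^ 2 ^ n * ‖factorQuot P hP ((D ^ 2 ^ n) x)‖ := by
    intro n
    induction n with
    | zero => rw [pow_zero, pow_one, pow_one, pow_one, mul_comm]
    | succ n ih =>
      have h1 := norm_factorQuot_apply_sq_le hP (C := D ^ 2 ^ n)
        (by rw [hpow]; exact hD.pow_left _) x
      rw [hpow, ← pow_add, ← two_mul, ← pow_succ'] at h1
      have h2 : (v ^ 2 ^ n * u) ^ 2 ≤ (u ^ 2 ^ n * ‖factorQuot P hP ((D ^ 2 ^ n) x)‖) ^ 2 := by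
        gcongr
      rw [mul_pow, mul_pow, ← pow_mul, ← pow_mul, ← pow_succ] at h2
      have h3 : v ^ 2 ^ (n + 1) * u ^ 2 ≤
          u ^ 2 ^ (n + 1) * (u * ‖factorQuot P hP ((D ^ 2 ^ (n + 1)) x)‖) :=
        h2.trans (by gcongr)
      refine le_of_mul_le_mul_right ?_ hpos
      linarith
  -- Otherwise `v / (‖D‖ u) > 1`, although its powers with exponents `2 ^ n` are bounded
  -- independently of `n`.
  by_contra! hlt
  have hd0 : 0 < ‖D‖ := by
    refine norm_pos_iff.2 fun h => ?_
    simp [h, hv] at hlt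
  have hdu : 0 < ‖D‖ * u := mul_pos hd0 hpos
  have hbound : ∀ n : ℕ, (v / (‖D‖ * u)) ^ 2 ^ n ≤ ‖factorQuot P hP‖ * ‖x‖ / u := by
    intro n
    rw [div_pow, div_le_div_iff₀ (by positivity) hpos]
    refine (key n).trans ?_
    have h1 : ‖factorQuot P hP ((D ^ 2 ^ n) x)‖ ≤ ‖factorQuot P hP‖ * (‖D‖ ^ 2 ^ n * ‖x‖) := by
      refine ((factorQuot P hP).le_opNorm _).trans ?_
      gcongr
      refine ((D ^ 2 ^ n).le_opNorm x).trans ?_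
      gcongr
      exact norm_pow_le' D (by positivity)
    calc _ ≤ u ^ 2 ^ n * (‖factorQuot P hP‖ * (‖D‖ ^ 2 ^ n * ‖x‖)) := by gcongr
      _ = _ := by rw [mul_pow]; ring
  have ht : 1 < v / (‖D‖ * u) := (one_lt_div hdu).2 hlt
  obtain ⟨n, hn⟩ := pow_unbounded_of_one_lt (‖factorQuot P hP‖ * ‖x‖ / u) ht
  have := (hn.trans_le (pow_le_pow_right₀ ht.le (Nat.lt_two_pow_self (n := n)).le)).trans_le
    (hbound n)
  exact lt_irrefl _ this

/-! ### Lifting operators to the Hilbert space -/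

/-- `D = T⁻¹ C T`, and `D` is compatible with `T⁺` as well. -/
structure Lifts {H : Type*} [NormedAddCommGroup H] [InnerProductSpace ℂ H] [CompleteSpace H]
    (T : H →L[ℂ] K) (C : K →L[ℂ] K) (D : H →L[ℂ] H) : Prop where
  left : T ∘L D = C ∘L T
  right : D ∘L adjointFrom T = adjointFrom T ∘L C

namespace Lifts

variable {H : Type*} [NormedAddCommGroup H] [InnerProductSpace ℂ H] [CompleteSpace H]
  {T : H →L[ℂ] K} {C C' : K →L[ℂ] K} {D D' : H →L[ℂ] H}

theorem add (h : Lifts T C D) (h' : Lifts T C' D') : Lifts T (C + C') (D + D') :=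
  ⟨by rw [ContinuousLinearMap.comp_add, ContinuousLinearMap.add_comp, h.left, h'.left],
   by rw [ContinuousLinearMap.comp_add, ContinuousLinearMap.add_comp, h.right, h'.right]⟩

theorem sub (h : Lifts T C D) (h' : Lifts T C' D') : Lifts T (C - C') (D - D') :=
  ⟨by rw [ContinuousLinearMap.comp_sub, ContinuousLinearMap.sub_comp, h.left, h'.left],
   by rw [ContinuousLinearMap.comp_sub, ContinuousLinearMap.sub_comp, h.right, h'.right]⟩

theorem smul (c : ℂ) (h : Lifts T C D) : Lifts T (c • C) (c • D) :=
  ⟨by rw [ContinuousLinearMap.comp_smul, ContinuousLinearMap.smul_comp, h.left],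
   by rw [ContinuousLinearMap.comp_smul, ContinuousLinearMap.smul_comp, h.right]⟩

theorem one : Lifts T 1 1 := ⟨rfl, rfl⟩

theorem mul (h : Lifts T C D) (h' : Lifts T C' D') : Lifts T (C * C') (D * D') :=
  ⟨by rw [ContinuousLinearMap.mul_def, ContinuousLinearMap.mul_def,
        ← ContinuousLinearMap.comp_assoc, h.left, ContinuousLinearMap.comp_assoc, h'.left,
        ContinuousLinearMap.comp_assoc],
   by rw [ContinuousLinearMap.mul_def, ContinuousLinearMap.mul_def,
        ContinuousLinearMap.comp_assoc, h'.right, ← ContinuousLinearMap.comp_assoc, h.right,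
        ContinuousLinearMap.comp_assoc]⟩

/-- Taking adjoints interchanges the two relations in `Lifts`, which is the reason for carrying
both. -/
theorem adjoint (h : Lifts T C D) : Lifts T (kreinAdjoint C) D.adjoint := by
  constructor
  · ext x
    refine form_ext fun y => ?_
    have h1 := congrArg (fun L : K →L[ℂ] H => L y) h.right
    simp only [ContinuousLinearMap.comp_apply] at h1 ⊢
    rw [← form_kreinAdjoint, ← conj_form_symm, form_adjointFrom, inner_conj_symm,
      ← conj_form_symm, form_adjointFrom, inner_conj_symm, ← h1,
      ContinuousLinearMap.adjoint_inner_right]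
  · ext x
    refine ext_inner_left ℂ fun y => ?_
    have h1 := congrArg (fun L : H →L[ℂ] K => L y) h.left
    simp only [ContinuousLinearMap.comp_apply] at h1 ⊢
    rw [ContinuousLinearMap.adjoint_inner_right, ← form_adjointFrom, ← form_adjointFrom, h1,
      form_kreinAdjoint]

theorem unique (hT : Function.Injective T) (h : Lifts T C D) (h' : Lifts T C D') : D = D' := by
  ext x
  apply hT
  have := congrArg (fun L : H →L[ℂ] K => L x) (h.left.trans h'.left.symm)
  simpa using this

theorem polyHom {N : K →L[ℂ] K} (hN : IsKreinNormal N) {M : H →L[ℂ] H} (hM : IsStarNormal M)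
    (h : Lifts T N M) (q : Poly) :
    Lifts T (polyAt N q) (polyHom (commute_hilbertRe_hilbertIm hM) q) := by
  rw [← polyHom_eq_polyAt hN]
  induction q using MvPolynomial.induction_on with
  | C c =>
    rw [← MvPolynomial.algebraMap_eq, AlgHom.commutes, AlgHom.commutes,
      Algebra.algebraMap_eq_smul_one, Algebra.algebraMap_eq_smul_one]
    exact one.smul c
  | add p q hp hq => rw [map_add, map_add]; exact hp.add hq
  | mul_X p i hp =>
    rw [map_mul, map_mul]
    refine hp.mul ?_
    fin_cases i
    · rw [show (⟨0, by decide⟩ : Fin 2) = 0 from rfl, polyHom_X_zero, polyHom_X_zero]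
      exact (h.add h.adjoint).smul _
    · rw [show (⟨1, by decide⟩ : Fin 2) = 1 from rfl, polyHom_X_one, polyHom_X_one]
      exact (h.sub h.adjoint).smul _

end Lifts

/-- Cauchy–Schwarz gives `‖C x‖_P² ≤ ‖x‖_P ‖C⁺ C x‖_P`. The operator `C⁺ C` is symmetric for `[P ·,
·]`, so Lax's inequality bounds this by `‖C⁺ C‖ ‖x‖_P²`, and `C` descends to the completion. -/
theorem exists_lifts {C : K →L[ℂ] K} (hC : Commute C P) :
    ∃ D, Lifts (factorMap P hP) C D := by
  have hC' : Commute (kreinAdjoint C) P := by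
    have := commute_kreinAdjoint hC
    rwa [hP.kreinAdjoint_eq] at this
  have hbound : ∀ x, ‖(factorQuot P hP ∘L C) x‖ ≤
      Real.sqrt ‖kreinAdjoint C * C‖ * ‖factorQuot P hP x‖ := by
    intro x
    refine le_of_sq_le_sq ?_ (by positivity)
    refine (norm_factorQuot_apply_sq_le hP hC' x).trans ?_
    have := norm_factorQuot_apply_le_of_symm hP (hC'.mul_left hC)
      (by rw [kreinAdjoint_mul, kreinAdjoint_kreinAdjoint]) x
    rw [mul_pow, Real.sq_sqrt (norm_nonneg _)]
    nlinarith [norm_nonneg (factorQuot P hP x)]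
  obtain ⟨D, hD, -⟩ := exists_clm_comp_factorQuot hP _ _ hbound
  refine ⟨D, ?_, by rwa [adjointFrom_factorMap]⟩
  -- On the dense range of `T⁺` the relation `T D = C T` becomes `P C = C P`.
  refine clm_ext_factorQuot hP ?_
  have hTT := factorMap_comp_adjointFrom P hP
  rw [adjointFrom_factorMap] at hTT
  rw [ContinuousLinearMap.comp_assoc, hD, ← ContinuousLinearMap.comp_assoc, hTT,
    ContinuousLinearMap.comp_assoc, hTT]
  exact hC.eq.symm

/-- `Theta` is chosen through the relation with `T` alone. Injectivity of `T` identifies it with the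
lift constructed above, which also respects `T⁺`. -/
theorem lifts_theta {C : K →L[ℂ] K} (hC : Commute C P) :
    Lifts (factorMap P hP) C (Theta (factorMap P hP) C) := by
  obtain ⟨D, hD⟩ := exists_lifts hP hC
  have hex : ∃ D : FactorSpace P hP →L[ℂ] FactorSpace P hP,
      factorMap P hP ∘L D = C ∘L factorMap P hP := ⟨D, hD.left⟩
  have h1 : factorMap P hP ∘L Theta (factorMap P hP) C = C ∘L factorMap P hP := by
    rw [Theta, dif_pos hex]
    exact hex.choose_spec
  have h2 : Theta (factorMap P hP) C = D := by
    ext x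
    apply factorMap_injective P hP
    have := congrArg (fun L : FactorSpace P hP →L[ℂ] K => L x) (h1.trans hD.left.symm)
    simpa using this
  rwa [h2]

theorem lifts_self : Lifts (factorMap P hP) P (factorQuot P hP ∘L factorMap P hP) := by
  have hTT := factorMap_comp_adjointFrom P hP
  rw [adjointFrom_factorMap] at hTT
  constructor
  · rw [← ContinuousLinearMap.comp_assoc, hTT]
  · rw [adjointFrom_factorMap, ContinuousLinearMap.comp_assoc, hTT]

/-- `M* M` and `M M*` lift `N⁺ N` and `N N⁺`, which are equal, and lifts along an injective `T` are
unique. -/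
theorem isStarNormal_of_lifts {N : K →L[ℂ] K} (hN : IsKreinNormal N)
    {M : FactorSpace P hP →L[ℂ] FactorSpace P hP} (h : Lifts (factorMap P hP) N M) :
    IsStarNormal M := by
  refine ⟨Lifts.unique (factorMap_injective P hP) (h.adjoint.mul h) ?_⟩
  have := h.mul h.adjoint
  rwa [hN] at this

/-! ### Comparison of two nonnegative operators -/

section Compare

variable {Q : K →L[ℂ] K} (hQ : FormNonneg Q)

/-- If `[Q x, x] ≤ [P x, x]`, the factor mapping of `Q` factors through that of `P`. -/
theorem exists_contraction (hle : ∀ x, (form x (Q x)).re ≤ (form x (P x)).re) :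
    ∃ W : FactorSpace P hP →L[ℂ] FactorSpace Q hQ, W ∘L factorQuot P hP = factorQuot Q hQ ∧
      ∀ x, ‖W x‖ ≤ ‖x‖ := by
  obtain ⟨W, hW, hn⟩ := exists_clm_comp_factorQuot hP (factorQuot Q hQ) 1 (by
    intro x
    rw [one_mul]
    refine le_of_sq_le_sq ?_ (norm_nonneg _)
    rw [norm_factorQuot_sq, norm_factorQuot_sq]
    exact hle x)
  exact ⟨W, hW, fun x => by simpa using hn x⟩

variable {hP hQ} {W : FactorSpace P hP →L[ℂ] FactorSpace Q hQ}

theorem factorMap_eq_comp_adjoint (hW : W ∘L factorQuot P hP = factorQuot Q hQ) :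
    factorMap Q hQ = factorMap P hP ∘L W.adjoint := by
  rw [factorMap, factorMap, ← hW, ContinuousLinearMap.adjoint_comp, ContinuousLinearMap.comp_assoc]

theorem comp_eq_comp_of_lifts (hW : W ∘L factorQuot P hP = factorQuot Q hQ) {C : K →L[ℂ] K}
    {D : FactorSpace P hP →L[ℂ] FactorSpace P hP} {D' : FactorSpace Q hQ →L[ℂ] FactorSpace Q hQ}
    (h : Lifts (factorMap P hP) C D) (h' : Lifts (factorMap Q hQ) C D') :
    W ∘L D = D' ∘L W := by
  have h1 := h.right
  have h2 := h'.right
  rw [adjointFrom_factorMap] at h1 h2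
  refine clm_ext_factorQuot hP ?_
  rw [ContinuousLinearMap.comp_assoc, h1, ← ContinuousLinearMap.comp_assoc, hW, ← h2, ← hW,
    ContinuousLinearMap.comp_assoc]

/-- With `T` the factor map of `P`, one has `T W* W T⁺ = Q`. Composing with `T` on the right gives
`T (W* W T⁺ T) = Q T = T D`, and `T` cancels. -/
theorem adjoint_mul_self_mul_eq_of_lifts (hW : W ∘L factorQuot P hP = factorQuot Q hQ)
    {D : FactorSpace P hP →L[ℂ] FactorSpace P hP} (h : Lifts (factorMap P hP) Q D) :
    (W.adjoint ∘L W) * (factorQuot P hP ∘L factorMap P hP) = D := by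
  have hQ' := factorMap_comp_adjointFrom Q hQ
  rw [adjointFrom_factorMap] at hQ'
  have key : factorMap P hP ∘L W.adjoint ∘L W ∘L factorQuot P hP = Q := by
    rw [hW, ← ContinuousLinearMap.comp_assoc, ← factorMap_eq_comp_adjoint hW, hQ']
  ext x
  apply factorMap_injective P hP
  have h1 := congrArg (fun L : K →L[ℂ] K => L (factorMap P hP x)) key
  have h2 := congrArg (fun L : FactorSpace P hP →L[ℂ] K => L x) h.left
  exact h1.trans h2.symm

end Compare

end Krein

end KreinNormal

namespace KreinNormal

open Filter MeasureTheory

section Main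

variable {K : Type*} [NormedAddCommGroup K] [InnerProductSpace ℂ K] [CompleteSpace K]
  [KreinSpace K] {N : K →L[ℂ] K} {m : ℕ} {p : Fin m → Poly}

theorem polyAt_sum (hN : IsKreinNormal N) (p : Fin m → Poly) :
    polyAt N (∑ k, p k) = ∑ k, polyAt N (p k) := by
  simp only [← polyHom_eq_polyAt hN, map_sum]

theorem commute_self_polyAt (hN : IsKreinNormal N) (q : Poly) : Commute N (polyAt N q) :=
  commute_polyAt hN (Commute.refl N) hN q

section Theta

variable {q : Poly} (hq : FormNonneg (polyAt N q))

theorem lifts_theta_polyAt (hN : IsKreinNormal N) :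
    Lifts (factorMap (polyAt N q) hq) N (Theta (factorMap (polyAt N q) hq) N) :=
  lifts_theta hq (commute_self_polyAt hN q)

theorem isStarNormal_theta (hN : IsKreinNormal N) :
    IsStarNormal (Theta (factorMap (polyAt N q) hq) N) :=
  isStarNormal_of_lifts hq hN (lifts_theta_polyAt hq hN)

theorem spectralMeasure_theta (hN : IsKreinNormal N) :
    (spectralMeasure (Theta (factorMap (polyAt N q) hq) N)).IsSpectralMeasureOf
      (Theta (factorMap (polyAt N q) hq) N) :=
  spectralMeasure_spec _ (isStarNormal_theta hq hN)

end Theta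

/-! ### Comparison of the spectral integrals on the spaces `ℋ_k` and `ℋ` -/

variable (hp : ∀ k, FormNonneg (polyAt N (p k)))

/-- The operator `T : ℋ → 𝒦` with `T T⁺ = ∑ p_k(A, B)`. -/
abbrev totalMap (hp : ∀ k, FormNonneg (polyAt N (p k))) :
    FactorSpace (∑ k, polyAt N (p k)) (FormNonneg.sum hp) →L[ℂ] K :=
  factorMap (∑ k, polyAt N (p k)) (FormNonneg.sum hp)

/-- The operator `Θ(N)` on `ℋ`. -/
abbrev totalTheta (hp : ∀ k, FormNonneg (polyAt N (p k))) :=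
  Theta (totalMap hp) N

/-- The integral with respect to the spectral measure of `Θ(N)`. -/
abbrev totalIntegral (hp : ∀ k, FormNonneg (polyAt N (p k))) (g : ℂ → ℂ) :=
  (spectralMeasure (totalTheta hp)).integral g

theorem lifts_totalTheta (hN : IsKreinNormal N) : Lifts (totalMap hp) N (totalTheta hp) :=
  lifts_theta (FormNonneg.sum hp) (by
    rw [← polyAt_sum hN]; exact commute_self_polyAt hN _)

theorem isStarNormal_totalTheta (hN : IsKreinNormal N) : IsStarNormal (totalTheta hp) :=
  isStarNormal_of_lifts _ hN (lifts_totalTheta hp hN)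

theorem spectralMeasure_totalTheta (hN : IsKreinNormal N) :
    (spectralMeasure (totalTheta hp)).IsSpectralMeasureOf (totalTheta hp) :=
  spectralMeasure_spec _ (isStarNormal_totalTheta hp hN)

theorem isCompact_hilbertSpectrum : IsCompact (hilbertSpectrum N p hp) := spectrum.isCompact _

theorem measurableSet_hilbertSpectrum : MeasurableSet (hilbertSpectrum N p hp) :=
  (isCompact_hilbertSpectrum hp).measurableSet

theorem bddBorel_indicator_evalC (q : Poly) :
    BddBorel ((hilbertSpectrum N p hp).indicator (evalC q)) :=
  BddBorel.indicator_of_isCompact (continuous_evalC q) (isCompact_hilbertSpectrum hp)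

theorem lifts_totalIntegral_evalC (hN : IsKreinNormal N) (q : Poly) :
    Lifts (totalMap hp) (polyAt N q)
      (totalIntegral hp ((hilbertSpectrum N p hp).indicator (evalC q))) := by
  have h := (lifts_totalTheta hp hN).polyHom hN (isStarNormal_totalTheta hp hN) q
  rwa [← (spectralMeasure_totalTheta hp hN).integral_evalC (isStarNormal_totalTheta hp hN)] at h

/-- `T⁺ T = ∫ ∑ p_k dE`. -/
theorem factorQuot_comp_totalMap (hN : IsKreinNormal N) :
    factorQuot _ (FormNonneg.sum hp) ∘L totalMap hp =
      totalIntegral hp ((hilbertSpectrum N p hp).indicator (evalC (∑ k, p k))) := by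
  have h := lifts_totalIntegral_evalC hp hN (∑ k, p k)
  rw [polyAt_sum hN] at h
  exact (lifts_self (FormNonneg.sum hp)).unique (factorMap_injective _ _) h

theorem exists_contraction_totalMap (k : Fin m) :
    ∃ W : FactorSpace (∑ k, polyAt N (p k)) (FormNonneg.sum hp) →L[ℂ]
        FactorSpace (polyAt N (p k)) (hp k),
      W ∘L factorQuot _ (FormNonneg.sum hp) = factorQuot _ (hp k) ∧ ∀ x, ‖W x‖ ≤ ‖x‖ := by
  refine exists_contraction (FormNonneg.sum hp) (hp k) fun x => ?_
  have h1 : form x ((∑ k, polyAt N (p k)) x) = ∑ k, form x (polyAt N (p k) x) := by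
    simp [form, map_sum, sum_apply]
  rw [h1, Complex.re_sum]
  exact Finset.single_le_sum (f := fun k => (form x (polyAt N (p k) x)).re)
    (fun j _ => (Complex.nonneg_iff.1 (hp j x)).1) (Finset.mem_univ k)

theorem adjoint_mul_self_mul_totalIntegral (hN : IsKreinNormal N) {k : Fin m}
    {W : FactorSpace (∑ k, polyAt N (p k)) (FormNonneg.sum hp) →L[ℂ]
        FactorSpace (polyAt N (p k)) (hp k)}
    (hW : W ∘L factorQuot _ (FormNonneg.sum hp) = factorQuot _ (hp k)) :
    (W.adjoint ∘L W) * totalIntegral hp ((hilbertSpectrum N p hp).indicator (evalC (∑ k, p k))) =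
      totalIntegral hp ((hilbertSpectrum N p hp).indicator (evalC (p k))) := by
  rw [← factorQuot_comp_totalMap hp hN]
  exact adjoint_mul_self_mul_eq_of_lifts hW (lifts_totalIntegral_evalC hp hN (p k))

/-- For `X = p_k(Θ(N))` and `Y = (∑ p_j)(Θ(N))` one has `X = W* W Y` with `W` a contraction. Hence
`X* X ≤ Y* Y`, and the continuous functional calculus turns this into a pointwise inequality on the
spectrum. -/
theorem norm_evalC_le_norm_evalC_sum (hN : IsKreinNormal N) (k : Fin m) {z : ℂ}
    (hz : z ∈ hilbertSpectrum N p hp) : ‖evalC (p k) z‖ ≤ ‖evalC (∑ k, p k) z‖ := by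
  obtain ⟨W, hW, hWn⟩ := exists_contraction_totalMap hp k
  have hM := isStarNormal_totalTheta hp hN
  have hE := spectralMeasure_totalTheta hp hN
  have h1 := adjoint_mul_self_mul_totalIntegral hp hN hW
  have hcfc : ∀ q : Poly, totalIntegral hp ((hilbertSpectrum N p hp).indicator (evalC q)) =
      cfc (evalC q) (totalTheta hp) := fun q => by
    rw [← polyHom_eq_cfc hM, ← hE.integral_evalC hM]
    rfl
  rw [hcfc, hcfc] at h1
  set X := cfc (evalC (p k)) (totalTheta hp)
  set Y := cfc (evalC (∑ k, p k)) (totalTheta hp)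
  have hnorm : ∀ v, ‖X v‖ ≤ ‖Y v‖ := by
    intro v
    have hWle : ‖W.adjoint‖ ≤ 1 := by
      rw [LinearIsometryEquiv.norm_map]
      exact W.opNorm_le_bound zero_le_one fun x => by simpa using hWn x
    rw [← h1, mul_apply_eq_comp, ContinuousLinearMap.comp_apply]
    refine (W.adjoint.le_of_opNorm_le hWle _).trans ?_
    rw [one_mul]
    exact hWn _
  have hpos : 0 ≤ star Y * Y - star X * X := by
    rw [ContinuousLinearMap.nonneg_iff_isPositive, ContinuousLinearMap.isPositive_iff_complex]
    intro v
    have h2 : ⟪(star Y * Y - star X * X) v, v⟫_ℂ = ((‖Y v‖ ^ 2 - ‖X v‖ ^ 2 : ℝ) : ℂ) := by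
      rw [sub_apply, inner_sub_left, mul_apply_eq_comp, mul_apply_eq_comp,
        ContinuousLinearMap.star_eq_adjoint, ContinuousLinearMap.star_eq_adjoint,
        ContinuousLinearMap.adjoint_inner_left, ContinuousLinearMap.adjoint_inner_left,
        inner_self_eq_norm_sq_to_K, inner_self_eq_norm_sq_to_K]
      push_cast
      rfl
    rw [h2]
    refine ⟨rfl, ?_⟩
    change 0 ≤ ‖Y v‖ ^ 2 - ‖X v‖ ^ 2
    have := pow_le_pow_left₀ (norm_nonneg _) (hnorm v) 2
    linarith
  have hc := fun q : Poly => (continuous_evalC q).continuousOn (s := spectrum ℂ (totalTheta hp))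
  have hc' : ∀ q : Poly, ContinuousOn (fun z => conj (evalC q z)) (spectrum ℂ (totalTheta hp)) :=
    fun q => (Complex.continuous_conj.comp (continuous_evalC q)).continuousOn
  have hsq : ∀ q : Poly, star (cfc (evalC q) (totalTheta hp)) * cfc (evalC q) (totalTheta hp) =
      cfc (fun z => conj (evalC q z) * evalC q z) (totalTheta hp) := by
    intro q
    rw [← cfc_star]
    exact (cfc_mul (fun z => conj (evalC q z)) (evalC q) _ (hc' q) (hc q)).symm
  rw [hsq, hsq, ← cfc_sub (fun z => conj (evalC (∑ k, p k) z) * evalC (∑ k, p k) z)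
      (fun z => conj (evalC (p k) z) * evalC (p k) z) _ ((hc' _).mul (hc _))
      ((hc' _).mul (hc _))] at hpos
  have h3 := (cfc_nonneg_iff (fun z => conj (evalC (∑ k, p k) z) * evalC (∑ k, p k) z -
    conj (evalC (p k) z) * evalC (p k) z) (totalTheta hp)
    (((hc' _).mul (hc _)).sub ((hc' _).mul (hc _)))).1 hpos z hz
  rw [Complex.conj_mul', Complex.conj_mul', ← Complex.ofReal_pow, ← Complex.ofReal_pow,
    ← Complex.ofReal_sub, Complex.zero_le_real, sub_nonneg] at h3
  exact le_of_sq_le_sq h3 (norm_nonneg _)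

/-- The function `f p_k / ∑ p_j` on `σ(Θ(N))`. -/
def ratio (hp : ∀ k, FormNonneg (polyAt N (p k))) (k : Fin m) (f : ℂ → ℂ) : ℂ → ℂ :=
  (hilbertSpectrum N p hp).indicator fun z => f z * (evalC (p k) z / evalC (∑ k, p k) z)

theorem norm_evalC_div_le (hN : IsKreinNormal N) (k : Fin m) {z : ℂ}
    (hz : z ∈ hilbertSpectrum N p hp) : ‖evalC (p k) z / evalC (∑ k, p k) z‖ ≤ 1 := by
  rw [norm_div]
  exact div_le_one_of_le₀ (norm_evalC_le_norm_evalC_sum hp hN k hz) (norm_nonneg _)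

theorem bddBorel_ratio (hN : IsKreinNormal N) (k : Fin m) {f : ℂ → ℂ} (hf : BddBorel f) :
    BddBorel (ratio hp k f) := by
  obtain ⟨c, hc⟩ := hf.bounded
  refine ⟨(hf.measurable.mul ((continuous_evalC _).measurable.div
    (continuous_evalC _).measurable)).indicator (measurableSet_hilbertSpectrum hp), c,
    fun z => ?_⟩
  have hc0 : 0 ≤ c := (norm_nonneg _).trans (hc z)
  by_cases hz : z ∈ hilbertSpectrum N p hp
  · rw [ratio, Set.indicator_of_mem hz, norm_mul]
    calc _ ≤ c * 1 := mul_le_mul (hc z) (norm_evalC_div_le hp hN k hz) (norm_nonneg _) hc0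
      _ = c := mul_one c
  · rw [ratio, Set.indicator_of_notMem hz, norm_zero]
    exact hc0

/-- Formally this is `W* W ∫ ∑ p_j dE = ∫ p_k dE` multiplied by `f / ∑ p_j`. That quotient may be
unbounded, so it is first cut off where `|∑ p_j|` is small; the bound `|p_k| ≤ |∑ p_j|` on `S` then
permits passage to the limit. -/
theorem adjoint_mul_self_mul_totalIntegral_of_vanish (hN : IsKreinNormal N) {k : Fin m}
    {W : FactorSpace (∑ k, polyAt N (p k)) (FormNonneg.sum hp) →L[ℂ]
        FactorSpace (polyAt N (p k)) (hp k)}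
    (hW : W ∘L factorQuot _ (FormNonneg.sum hp) = factorQuot _ (hp k)) {f : ℂ → ℂ}
    (hf : BddBorel f)
    (hf0 : ∀ z ∈ hilbertSpectrum N p hp, evalC (∑ k, p k) z = 0 → f z = 0) :
    (W.adjoint ∘L W) * totalIntegral hp f = totalIntegral hp (ratio hp k f) := by
  set S := hilbertSpectrum N p hp with hS
  set E := spectralMeasure (totalTheta hp) with hEdef
  have hE : E.IsSpectralMeasureOf (totalTheta hp) := spectralMeasure_totalTheta hp hN
  have hSm : MeasurableSet S := measurableSet_hilbertSpectrum hp
  obtain ⟨c, hc⟩ := hf.bounded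
  have hc0 : 0 ≤ c := (norm_nonneg _).trans (hc 0)
  let t : ℕ → Set ℂ := fun n => {z | 1 / ((n : ℝ) + 1) < ‖evalC (∑ k, p k) z‖}
  have ht : ∀ n, MeasurableSet (t n) := fun n =>
    (isOpen_lt continuous_const (continuous_evalC _).norm).measurableSet
  let u : ℕ → ℂ → ℂ := fun n => (t n).indicator fun z => f z / evalC (∑ k, p k) z
  have hu : ∀ n, BddBorel (u n) := by
    intro n
    refine ⟨(hf.measurable.div (continuous_evalC _).measurable).indicator (ht n),
      c * ((n : ℝ) + 1), fun z => ?_⟩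
    by_cases hz : z ∈ t n
    · simp only [u, Set.indicator_of_mem hz, div_eq_mul_inv, norm_mul, norm_inv]
      refine mul_le_mul (hc z) ?_ (by positivity) hc0
      have : 1 / ((n : ℝ) + 1) < ‖evalC (∑ k, p k) z‖ := hz
      rw [inv_le_comm₀ (lt_trans (by positivity) this) (by positivity)]
      rw [one_div] at this
      exact this.le
    · simp only [u, Set.indicator_of_notMem hz, norm_zero]
      positivity
  have hP := bddBorel_indicator_evalC hp (∑ k, p k)
  have hPk := bddBorel_indicator_evalC hp (p k)
  have hstep : ∀ n, (W.adjoint ∘L W) * E.integral (S.indicator (evalC (∑ k, p k)) * u n) =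
      E.integral (S.indicator (evalC (p k)) * u n) := by
    intro n
    rw [E.integral_mul hP (hu n), E.integral_mul hPk (hu n), ← mul_assoc]
    congr 1
    exact adjoint_mul_self_mul_totalIntegral hp hN hW
  have hlimt : ∀ z, evalC (∑ k, p k) z ≠ 0 → ∀ᶠ n in atTop, z ∈ t n := by
    intro z hz
    exact (tendsto_one_div_add_atTop_nhds_zero_nat (𝕜 := ℝ)).eventually_lt_const (norm_pos_iff.2 hz)
  have hlim1 : ∀ z, Tendsto (fun n => (S.indicator (evalC (∑ k, p k)) * u n) z) atTop
      (𝓝 (S.indicator f z)) := by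
    intro z
    by_cases hz : z ∈ S
    -- Here `hf0` is indispensable: at a zero of `∑ p_j` every cut-off product is `0`, so the limit
    -- `f z` has to be `0`.
    · by_cases h0 : evalC (∑ k, p k) z = 0
      · simp only [Pi.mul_apply, Set.indicator_of_mem hz, h0, zero_mul, hf0 z hz h0]
        exact tendsto_const_nhds
      · refine tendsto_const_nhds.congr' ?_
        filter_upwards [hlimt z h0] with n hn
        simp only [Pi.mul_apply, Set.indicator_of_mem hz, u, Set.indicator_of_mem hn]
        field_simp
    · simp only [Pi.mul_apply, Set.indicator_of_notMem hz, zero_mul]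
      exact tendsto_const_nhds
  have hlim2 : ∀ z, Tendsto (fun n => (S.indicator (evalC (p k)) * u n) z) atTop
      (𝓝 (ratio hp k f z)) := by
    intro z
    by_cases hz : z ∈ S
    -- At these zeros `ratio` is `0` by the convention `x / 0 = 0`.
    · by_cases h0 : evalC (∑ k, p k) z = 0
      · simp only [Pi.mul_apply, ratio, ← hS, Set.indicator_of_mem hz, u, Set.indicator_apply, h0,
          div_zero, ite_self, mul_zero]
        exact tendsto_const_nhds
      · refine tendsto_const_nhds.congr' ?_
        filter_upwards [hlimt z h0] with n hn
        simp only [Pi.mul_apply, ratio, ← hS, Set.indicator_of_mem hz, u, Set.indicator_of_mem hn]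
        ring
    · simp only [Pi.mul_apply, ratio, ← hS, Set.indicator_of_notMem hz, zero_mul]
      exact tendsto_const_nhds
  have hu_le : ∀ n z, ‖u n z‖ ≤ ‖f z‖ / ‖evalC (∑ k, p k) z‖ := fun n z => by
    rw [← norm_div]
    exact norm_indicator_le_norm_self (fun z => f z / evalC (∑ k, p k) z) z
  have hb : ∀ q : Poly, (∀ z ∈ S, ‖evalC q z‖ ≤ ‖evalC (∑ k, p k) z‖) → ∀ n z,
      ‖(S.indicator (evalC q) * u n) z‖ ≤ c := by
    intro q hq n z
    by_cases hz : z ∈ S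
    · rw [Pi.mul_apply, Set.indicator_of_mem hz, norm_mul]
      calc _ ≤ ‖evalC (∑ k, p k) z‖ * (‖f z‖ / ‖evalC (∑ k, p k) z‖) :=
            mul_le_mul (hq z hz) (hu_le n z) (norm_nonneg _) (norm_nonneg _)
        _ = ‖f z‖ * (‖evalC (∑ k, p k) z‖ / ‖evalC (∑ k, p k) z‖) := by ring
        _ ≤ ‖f z‖ * 1 := by gcongr; exact div_self_le_one _
        _ ≤ c := by rw [mul_one]; exact hc z
    · rw [Pi.mul_apply, Set.indicator_of_notMem hz, zero_mul, norm_zero]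
      exact hc0
  have hfS : E.integral f = E.integral (S.indicator f) :=
    hE.integral_congr hf (hf.indicator hSm) fun z hz => (Set.indicator_of_mem hz f).symm
  change (W.adjoint ∘L W) * E.integral f = E.integral (ratio hp k f)
  rw [hfS]
  ext y
  refine ext_inner_left ℂ fun x => ?_
  have h1 := E.isBorelCalculus.tendsto (fun n => (hP.mul (hu n)).measurable)
    (hb _ fun z _ => le_rfl) (hf.indicator hSm) hlim1 ((W.adjoint ∘L W).adjoint x) y
  have h2 := E.isBorelCalculus.tendsto (fun n => (hPk.mul (hu n)).measurable)
    (hb _ fun z hz => norm_evalC_le_norm_evalC_sum hp hN k hz) (bddBorel_ratio hp hN k hf) hlim2 x y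
  simp only [ContinuousLinearMap.adjoint_inner_left] at h1
  rw [mul_apply_eq_comp]
  refine tendsto_nhds_unique h1 (h2.congr fun n => ?_)
  rw [← hstep n, mul_apply_eq_comp]

/-- `T_k (∫ f dE_k) T_k⁺ = T (∫ f p_k / (∑ p_j) dE) T⁺` for `f` vanishing at the zeros of
`∑ p_j` in `σ(Θ(N))`. -/
theorem factorMap_comp_integral (hN : IsKreinNormal N) (k : Fin m) {f : ℂ → ℂ} (hf : BddBorel f)
    (hf0 : ∀ z ∈ hilbertSpectrum N p hp, evalC (∑ k, p k) z = 0 → f z = 0) :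
    factorMap (polyAt N (p k)) (hp k) ∘L
      (spectralMeasure (Theta (factorMap (polyAt N (p k)) (hp k)) N)).integral f ∘L
        adjointFrom (factorMap (polyAt N (p k)) (hp k)) =
      totalMap hp ∘L totalIntegral hp (ratio hp k f) ∘L adjointFrom (totalMap hp) := by
  obtain ⟨W, hW, -⟩ := exists_contraction_totalMap hp k
  have hl := lifts_totalTheta hp hN
  have hlk := lifts_theta_polyAt (hp k) hN
  -- Since `W` intertwines `Θ(N)` and `Θ_k(N)` together with their adjoints, `T_k (∫ f dE_k) T_k⁺ =
  -- T W* (∫ f dE_k) W T⁺ = T W* W (∫ f dE) T⁺`.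
  have hint := (spectralMeasure_totalTheta hp hN).intertwine (spectralMeasure_theta (hp k) hN)
    (isStarNormal_totalTheta hp hN) (isStarNormal_theta (hp k) hN)
    (comp_eq_comp_of_lifts hW hl hlk) (comp_eq_comp_of_lifts hW hl.adjoint hlk.adjoint) hf
  rw [← adjoint_mul_self_mul_totalIntegral_of_vanish hp hN hW hf hf0, adjointFrom_factorMap,
    adjointFrom_factorMap]
  ext x
  have h1 := DFunLike.congr_fun hW x
  have h2 := DFunLike.congr_fun hint (factorQuot _ (FormNonneg.sum hp) x)
  have h3 := DFunLike.congr_fun (factorMap_eq_comp_adjoint hW)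
  simp only [ContinuousLinearMap.comp_apply, mul_apply_eq_comp] at h1 h2 h3 ⊢
  rw [h3, ← h1, ← h2]

/-- The operator `r(A, B) + T (∫ g dE) T⁺`. -/
def totalPsi (hp : ∀ k, FormNonneg (polyAt N (p k))) (r : Poly) (g : ℂ → ℂ) : K →L[ℂ] K :=
  polyAt N r + totalMap hp ∘L totalIntegral hp g ∘L adjointFrom (totalMap hp)

theorem Psi_eq_totalPsi (hN : IsKreinNormal N) (r : Poly) {f : Fin m → ℂ → ℂ}
    (hf : ∀ k, BddBorel (f k))
    (hf0 : ∀ k, ∀ z ∈ hilbertSpectrum N p hp, evalC (∑ k, p k) z = 0 → f k z = 0) :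
    Psi N p hp r f = totalPsi hp r (∑ k, ratio hp k (f k)) := by
  rw [Psi, totalPsi, totalIntegral, ProjMeasure.isBorelCalculus _ |>.sum _
    fun k _ => bddBorel_ratio hp hN k (hf k)]
  congr 1
  ext x
  simp only [sum_apply, ContinuousLinearMap.comp_apply, map_sum]
  refine Finset.sum_congr rfl fun k _ => ?_
  exact congrArg (fun L : K →L[ℂ] K => L x) (factorMap_comp_integral hp hN k (hf k) (hf0 k))

/-- Polynomials in the ideal generated by the `p_j`, with coefficients vanishing at the zeros of
`∑ p_j` in `σ(Θ(N))`, act through spectral integrals. -/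
theorem polyAt_eq_totalIntegral (hN : IsKreinNormal N) {r : Poly} {s : Fin m → Poly}
    (hr : r = ∑ j, s j * p j)
    (hs0 : ∀ j, ∀ z ∈ hilbertSpectrum N p hp, evalC (∑ k, p k) z = 0 → evalC (s j) z = 0) :
    BddBorel ((hilbertSpectrum N p hp).indicator fun z => evalC r z / evalC (∑ k, p k) z) ∧
    polyAt N r = totalMap hp ∘L totalIntegral hp
      ((hilbertSpectrum N p hp).indicator fun z => evalC r z / evalC (∑ k, p k) z) ∘L
        adjointFrom (totalMap hp) := by
  -- The cut-off of `s j` must agree with `s j` on `σ(Θ(N))` and on `σ(Θ_j(N))`, and be bounded on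
  -- all of `ℂ`.
  let C : Fin m → Set ℂ := fun j =>
    hilbertSpectrum N p hp ∪ spectrum ℂ (Theta (factorMap (polyAt N (p j)) (hp j)) N)
  have hC : ∀ j, IsCompact (C j) := fun j =>
    (isCompact_hilbertSpectrum hp).union (spectrum.isCompact _)
  let f : Fin m → ℂ → ℂ := fun j => (C j).indicator (evalC (s j))
  have hf : ∀ j, BddBorel (f j) := fun j =>
    BddBorel.indicator_of_isCompact (continuous_evalC _) (hC j)
  have hf0 : ∀ j, ∀ z ∈ hilbertSpectrum N p hp, evalC (∑ k, p k) z = 0 → f j z = 0 := by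
    intro j z hz h0
    simp only [f, C, Set.indicator_of_mem (Set.mem_union_left _ hz), hs0 j z hz h0]
  have hsum : (hilbertSpectrum N p hp).indicator (fun z => evalC r z / evalC (∑ k, p k) z) =
      ∑ k, ratio hp k (f k) := by
    ext z
    rw [Finset.sum_apply]
    by_cases hz : z ∈ hilbertSpectrum N p hp
    · simp only [ratio, f, C, Set.indicator_of_mem hz,
        Set.indicator_of_mem (Set.mem_union_left _ hz)]
      rw [hr, evalC_sum (p := fun j => s j * p j), Finset.sum_div]
      exact Finset.sum_congr rfl fun j _ => by rw [evalC_mul, mul_div_assoc]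
    · simp [ratio, hz]
  have hP : polyAt N r = ∑ j, polyAt N (s j) * polyAt N (p j) := by
    simp only [hr, ← polyHom_eq_polyAt hN, map_sum, map_mul]
  -- With `r = 0` only the integral terms remain, and `T_j (∫ s_j dE_j) T_j⁺ = s_j(A, B) T_j T_j⁺ =
  -- s_j(A, B) p_j(A, B)`.
  have h := Psi_eq_totalPsi hp hN 0 hf hf0
  have h0 : polyAt N 0 = 0 := by rw [← polyHom_eq_polyAt hN, map_zero]
  rw [Psi, totalPsi, h0, zero_add, zero_add] at h
  rw [hsum]
  refine ⟨BddBorel.sum _ fun k _ => bddBorel_ratio hp hN k (hf k), ?_⟩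
  rw [← h, hP]
  refine Finset.sum_congr rfl fun j _ => ?_
  have hM := isStarNormal_theta (hp j) hN
  have hE := spectralMeasure_theta (hp j) hN
  have hl := ((lifts_theta_polyAt (hp j) hN).polyHom hN hM (s j)).left
  rw [← hE.integral_evalC hM, ← hE.integral_congr (hf j) (ProjMeasure.bddBorel_evalC _ _)] at hl
  · rw [← ContinuousLinearMap.comp_assoc, hl, ContinuousLinearMap.comp_assoc,
      factorMap_comp_adjointFrom]
    rfl
  · intro z hz
    simp only [f, C, Set.indicator_of_mem hz, Set.indicator_of_mem (Set.mem_union_right _ hz)]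

/-! ### Algebraic properties of the operators `r(A, B) + T (∫ g dE) T⁺` -/

theorem totalPsi_add (hN : IsKreinNormal N) (r s : Poly) {g h : ℂ → ℂ} (hg : BddBorel g)
    (hh : BddBorel h) : totalPsi hp (r + s) (g + h) = totalPsi hp r g + totalPsi hp s h := by
  simp only [totalPsi, totalIntegral, ProjMeasure.isBorelCalculus _ |>.add hg hh,
    ← polyHom_eq_polyAt hN, map_add, ContinuousLinearMap.comp_add, ContinuousLinearMap.add_comp]
  abel

theorem totalPsi_zero_right (r : Poly) : totalPsi hp r 0 = polyAt N r := by
  simp [totalPsi, totalIntegral, (ProjMeasure.isBorelCalculus _).zero]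

/-- Lifting gives `r(A, B) T = T ∫ r dE` and `T⁺ s(A, B) = (∫ s dE) T⁺`. In the product of the two
integral terms, the inner `T⁺ T` is `∫ ∑ p_k dE`. -/
theorem totalPsi_mul (hN : IsKreinNormal N) (r s : Poly) {g h : ℂ → ℂ} (hg : BddBorel g)
    (hh : BddBorel h) :
    totalPsi hp r g * totalPsi hp s h = totalPsi hp (r * s)
      ((hilbertSpectrum N p hp).indicator (evalC r) * h +
        g * (hilbertSpectrum N p hp).indicator (evalC s) +
        g * (hilbertSpectrum N p hp).indicator (evalC (∑ k, p k)) * h) := by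
  set E := spectralMeasure (totalTheta hp) with hE
  have b := bddBorel_indicator_evalC hp
  have hr := (lifts_totalIntegral_evalC hp hN r).left
  have hs := (lifts_totalIntegral_evalC hp hN s).right
  have hP := factorQuot_comp_totalMap hp hN
  rw [← adjointFrom_factorMap] at hP
  simp only [totalPsi, totalIntegral] at hr hs hP ⊢
  rw [← hE] at hr hs hP ⊢
  rw [E.isBorelCalculus.add (((b r).mul hh).add (hg.mul (b s))) ((hg.mul (b _)).mul hh),
    E.isBorelCalculus.add ((b r).mul hh) (hg.mul (b s)), E.integral_mul (hg.mul (b _)) hh,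
    E.integral_mul hg (b (∑ k, p k)), E.integral_mul (b r) hh, E.integral_mul hg (b s), ← hP]
  have hrs : polyAt N (r * s) = polyAt N r * polyAt N s := by
    simp only [← polyHom_eq_polyAt hN, map_mul]
  rw [hrs]
  ext x
  have hr' := fun v => congrArg (fun L : _ →L[ℂ] K => L v) hr
  have hs' := fun v => congrArg (fun L : K →L[ℂ] _ => L v) hs
  simp only [ContinuousLinearMap.comp_apply] at hr' hs'
  simp only [mul_apply_eq_comp, add_apply, ContinuousLinearMap.comp_apply, map_add, hr', hs']
  abel

theorem kreinAdjoint_totalPsi (hN : IsKreinNormal N) (r : Poly) {g : ℂ → ℂ} (hg : BddBorel g) :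
    kreinAdjoint (totalPsi hp r g) = totalPsi hp (sharpHom r) fun z => conj (g z) := by
  rw [totalPsi, kreinAdjoint_add, kreinAdjoint_polyAt hN, kreinAdjoint_comp_adjointFrom, totalPsi,
    totalIntegral, totalIntegral, (ProjMeasure.isBorelCalculus _).star hg]

/-- An operator commuting with `N` and `N⁺` lifts to one commuting with `Θ(N)` and its adjoint,
hence with all spectral integrals. -/
theorem totalPsi_mem_bicommutant (hN : IsKreinNormal N) (r : Poly) {g : ℂ → ℂ} (hg : BddBorel g) :
    totalPsi hp r g ∈ bicommutant N := by
  intro C hC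
  have h1 : Commute C N := (hC N (by simp)).symm
  have h2 : Commute C (kreinAdjoint N) := (hC (kreinAdjoint N) (by simp)).symm
  have hlC : Lifts (totalMap hp) C (Theta (totalMap hp) C) :=
    lifts_theta (FormNonneg.sum hp) (by
      rw [← polyAt_sum hN]; exact commute_polyAt hN h1 h2 _)
  have hl := lifts_totalTheta hp hN
  have hinj := factorMap_injective (∑ k, polyAt N (p k)) (FormNonneg.sum hp)
  have hc1 : Theta (totalMap hp) C * totalTheta hp = totalTheta hp * Theta (totalMap hp) C := by
    refine (hlC.mul hl).unique hinj ?_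
    rw [h1.eq]
    exact hl.mul hlC
  have hc2 : Theta (totalMap hp) C * (totalTheta hp).adjoint =
      (totalTheta hp).adjoint * Theta (totalMap hp) C := by
    refine (hlC.mul hl.adjoint).unique hinj ?_
    rw [h2.eq]
    exact hl.adjoint.mul hlC
  have hE := spectralMeasure_totalTheta hp hN
  have hM := isStarNormal_totalTheta hp hN
  have hint : Theta (totalMap hp) C ∘L totalIntegral hp g =
      totalIntegral hp g ∘L Theta (totalMap hp) C := hE.intertwine hE hM hM hc1 hc2 hg
  have hpoly : C * polyAt N r = polyAt N r * C := commute_polyAt hN h1 h2 r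
  rw [totalPsi, mul_add, add_mul, hpoly]
  congr 1
  rw [ContinuousLinearMap.mul_def, ContinuousLinearMap.mul_def, ← ContinuousLinearMap.comp_assoc,
    ← hlC.left, ContinuousLinearMap.comp_assoc, ← ContinuousLinearMap.comp_assoc (Theta _ C),
    hint]
  simp only [ContinuousLinearMap.comp_assoc]
  rw [hlC.right]

end Main

end KreinNormal

namespace KreinNormal

open Filter MeasureTheory

/-! ### The function class `ℱ_N` -/

section ClassF

variable {I : Ideal Poly} {S : Set ℂ}

theorem mem_realVariety_iff {z : ℂ} : z ∈ realVariety I ↔ ∀ f ∈ I, evalC f z = 0 := mem_variety_iff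

/-- The decomposition `φ = r_N + g q_N` with a bounded Borel function `g` vanishing on `V_ℝ(I)`, where
`q ∈ I`. -/
structure IsReduced (q : Poly) (φ : FunM I S) (r : Poly) (g : ℂ → ℂ) : Prop where
  bddBorel : BddBorel g
  vanish : ∀ z ∈ realVariety I, g z = 0
  on_spectrum : ∀ z, φ.1 z = evalC r z + g z * evalC q z
  on_real : ∀ z, φ.2.1 z = Ideal.Quotient.mk _ r
  on_nonreal : ∀ a, φ.2.2 a = Ideal.Quotient.mk _ r

namespace IsReduced

variable {q : Poly} {φ ψ : FunM I S} {r s : Poly} {g h : ℂ → ℂ}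

theorem add (hφ : IsReduced q φ r g) (hψ : IsReduced q ψ s h) :
    IsReduced q (φ + ψ) (r + s) (g + h) where
  bddBorel := hφ.bddBorel.add hψ.bddBorel
  vanish z hz := by simp [hφ.vanish z hz, hψ.vanish z hz]
  on_spectrum z := by
    simp only [Prod.fst_add, Pi.add_apply, hφ.on_spectrum, hψ.on_spectrum, evalC_add]
    ring
  on_real z := by
    simp only [Prod.fst_add, Prod.snd_add, Pi.add_apply, hφ.on_real, hψ.on_real, map_add]
  on_nonreal a := by
    simp only [Prod.snd_add, Pi.add_apply, hφ.on_nonreal, hψ.on_nonreal, map_add]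

/-- `(r + g q)(s + h q) = r s + (r h + g s + g q h) q`. The indicators only keep the coefficient
bounded, and for `q = ∑ p_k` it is the function appearing in `totalPsi_mul`. -/
theorem mul (hS : IsCompact S) (hφ : IsReduced q φ r g) (hψ : IsReduced q ψ s h) :
    IsReduced q (φ * ψ) (r * s)
      (S.indicator (evalC r) * h + g * S.indicator (evalC s) + g * S.indicator (evalC q) * h) where
  bddBorel := by
    have b := fun q : Poly => BddBorel.indicator_of_isCompact (continuous_evalC q) hS
    exact (((b r).mul hψ.bddBorel).add (hφ.bddBorel.mul (b s))).add
      ((hφ.bddBorel.mul (b q)).mul hψ.bddBorel)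
  vanish z hz := by simp [hφ.vanish z hz, hψ.vanish z hz]
  on_spectrum z := by
    simp only [Prod.fst_mul, Pi.mul_apply, Pi.add_apply, hφ.on_spectrum, hψ.on_spectrum, evalC_mul,
      Set.indicator_of_mem z.2.1]
    ring
  on_real z := by
    simp only [Prod.fst_mul, Prod.snd_mul, Pi.mul_apply, hφ.on_real, hψ.on_real, map_mul]
  on_nonreal a := by
    simp only [Prod.snd_mul, Pi.mul_apply, hφ.on_nonreal, hψ.on_nonreal, map_mul]

theorem polyN (q r : Poly) : IsReduced q (polyN I S r) r 0 where
  bddBorel := BddBorel.zero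
  vanish _ _ := rfl
  on_spectrum z := by simp [KreinNormal.polyN]
  on_real _ := rfl
  on_nonreal _ := rfl

theorem algebraMap (q : Poly) (c : ℂ) :
    IsReduced q (algebraMap ℂ (FunM I S) c) (algebraMap ℂ Poly c) 0 where
  bddBorel := BddBorel.zero
  vanish _ _ := rfl
  on_spectrum z := by
    rw [MvPolynomial.algebraMap_eq, evalC_C]
    simp
  on_real _ := rfl
  on_nonreal _ := rfl

theorem sharp (hI : I ≤ I.comap sharpHom) (hq : sharpHom q = q) (hφ : IsReduced q φ r g) :
    IsReduced q (FunM.sharp hI φ) (sharpHom r) fun z => conj (g z) where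
  bddBorel := hφ.bddBorel.star
  vanish z hz := by simp [hφ.vanish z hz]
  on_spectrum z := by
    have hqz : conj (evalC q z) = evalC q z := by rw [← evalC_sharpHom, hq]
    simp only [FunM.sharp, hφ.on_spectrum, map_add, map_mul, evalC_sharpHom, hqz]
  on_real z := by
    simp only [FunM.sharp, hφ.on_real, Ideal.quotientMap_mk]
  on_nonreal a := by
    simp only [FunM.sharp, hφ.on_nonreal, Ideal.quotientMap_mk]

theorem isDecomposition {m : ℕ} {p : Fin m → Poly} (hφ : IsReduced (∑ k, p k) φ r g) :
    IsDecomposition p φ r fun _ => g where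
  measurable _ := hφ.bddBorel.measurable
  bounded _ := hφ.bddBorel.bounded
  vanish _ := hφ.vanish
  on_spectrum z := by
    rw [hφ.on_spectrum, evalC_sum, Finset.mul_sum]
    rfl
  on_real z := by
    simp only [hφ.vanish z z.2, zero_smul, Finset.sum_const_zero, add_zero]
    exact hφ.on_real z
  on_nonreal := hφ.on_nonreal

end IsReduced

theorem exists_norm_evalC_le {n : ℕ} {h : Fin n → Poly} (hS : IsCompact S) {f : Poly}
    (hf : f ∈ Ideal.span (Set.range h)) :
    ∃ c : ℝ, 0 ≤ c ∧ ∀ z ∈ S, ‖evalC f z‖ ≤ c * ‖fun j => evalC (h j) z‖ := by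
  obtain ⟨u, hu⟩ := (Ideal.mem_span_range_iff_exists_fun).1 hf
  choose c hc using fun j => hS.exists_bound_of_continuousOn (continuous_evalC (u j)).continuousOn
  refine ⟨∑ j, |c j|, Finset.sum_nonneg fun _ _ => abs_nonneg _, fun z hz => ?_⟩
  rw [← hu, evalC_sum, Finset.sum_mul]
  refine norm_sum_le_of_le _ fun j _ => ?_
  rw [evalC_mul, norm_mul]
  exact mul_le_mul ((hc j z hz).trans (le_abs_self _)) (norm_le_pi_norm (fun j => evalC (h j) z) j)
    (norm_nonneg _) (abs_nonneg _)

/-- `φ - r = g q` with `g` bounded and `q ∈ I ⊆ Q(w)`, so the difference is dominated by any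
generators of `Q(w)`. -/
theorem IsReduced.mem_classF (hS : IsCompact S) {q : Poly} (hq : q ∈ I) {φ : FunM I S} {r : Poly}
    {g : ℂ → ℂ} (hφ : IsReduced q φ r g) : φ ∈ classF I S := by
  obtain ⟨c, hc⟩ := hφ.bddBorel.bounded
  obtain ⟨cr, hcr⟩ := hS.exists_bound_of_continuousOn (continuous_evalC r).continuousOn
  obtain ⟨cq, hcq⟩ := hS.exists_bound_of_continuousOn (continuous_evalC q).continuousOn
  have hc0 : 0 ≤ c := (norm_nonneg _).trans (hc 0)
  refine ⟨?_, ⟨cr + c * cq, fun z => ?_⟩, fun w _ _ => ?_⟩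
  · rw [funext hφ.on_spectrum]
    exact ((continuous_evalC r).measurable.comp measurable_subtype_coe).add
      ((hφ.bddBorel.measurable.comp measurable_subtype_coe).mul
        ((continuous_evalC q).measurable.comp measurable_subtype_coe))
  · rw [hφ.on_spectrum]
    refine (norm_add_le _ _).trans (add_le_add (hcr z z.2.1) ?_)
    rw [norm_mul]
    exact mul_le_mul (hc z) (hcq z z.2.1) (norm_nonneg _) hc0
  · obtain ⟨n, h, hh⟩ := Submodule.fg_iff_exists_fin_generating_family.1
      (IsNoetherian.noetherian (primaryComponent I (tau w)))
    refine ⟨n, h, r, hh, (hφ.on_real w).symm, ?_⟩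
    obtain ⟨d, hd0, hd⟩ := exists_norm_evalC_le (h := h) hS
      (show q ∈ Ideal.span (Set.range h) by
        rw [Ideal.span, hh]; exact le_primaryComponent I _ hq)
    refine Asymptotics.IsBigO.of_bound (c * d) (Eventually.of_forall fun z => ?_)
    rw [hφ.on_spectrum, add_sub_cancel_left, norm_mul, norm_norm, mul_assoc]
    exact mul_le_mul (hc z) (hd z z.2.1) (norm_nonneg _) hc0

variable {m : ℕ} {p : Fin m → Poly}

theorem norm_evalC_tuple_le (hp : ∀ k, ∀ z ∈ S, ‖evalC (p k) z‖ ≤ ‖evalC (∑ k, p k) z‖) {z : ℂ}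
    (hz : z ∈ S) : ‖fun k => evalC (p k) z‖ ≤ ‖evalC (∑ k, p k) z‖ :=
  (pi_norm_le_iff_of_nonneg (norm_nonneg _)).2 fun k => hp k z hz

/-- The domination forces every `p_k` to vanish at `z`, and the `p_k` generate `I`. -/
theorem mem_realVariety_of_evalC_sum_eq_zero (hgen : Ideal.span (Set.range p) = I)
    (hp : ∀ k, ∀ z ∈ S, ‖evalC (p k) z‖ ≤ ‖evalC (∑ k, p k) z‖) {z : ℂ} (hz : z ∈ S)
    (h0 : evalC (∑ k, p k) z = 0) : z ∈ realVariety I := by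
  rw [mem_realVariety_iff]
  intro f hf
  rw [← hgen] at hf
  obtain ⟨u, rfl⟩ := (Ideal.mem_span_range_iff_exists_fun).1 hf
  rw [evalC_sum]
  refine Finset.sum_eq_zero fun k _ => ?_
  have := hp k z hz
  rw [h0, norm_zero, norm_le_zero_iff] at this
  rw [evalC_mul, this, mul_zero]

/-- Near a real point `w` of `V(I)`, generators of `Q(w)` are bounded by a multiple of `∑ p_k`. -/
theorem eventually_norm_evalC_le (hS : IsCompact S) (hgen : Ideal.span (Set.range p) = I)
    (hp : ∀ k, ∀ z ∈ S, ‖evalC (p k) z‖ ≤ ‖evalC (∑ k, p k) z‖) {w : ℂ} {f : Poly}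
    (hf : f ∈ primaryComponent I (tau w)) :
    ∃ c : ℝ, 0 ≤ c ∧ ∀ᶠ z in 𝓝 w, z ∈ S → ‖evalC f z‖ ≤ c * ‖evalC (∑ k, p k) z‖ := by
  -- A `g` not vanishing at `w` carries `f` into `I`. So `|g f|` is bounded by a multiple of `|∑
  -- p_k|` on `S`, while `|g|` stays above half its value at `w` nearby.
  obtain ⟨g, hg, hgf⟩ := hf
  rw [← hgen] at hgf
  obtain ⟨c, hc0, hc⟩ := exists_norm_evalC_le hS hgf
  have hgw : 0 < ‖evalC g w‖ := norm_pos_iff.2 hg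
  have hev : ∀ᶠ z in 𝓝 w, ‖evalC g w‖ / 2 < ‖evalC g z‖ :=
    (continuous_evalC g).norm.continuousAt.eventually_const_lt (half_lt_self hgw)
  refine ⟨c / (‖evalC g w‖ / 2), by positivity, ?_⟩
  filter_upwards [hev] with z hz hzS
  have h1 := (hc z hzS).trans (mul_le_mul_of_nonneg_left (norm_evalC_tuple_le hp hzS) hc0)
  rw [evalC_mul, norm_mul] at h1
  rw [div_mul_eq_mul_div, le_div_iff₀ (by positivity), mul_comm]
  exact (mul_le_mul_of_nonneg_right hz.le (norm_nonneg _)).trans h1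

/-- By compactness of `S` a local bound suffices. The growth condition gives it at accumulation
points in `V_ℝ(I)`, and off `V_ℝ(I)` the sum `∑ p_k` is bounded away from zero. -/
theorem exists_norm_sub_le (hS : IsCompact S) (hgen : Ideal.span (Set.range p) = I)
    (hp : ∀ k, ∀ z ∈ S, ‖evalC (p k) z‖ ≤ ‖evalC (∑ k, p k) z‖) {φ : FunM I S}
    (hφ : φ ∈ classF I S) {r : Poly} (hr : ∀ w, Ideal.Quotient.mk _ r = φ.2.1 w) :
    ∃ c : ℝ, ∀ z : ↥(S \ realVariety I), ‖φ.1 z - evalC r z‖ ≤ c * ‖evalC (∑ k, p k) z‖ := by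
  obtain ⟨-, ⟨b, hb⟩, hloc⟩ := hφ
  obtain ⟨br, hbr⟩ := hS.exists_bound_of_continuousOn (continuous_evalC r).continuousOn
  suffices h : ∃ c : ℝ, ∀ z : ↥(S \ realVariety I), (z : ℂ) ∈ S →
      ‖φ.1 z - evalC r z‖ ≤ c * ‖evalC (∑ k, p k) z‖ by
    obtain ⟨c, hc⟩ := h
    exact ⟨c, fun z => hc z z.2.1⟩
  refine hS.induction_on (p := fun t => ∃ c : ℝ, ∀ z : ↥(S \ realVariety I), (z : ℂ) ∈ t →
      ‖φ.1 z - evalC r z‖ ≤ c * ‖evalC (∑ k, p k) z‖) ⟨0, fun z hz => hz.elim⟩ ?_ ?_ ?_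
  · rintro t t' htt ⟨c, hc⟩
    exact ⟨c, fun z hz => hc z (htt hz)⟩
  · rintro t t' ⟨c, hc⟩ ⟨c', hc'⟩
    refine ⟨max c c', fun z hz => ?_⟩
    rcases hz with hz | hz
    · exact (hc z hz).trans (by gcongr; exact le_max_left _ _)
    · exact (hc' z hz).trans (by gcongr; exact le_max_right _ _)
  · intro w hw
    suffices h : ∃ c : ℝ, ∀ᶠ z in 𝓝 w, ∀ hz : z ∈ S \ realVariety I,
        ‖φ.1 ⟨z, hz⟩ - evalC r z‖ ≤ c * ‖evalC (∑ k, p k) z‖ by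
      obtain ⟨c, hc⟩ := h
      exact ⟨_, mem_nhdsWithin_of_mem_nhds hc, c, fun z hz => hz z.2⟩
    by_cases hwV : w ∈ realVariety I
    · by_cases hacc : AccPt w (𝓟 S)
      · obtain ⟨n, h, q, hh, hq, hO⟩ := hloc ⟨w, hwV⟩ hw hacc
        obtain ⟨c, hc⟩ := hO.bound
        rw [eventually_comap] at hc
        -- The representatives agree modulo `P(w) · Q(w)`; here only agreement modulo `Q(w)` is
        -- used.
        have hrq : q - r ∈ Ideal.span (Set.range h) := by
          rw [hh]
          have h1 := Ideal.Quotient.eq.1 (hq.trans (hr ⟨w, hwV⟩).symm)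
          exact Ideal.mul_le_right h1
        obtain ⟨d, hd0, hd⟩ := exists_norm_evalC_le hS hrq
        have hj : ∀ j, h j ∈ primaryComponent I (tau w) := fun j => by
          have : h j ∈ Ideal.span (Set.range h) := Ideal.subset_span ⟨j, rfl⟩
          rwa [hh] at this
        choose e he0 he using fun j => eventually_norm_evalC_le hS hgen hp (hj j)
        have hall := eventually_all.2 he
        refine ⟨(|c| + d) * ∑ j, e j, ?_⟩
        filter_upwards [hc, hall] with z hz hze hzS
        have h1 := hz ⟨z, hzS⟩ rfl
        rw [norm_norm] at h1
        have h2 : ‖fun j => evalC (h j) z‖ ≤ (∑ j, e j) * ‖evalC (∑ k, p k) z‖ := by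
          refine (pi_norm_le_iff_of_nonneg (mul_nonneg (Finset.sum_nonneg fun j _ => he0 j)
            (norm_nonneg _))).2 fun j => (hze j hzS.1).trans ?_
          gcongr
          exact Finset.single_le_sum (fun j _ => he0 j) (Finset.mem_univ j)
        have h3 := hd z hzS.1
        rw [evalC_sub] at h3
        calc ‖φ.1 ⟨z, hzS⟩ - evalC r z‖
            = ‖(φ.1 ⟨z, hzS⟩ - evalC q z) + (evalC q z - evalC r z)‖ := by
              rw [sub_add_sub_cancel]
          _ ≤ c * ‖fun j => evalC (h j) z‖ + d * ‖fun j => evalC (h j) z‖ :=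
              (norm_add_le _ _).trans (add_le_add h1 h3)
          _ ≤ |c| * ‖fun j => evalC (h j) z‖ + d * ‖fun j => evalC (h j) z‖ := by
              gcongr; exact le_abs_self c
          _ = (|c| + d) * ‖fun j => evalC (h j) z‖ := by ring
          _ ≤ (|c| + d) * ((∑ j, e j) * ‖evalC (∑ k, p k) z‖) := by gcongr
          _ = _ := by ring
      -- Near an isolated point `w` of `S` the only point of `S` is `w`, which lies in `V_ℝ(I)`, so
      -- nothing is left to bound.
      · refine ⟨0, ?_⟩
        rw [accPt_iff_frequently, not_frequently] at hacc
        filter_upwards [hacc] with z hz hzS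
        exact absurd ⟨fun h => hzS.2 (h ▸ hwV), hzS.1⟩ hz
    · have hp0 : 0 < ‖evalC (∑ k, p k) w‖ := norm_pos_iff.2 fun h0 =>
        hwV (mem_realVariety_of_evalC_sum_eq_zero hgen hp hw h0)
      have hev : ∀ᶠ z in 𝓝 w, ‖evalC (∑ k, p k) w‖ / 2 < ‖evalC (∑ k, p k) z‖ :=
        (continuous_evalC _).norm.continuousAt.eventually_const_lt (half_lt_self hp0)
      refine ⟨(|b| + |br|) / (‖evalC (∑ k, p k) w‖ / 2), ?_⟩
      filter_upwards [hev] with z hz hzS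
      rw [div_mul_eq_mul_div, le_div_iff₀ (by positivity)]
      refine mul_le_mul ((norm_sub_le _ _).trans (add_le_add ((hb _).trans (le_abs_self _))
        ((hbr z hzS.1).trans (le_abs_self _)))) hz.le (by positivity) (by positivity)

/-- `r` interpolates the prescribed values in the local algebras. The coefficient is the quotient
`(φ - r) / ∑ p_k` on `S \ V_ℝ(I)`, where the denominator has no zeros, extended by `0`. -/
theorem exists_isReduced [FiniteDimensional ℂ (Poly ⧸ I)] (hS : IsCompact S)
    (hgen : Ideal.span (Set.range p) = I)
    (hp : ∀ k, ∀ z ∈ S, ‖evalC (p k) z‖ ≤ ‖evalC (∑ k, p k) z‖) {φ : FunM I S}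
    (hφ : φ ∈ classF I S) : ∃ r g, IsReduced (∑ k, p k) φ r g := by
  classical
  obtain ⟨r, hr, hr'⟩ := exists_poly_interpolate φ.2.1 φ.2.2
  obtain ⟨c, hc⟩ := exists_norm_sub_le hS hgen hp hφ hr
  have hm : MeasurableSet (S \ realVariety I) :=
    hS.measurableSet.diff finite_realVariety.measurableSet
  refine ⟨r, fun z => if hz : z ∈ S \ realVariety I then
    (φ.1 ⟨z, hz⟩ - evalC r z) / evalC (∑ k, p k) z else 0, ⟨?_, |c|, fun z => ?_⟩, fun z hz => ?_,
    fun z => ?_, fun z => (hr z).symm, fun a => (hr' a).symm⟩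
  · refine Measurable.dite (s := S \ realVariety I)
      (f := fun z => (φ.1 z - evalC r z) / evalC (∑ k, p k) z) (g := fun _ => 0) ?_
      measurable_const hm
    exact (hφ.1.sub ((continuous_evalC r).measurable.comp measurable_subtype_coe)).div
      ((continuous_evalC _).measurable.comp measurable_subtype_coe)
  · by_cases hz : z ∈ S \ realVariety I
    · rw [dif_pos hz, norm_div]
      refine div_le_of_le_mul₀ (norm_nonneg _) (abs_nonneg _) ((hc ⟨z, hz⟩).trans ?_)
      gcongr
      exact le_abs_self c
    · rw [dif_neg hz, norm_zero]
      exact abs_nonneg _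
  · rw [dif_neg fun h => h.2 hz]
  · have hz0 : evalC (∑ k, p k) z ≠ 0 := fun h0 =>
      z.2.2 (mem_realVariety_of_evalC_sum_eq_zero hgen hp z.2.1 h0)
    rw [dif_pos z.2, div_mul_cancel₀ _ hz0]
    ring

end ClassF

end KreinNormal

namespace KreinNormal

/-! ### The functional calculus as an algebra homomorphism -/

section FunctionalCalculus

variable {K : Type*} [NormedAddCommGroup K] [InnerProductSpace ℂ K] [CompleteSpace K]
  [KreinSpace K] {N : K →L[ℂ] K} {m : ℕ} {p : Fin m → Poly}
  (hp : ∀ k, FormNonneg (polyAt N (p k))) {I : Ideal Poly}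

theorem evalC_sum_eq_zero_of_mem (hgen : Ideal.span (Set.range p) = I) {z : ℂ}
    (hz : z ∈ realVariety I) : evalC (∑ k, p k) z = 0 := by
  refine mem_realVariety_iff.1 hz _ (Ideal.sum_mem _ fun k _ => ?_)
  rw [← hgen]
  exact Ideal.subset_span ⟨k, rfl⟩

theorem sum_mem_of_span_eq (hgen : Ideal.span (Set.range p) = I) : ∑ k, p k ∈ I := by
  refine Ideal.sum_mem _ fun k _ => ?_
  rw [← hgen]
  exact Ideal.subset_span ⟨k, rfl⟩

/-- The operator `r(A, B) + T (∫ g dE) T⁺` depends only on the function `r_N + g (∑ p_k)_N`. -/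
theorem totalPsi_eq_of_isReduced (hN : IsKreinNormal N) [FiniteDimensional ℂ (Poly ⧸ I)]
    (hgen : Ideal.span (Set.range p) = I) {φ : FunM I (hilbertSpectrum N p hp)} {r r' : Poly}
    {g g' : ℂ → ℂ} (h : IsReduced (∑ k, p k) φ r g) (h' : IsReduced (∑ k, p k) φ r' g') :
    totalPsi hp r g = totalPsi hp r' g' := by
  have hle := fun k z hz => norm_evalC_le_norm_evalC_sum hp hN k (z := z) hz
  obtain ⟨s, hs0, hs⟩ := exists_eq_sum_of_mem hgen (r := r' - r)
    (fun z hz => Ideal.Quotient.eq.1 ((h'.on_real ⟨z, hz⟩).symm.trans (h.on_real ⟨z, hz⟩)))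
    (fun a ha => Ideal.Quotient.eq.1 ((h'.on_nonreal ⟨a, ha⟩).symm.trans (h.on_nonreal ⟨a, ha⟩)))
  obtain ⟨hb, hP⟩ := polyAt_eq_totalIntegral hp hN hs fun j z hz h0 =>
    hs0 j z (mem_realVariety_of_evalC_sum_eq_zero hgen hle hz h0)
  have hE := spectralMeasure_totalTheta hp hN
  set u : ℂ → ℂ := (hilbertSpectrum N p hp).indicator
    fun z => evalC (r' - r) z / evalC (∑ k, p k) z with hu
  -- Off `V_ℝ(I)`, equating the two expressions for `φ` gives `g = (r' - r) / ∑ p_k + g'`. On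
  -- `V_ℝ(I)` all three terms are `0`, the quotient by `x / 0 = 0`.
  have hcongr : totalIntegral hp g = totalIntegral hp (u + g') := by
    refine hE.integral_congr h.bddBorel (hb.add h'.bddBorel) fun z hz => ?_
    have hzS : z ∈ hilbertSpectrum N p hp := hz
    rw [Pi.add_apply, hu, Set.indicator_of_mem hzS]
    by_cases hzV : z ∈ realVariety I
    · rw [h.vanish z hzV, h'.vanish z hzV, evalC_sum_eq_zero_of_mem hgen hzV, div_zero, add_zero]
    · have h0 : evalC (∑ k, p k) z ≠ 0 := fun h0 =>
        hzV (mem_realVariety_of_evalC_sum_eq_zero hgen hle hzS h0)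
      have e1 := h.on_spectrum ⟨z, hzS, hzV⟩
      have e2 := h'.on_spectrum ⟨z, hzS, hzV⟩
      simp only at e1 e2
      rw [evalC_sub]
      field_simp
      linear_combination e2 - e1
  -- Both operators turn out to be `totalPsi hp r g'` plus `(r' - r)(A, B)`, the latter being `T (∫
  -- u dE) T⁺`.
  have h1 := totalPsi_add hp hN r 0 h'.bddBorel hb
  have h2 := totalPsi_add hp hN r (r' - r) h'.bddBorel BddBorel.zero
  have h3 : totalPsi hp 0 u = polyAt N (r' - r) := by
    have hz : polyAt N 0 = 0 := by rw [← polyHom_eq_polyAt hN, map_zero]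
    rw [totalPsi, hz, zero_add, hP]
  rw [totalPsi_zero_right, add_zero, add_sub_cancel] at h2
  rw [add_zero, h3] at h1
  rw [h2, ← h1, totalPsi, totalPsi, hcongr, add_comm u]

/-- Off its zeros the factor `∑ p_j` can be extracted from `∑ f_k p_k`; the coefficients stay
bounded because `|p_k / ∑ p_j| ≤ 1` on `S`. -/
theorem isReduced_of_isDecomposition (hN : IsKreinNormal N)
    (hgen : Ideal.span (Set.range p) = I) {φ : FunM I (hilbertSpectrum N p hp)} {r : Poly}
    {f : Fin m → ℂ → ℂ} (h : IsDecomposition p φ r f) :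
    IsReduced (∑ k, p k) φ r (∑ k, ratio hp k (f k)) where
  bddBorel := BddBorel.sum _ fun k _ => bddBorel_ratio hp hN k ⟨h.measurable k, h.bounded k⟩
  vanish z hz := by
    rw [Finset.sum_apply]
    refine Finset.sum_eq_zero fun k _ => ?_
    rw [ratio]
    exact Set.indicator_apply_eq_zero.2 fun _ => by rw [h.vanish k z hz, zero_mul]
  on_spectrum z := by
    have h0 : evalC (∑ k, p k) z ≠ 0 := fun h0 => z.2.2
      (mem_realVariety_of_evalC_sum_eq_zero hgen
        (fun k z hz => norm_evalC_le_norm_evalC_sum hp hN k hz) z.2.1 h0)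
    rw [h.on_spectrum, Finset.sum_apply, Finset.sum_mul]
    congr 1
    refine Finset.sum_congr rfl fun k _ => ?_
    rw [ratio, Set.indicator_of_mem z.2.1, mul_assoc, div_mul_cancel₀ _ h0]
    rfl
  on_real z := by
    rw [h.on_real z]
    simp only [h.vanish _ z z.2, zero_smul, Finset.sum_const_zero, add_zero]
    rfl
  on_nonreal := h.on_nonreal

theorem Psi_eq_of_isDecomposition (hN : IsKreinNormal N) (hgen : Ideal.span (Set.range p) = I)
    {φ : FunM I (hilbertSpectrum N p hp)} {r : Poly} {f : Fin m → ℂ → ℂ}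
    (h : IsDecomposition p φ r f) :
    Psi N p hp r f = totalPsi hp r (∑ k, ratio hp k (f k)) := by
  refine Psi_eq_totalPsi hp hN r (fun k => ⟨h.measurable k, h.bounded k⟩) fun k z hz h0 => ?_
  exact h.vanish k z (mem_realVariety_of_evalC_sum_eq_zero hgen
    (fun k z hz => norm_evalC_le_norm_evalC_sum hp hN k hz) hz h0)

/-- Closure of `ℱ_N` under sums, products and `#` is read off from the pairs `(r, g)` instead of the
growth condition. -/
theorem mem_classF_iff (hN : IsKreinNormal N) [FiniteDimensional ℂ (Poly ⧸ I)]
    (hgen : Ideal.span (Set.range p) = I) {φ : FunM I (hilbertSpectrum N p hp)} :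
    φ ∈ classF I (hilbertSpectrum N p hp) ↔ ∃ r g, IsReduced (∑ k, p k) φ r g :=
  ⟨exists_isReduced (isCompact_hilbertSpectrum hp) hgen
    fun k _ hz => norm_evalC_le_norm_evalC_sum hp hN k hz,
   fun ⟨_, _, h⟩ => h.mem_classF (isCompact_hilbertSpectrum hp) (sum_mem_of_span_eq hgen)⟩

/-- The class `ℱ_N` as a subalgebra of `ℳ_N`. -/
def subalgebraF (hN : IsKreinNormal N) [FiniteDimensional ℂ (Poly ⧸ I)]
    (hgen : Ideal.span (Set.range p) = I) :
    Subalgebra ℂ (FunM I (hilbertSpectrum N p hp)) where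
  carrier := classF I (hilbertSpectrum N p hp)
  mul_mem' {φ ψ} hφ hψ := by
    obtain ⟨r, g, h⟩ := (mem_classF_iff hp hN hgen).1 hφ
    obtain ⟨s, k, h'⟩ := (mem_classF_iff hp hN hgen).1 hψ
    exact (mem_classF_iff hp hN hgen).2 ⟨_, _, h.mul (isCompact_hilbertSpectrum hp) h'⟩
  add_mem' {φ ψ} hφ hψ := by
    obtain ⟨r, g, h⟩ := (mem_classF_iff hp hN hgen).1 hφ
    obtain ⟨s, k, h'⟩ := (mem_classF_iff hp hN hgen).1 hψ
    exact (mem_classF_iff hp hN hgen).2 ⟨_, _, h.add h'⟩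
  algebraMap_mem' c := (mem_classF_iff hp hN hgen).2 ⟨_, _, IsReduced.algebraMap _ c⟩

/-- The functional calculus `φ ↦ φ(N)`. -/
theorem exists_functionalCalculus (hN : IsKreinNormal N) [FiniteDimensional ℂ (Poly ⧸ I)]
    (hgen : Ideal.span (Set.range p) = I) :
    ∃ Φ : subalgebraF hp hN hgen →ₐ[ℂ] (K →L[ℂ] K),
      ∀ (φ : subalgebraF hp hN hgen) (r : Poly) (g : ℂ → ℂ),
        IsReduced (∑ k, p k) φ.1 r g → Φ φ = totalPsi hp r g := by
  have hex := fun φ : subalgebraF hp hN hgen => (mem_classF_iff hp hN hgen).1 φ.2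
  choose r g hrg using hex
  -- The chosen representatives are immaterial, so each algebraic law can be checked on whichever
  -- pair is convenient.
  have key : ∀ (φ : subalgebraF hp hN hgen) (r' : Poly) (g' : ℂ → ℂ),
      IsReduced (∑ k, p k) φ.1 r' g' → totalPsi hp (r φ) (g φ) = totalPsi hp r' g' :=
    fun φ _ _ h => totalPsi_eq_of_isReduced hp hN hgen (hrg φ) h
  have halg : ∀ c, totalPsi hp (r (algebraMap ℂ _ c)) (g (algebraMap ℂ _ c)) =
      algebraMap ℂ (K →L[ℂ] K) c := by
    intro c
    rw [key _ _ _ (IsReduced.algebraMap _ c), totalPsi_zero_right, ← polyHom_eq_polyAt hN,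
      AlgHom.commutes]
  refine ⟨{ toFun := fun φ => totalPsi hp (r φ) (g φ)
            map_one' := by simpa using halg 1
            map_mul' := fun φ ψ => by
              rw [key _ _ _ ((hrg φ).mul (isCompact_hilbertSpectrum hp) (hrg ψ)),
                totalPsi_mul hp hN _ _ (hrg φ).bddBorel (hrg ψ).bddBorel]
            map_zero' := by simpa using halg 0
            map_add' := fun φ ψ => by
              rw [key _ _ _ ((hrg φ).add (hrg ψ)),
                totalPsi_add hp hN _ _ (hrg φ).bddBorel (hrg ψ).bddBorel]
            commutes' := halg }, key⟩

theorem sharpHom_eq_self {q : Poly} (hq : IsRealPoly q) : sharpHom q = q := by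
  ext s
  rw [sharpHom, MvPolynomial.coeff_map]
  exact Complex.conj_eq_iff_im.2 (hq s)

end FunctionalCalculus

end KreinNormal

end

/-! ### The main theorem -/

open KreinNormal
theorem mainTheorem1 {K : Type*} [NormedAddCommGroup K] [InnerProductSpace ℂ K] [CompleteSpace K]
    [KreinSpace K] (N : K →L[ℂ] K) (hN : IsKreinNormal N)
    (hI : FiniteDimensional ℂ (Poly ⧸ definitizingIdeal N))
    {m : ℕ} (p : Fin m → Poly)
    (hreal : ∀ k, IsRealPoly (p k)) (hdef : ∀ k, IsDefinitizing N (p k))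
    (hgen : Ideal.span (Set.range p) = definitizingIdeal N) :
    ∃ (F : Subalgebra ℂ (FunM (definitizingIdeal N) (hilbertSpectrum N p fun k => (hdef k).2)))
      (Φ : F →ₐ[ℂ] (K →L[ℂ] K)),
      (F : Set (FunM (definitizingIdeal N) (hilbertSpectrum N p fun k => (hdef k).2))) =
        classF (definitizingIdeal N) (hilbertSpectrum N p fun k => (hdef k).2) ∧
      (∀ φ : F, ∃ r f, IsDecomposition p φ.1 r f) ∧
      (∀ (φ : F) r f, IsDecomposition p φ.1 r f →
        Φ φ = Psi N p (fun k => (hdef k).2) r f) ∧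
      (∀ φ : F, Φ φ ∈ bicommutant N) ∧
      (∀ φ : F, ∃ h : FunM.sharp (definitizingIdeal_sharp N) φ.1 ∈ F,
        Φ ⟨FunM.sharp (definitizingIdeal_sharp N) φ.1, h⟩ = kreinAdjoint (Φ φ)) ∧
      (∀ q : Poly, ∃ h : polyN _ _ q ∈ F, Φ ⟨polyN _ _ q, h⟩ = polyAt N q) := by
  obtain ⟨Φ, hΦ⟩ := exists_functionalCalculus (fun k => (hdef k).2) hN hgen
  have hex := fun φ : subalgebraF (fun k => (hdef k).2) hN hgen =>
    (mem_classF_iff (fun k => (hdef k).2) hN hgen).1 φ.2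
  refine ⟨subalgebraF (fun k => (hdef k).2) hN hgen, Φ, rfl, fun φ => ?_, fun φ r f h => ?_,
    fun φ => ?_, fun φ => ?_, fun q => ?_⟩
  · obtain ⟨r, g, h⟩ := hex φ
    exact ⟨r, _, h.isDecomposition⟩
  · rw [Psi_eq_of_isDecomposition _ hN hgen h]
    exact hΦ φ _ _ (isReduced_of_isDecomposition _ hN hgen h)
  · obtain ⟨r, g, h⟩ := hex φ
    rw [hΦ φ r g h]
    exact totalPsi_mem_bicommutant _ hN r h.bddBorel
  · obtain ⟨r, g, h⟩ := hex φ
    -- Real coefficients enter here: `∑ p_k` is fixed by `#`, so conjugating `r + g ∑ p_k`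
    -- conjugates `r` and `g` only.
    have hsum : sharpHom (∑ k, p k) = ∑ k, p k := by
      rw [map_sum]
      exact Finset.sum_congr rfl fun k _ => sharpHom_eq_self (hreal k)
    have hs := h.sharp (definitizingIdeal_sharp N) hsum
    refine ⟨(mem_classF_iff _ hN hgen).2 ⟨_, _, hs⟩, ?_⟩
    rw [hΦ φ r g h, kreinAdjoint_totalPsi _ hN r h.bddBorel]
    exact hΦ _ _ _ hs
  · have h := IsReduced.polyN (I := definitizingIdeal N)
      (S := hilbertSpectrum N p fun k => (hdef k).2) (∑ k, p k) q
    refine ⟨(mem_classF_iff _ hN hgen).2 ⟨_, _, h⟩, ?_⟩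
    rw [hΦ _ _ _ h, totalPsi_zero_right]
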